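/- Let $p$ be an odd prime and let $G$ be the cyclic group of order $p$ generated by $g=\begin{pmatrix}1&1\\0&1\end{pmatrix}$ acting on $V=\mathbb F_p^2$ with basis $v_1,v_2$, so ${}^gv_1=v_1$ and ${}^gv_2=v_1+v_2$. For bilinear maps $\lambda:\mathbb F_pG\times V\to\mathbb F_pG$ and $\kappa:V\times V\to\mathbb F_pG\oplus(V\otimes\mathbb F_pG)$ let $\mathcal H_{\lambda,\kappa}$ be the $\mathbb F_p$-algebra generated by the algebra $\mathbb F_pG$ and the vector space $V$ subject to the relations $hv={}^hv\,h+\lambda(h,v)$ and $vw-wv=\kappa(v,w)$ for $h\in G$ and $v,w\in V$ (where $v\otimes a$ is read as $va$), filtered by giving vectors degree $1$ and group elements degree $0$. Call $\mathcal H_{\lambda,\kappa}$ a Drinfeld orbifold algebra (a PBW deformation of $S(V)\rtimes G$) if $\operatorname{gr}\mathcal H_{\lambda,\kappa}\cong S(V)\rtimes G$ as graded algebras. Write $\kappa=\kappa^C+\kappa^L$ for the components of $\kappa$ in $\mathbb F_pG$ and $V\otimes\mathbb F_pG$. Two pairs $(\lambda,\kappa)$ differ by a coboundary if they have the same $\kappa^C$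 and there is a linear map $f:V\to\mathbb F_pG$ such that $\lambda$ changes by $(h,v)\mapsto hf(v)-f({}^hv)h$ $(h\in G)$ and $\kappa^L$ changes by $(v,w)\mapsto (vf(w)-f(w)v)-(wf(v)-f(v)w)$, computed in $S(V)\rtimes G$. Make the following choices: an integer $0\le k\le p$ and an element $b=\sum_{j=0}^{p-1}b_jg^j\in\mathbb F_pG$ of the form $b=(g-1)^k\tilde b$, where $\tilde b=\sum_i\tilde b_ig^i\in\mathbb F_pG$ has $\sum_i\tilde b_i\ne0$; elements $d_1,\dots,d_k\in\mathbb F_p$; and an arbitrary element $\kappa^C\in\mathbb F_pG$. For $0\le j\le p-1$ put $$\mu(\mathbf d,j)=(-1)^{p-j}\sum_{m=1}^{k}(-1)^{m+1}\binom{p-m}{p-j}d_m .$$ Let $\lambda$ be the bilinear map and $\kappa$ the alternating bilinear map determined by $$\lambda(g^i,v_1)=i\,b\,g^i,$$ $$\lambda(g^i,v_2)=\sum_{j=0}^{p-1}\left(\binom i2+i\,j^{p-2}\binom{j+1}2\right)b_j\,g^{i+j}+i\sum_{j=0}^{p-1}j^{p-2}\mu(\mathbf d,j)\,g^{i+j}$$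 for $0\le i\le p-1$, and $$\kappa(v_1,v_2)=\left(\sum_{m=1}^{k}(-1)^{m+1}d_m\right)v_1+\sum_{j=0}^{p-1}j\,b_j\,v_2\,g^j+\kappa^C .$$ Then $\mathcal H_{\lambda,\kappa}$ is a Drinfeld orbifold algebra. Conversely, for every Drinfeld orbifold algebra $\mathcal H_{\lambda',\kappa'}$ there is exactly one choice of $(k,b,d_1,\dots,d_k,\kappa^C)$ whose $(\lambda,\kappa)$ differs from $(\lambda',\kappa')$ by a coboundary. Up to coboundary, there are exactly $p^{2p+1}$ Drinfeld orbifold algebras. -/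

import Mathlib

open TensorProduct

noncomputable section

namespace DrinfeldOrbifold

/-! ### The associated graded ring of a filtered algebra -/

section AssociatedGraded

variable {F A : Type*} [CommRing F] [Ring A] [Algebra F A]

/-- The sum of all the filtration pieces of index smaller than `n`. -/
def filLT (Fil : ℕ → Submodule F A) (n : ℕ) : Submodule F A :=
  ⨆ m : Fin n, Fil m

/-- The `n`-th piece `Fil n / Fil (n - 1)` of the associated graded ring. -/
abbrev Gr (Fil : ℕ → Submodule F A) (n : ℕ) : Type _ :=
  Fil n ⧸ (filLT Fil n).submoduleOf (Fil n)

variable (Fil : ℕ → Submodule F A)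

/-- The class of an element of `Fil n` in the `n`-th graded piece. -/
def Gr.mk (n : ℕ) : Fil n →ₗ[F] Gr Fil n := Submodule.mkQ _

theorem Gr.mk_surjective (n : ℕ) : Function.Surjective (Gr.mk Fil n) := Submodule.mkQ_surjective _

theorem Gr.mk_eq_zero {n : ℕ} {x : Fil n} (hx : (x : A) ∈ filLT Fil n) : Gr.mk Fil n x = 0 :=
  (Submodule.Quotient.mk_eq_zero _).2 hx

theorem Gr.sigma_ext {i j : ℕ} (h : i = j) (x : Fil i) (y : Fil j) (hxy : (x : A) = y) :
    (GradedMonoid.mk i (Gr.mk Fil i x) : GradedMonoid (Gr Fil)) =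
      GradedMonoid.mk j (Gr.mk Fil j y) := by
  subst h
  rw [Subtype.ext hxy]

variable [SetLike.GradedMonoid Fil]

theorem filLT_mul_left {i j : ℕ} {x y : A} (hx : x ∈ filLT Fil i) (hy : y ∈ Fil j) :
    x * y ∈ filLT Fil (i + j) := by
  have : filLT Fil i ≤ (filLT Fil (i + j)).comap (LinearMap.mulRight F y) := by
    refine iSup_le fun m z hz => ?_
    have h := SetLike.mul_mem_graded hz hy
    exact (le_iSup (fun l : Fin (i + j) => Fil l) ⟨m + j, by omega⟩) h
  exact this hx

theorem filLT_mul_right {i j : ℕ} {x y : A} (hx : x ∈ Fil i) (hy : y ∈ filLT Fil j) :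
    x * y ∈ filLT Fil (i + j) := by
  have : filLT Fil j ≤ (filLT Fil (i + j)).comap (LinearMap.mulLeft F x) := by
    refine iSup_le fun m z hz => ?_
    have h := SetLike.mul_mem_graded hx hz
    exact (le_iSup (fun l : Fin (i + j) => Fil l) ⟨i + m, by omega⟩) h
  exact this hy

/-- Multiplication `Fil i × Fil j → Fil (i + j) / Fil (i + j - 1)`. -/
def Gr.mulAux (i j : ℕ) : Fil i →ₗ[F] Fil j →ₗ[F] Gr Fil (i + j) :=
  LinearMap.mk₂ F (fun x y => Gr.mk Fil (i + j) ⟨x * y, SetLike.mul_mem_graded x.2 y.2⟩)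
    (fun x x' y => by rw [← map_add]; congr 1; ext; simp [add_mul])
    (fun c x y => by rw [← map_smul]; congr 1; ext; simp)
    (fun x y y' => by rw [← map_add]; congr 1; ext; simp [mul_add])
    (fun c x y => by rw [← map_smul]; congr 1; ext; simp)

/-- Multiplication of the associated graded ring: the class of `x` times the class of `y` is the
class of `x * y`. -/
def Gr.mul (i j : ℕ) : Gr Fil i →ₗ[F] Gr Fil j →ₗ[F] Gr Fil (i + j) :=
  Submodule.liftQ _
    { toFun := fun x => Submodule.liftQ _ (Gr.mulAux Fil i j x) (fun y hy => by
        rw [LinearMap.mem_ker]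
        exact Gr.mk_eq_zero Fil (filLT_mul_right Fil x.2 hy))
      map_add' := fun x x' => by
        refine Submodule.linearMap_qext _ (LinearMap.ext fun y => ?_)
        simp
      map_smul' := fun c x => by
        refine Submodule.linearMap_qext _ (LinearMap.ext fun y => ?_)
        simp }
    (fun x hx => by
      rw [LinearMap.mem_ker]
      refine Submodule.linearMap_qext _ (LinearMap.ext fun y => ?_)
      exact Gr.mk_eq_zero Fil (filLT_mul_left Fil hx y.2))

theorem Gr.mul_mk {i j : ℕ} (x : Fil i) (y : Fil j) :
    Gr.mul Fil i j (Gr.mk Fil i x) (Gr.mk Fil j y) =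
      Gr.mk Fil (i + j) ⟨x * y, SetLike.mul_mem_graded x.2 y.2⟩ := rfl

instance : GradedMonoid.GMul (Gr Fil) where
  mul x y := Gr.mul Fil _ _ x y

instance : GradedMonoid.GOne (Gr Fil) where
  one := Gr.mk Fil 0 ⟨1, SetLike.one_mem_graded Fil⟩

instance : GradedMonoid.GMonoid (Gr Fil) where
  one_mul := fun ⟨i, x⟩ => by
    obtain ⟨x, rfl⟩ := Gr.mk_surjective Fil i x
    exact Gr.sigma_ext Fil (zero_add i) _ _ (one_mul _)
  mul_one := fun ⟨i, x⟩ => by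
    obtain ⟨x, rfl⟩ := Gr.mk_surjective Fil i x
    exact Gr.sigma_ext Fil (add_zero i) _ _ (mul_one _)
  mul_assoc := fun ⟨i, x⟩ ⟨j, y⟩ ⟨k, z⟩ => by
    obtain ⟨x, rfl⟩ := Gr.mk_surjective Fil i x
    obtain ⟨y, rfl⟩ := Gr.mk_surjective Fil j y
    obtain ⟨z, rfl⟩ := Gr.mk_surjective Fil k z
    exact Gr.sigma_ext Fil (add_assoc i j k) _ _ (mul_assoc _ _ _)

instance : DirectSum.GSemiring (Gr Fil) where
  mul_zero := fun x => map_zero (Gr.mul Fil _ _ x)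
  zero_mul := fun y => LinearMap.map_zero₂ (Gr.mul Fil _ _) y
  mul_add := fun x y z => map_add (Gr.mul Fil _ _ x) y z
  add_mul := fun x y z => LinearMap.map_add₂ (Gr.mul Fil _ _) x y z
  natCast := fun n => n • GradedMonoid.GOne.one
  natCast_zero := zero_smul _ _
  natCast_succ := fun n => succ_nsmul _ n

end AssociatedGraded

/-! ### The skew group algebra `S(V) ⋊ G` -/

section Skew

variable (F G V : Type*) [CommRing F] [Group G] [AddCommGroup V] [Module F V]
  [DistribMulAction G V] [SMulCommClass G F V]

/-- A group element acting linearly on `V` acts on `S(V)` by an algebra endomorphism. -/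
def symAct (h : G) : SymmetricAlgebra F V →ₐ[F] SymmetricAlgebra F V :=
  SymmetricAlgebra.lift (SymmetricAlgebra.ι F V ∘ₗ DistribSMul.toLinearMap F V h)

theorem symAct_ι (h : G) (v : V) :
    symAct F G V h (SymmetricAlgebra.ι F V v) = SymmetricAlgebra.ι F V (h • v) := by
  simp [symAct]

/-- The action of `G` on `S(V)` by automorphisms extending the linear action on `V`. -/
instance symMulSemiringAction : MulSemiringAction G (SymmetricAlgebra F V) where
  smul h s := symAct F G V h s
  one_smul s := by
    have : symAct F G V 1 = AlgHom.id F _ := by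
      refine SymmetricAlgebra.algHom_ext (LinearMap.ext fun v => ?_)
      simp [symAct_ι]
    exact DFunLike.congr_fun this s
  mul_smul h h' s := by
    have : symAct F G V (h * h') = (symAct F G V h).comp (symAct F G V h') := by
      refine SymmetricAlgebra.algHom_ext (LinearMap.ext fun v => ?_)
      simp [symAct_ι, mul_smul]
    exact DFunLike.congr_fun this s
  smul_zero h := map_zero (symAct F G V h)
  smul_add h := map_add (symAct F G V h)
  smul_one h := map_one (symAct F G V h)
  smul_mul h := map_mul (symAct F G V h)

/-- The skew group algebra `S(V) ⋊ G`, with `(s h) (s' h') = (s (h • s')) (h h')`. -/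
abbrev SkewGroupAlgebra : Type _ := SkewMonoidAlgebra (SymmetricAlgebra F V) G

/-- The degree `n` part of `S(V) ⋊ G`: spanned by all `s h` with `s ∈ S(V)` homogeneous of
degree `n` and `h ∈ G`. -/
def skewGrade (n : ℕ) : Submodule F (SkewGroupAlgebra F G V) :=
  Submodule.span F {x | ∃ (h : G) (s : SymmetricAlgebra F V),
    s ∈ (LinearMap.range (SymmetricAlgebra.ι F V)) ^ n ∧ x = SkewMonoidAlgebra.single h s}

end Skew

/-! ### The algebras `H_{λ,κ}` -/

section Algebras

variable (F G V : Type*) [CommRing F] [Group G] [AddCommGroup V] [Module F V]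

/-- A pair of bilinear parameter functions `λ : FG × V → FG` and `κ : V × V → FG ⊕ (V ⊗ FG)`. -/
@[ext]
structure Params where
  lam : MonoidAlgebra F G →ₗ[F] V →ₗ[F] MonoidAlgebra F G
  kap : V →ₗ[F] V →ₗ[F] MonoidAlgebra F G × (V ⊗[F] MonoidAlgebra F G)

/-- The free algebra on the vector space `FG ⊕ V`. -/
abbrev Free : Type _ := TensorAlgebra F (MonoidAlgebra F G × V)

/-- The inclusion of the generators `FG`. -/
def freeG : MonoidAlgebra F G →ₗ[F] Free F G V :=
  TensorAlgebra.ι F ∘ₗ LinearMap.inl F (MonoidAlgebra F G) V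

/-- The inclusion of the generators `V`. -/
def freeV : V →ₗ[F] Free F G V :=
  TensorAlgebra.ι F ∘ₗ LinearMap.inr F (MonoidAlgebra F G) V

/-- The linear map sending `v ⊗ a` to the product `v a`. -/
def freeVG : V ⊗[F] MonoidAlgebra F G →ₗ[F] Free F G V :=
  TensorProduct.lift ((LinearMap.mul F (Free F G V)).compl₁₂ (freeV F G V) (freeG F G V))

variable {F G V}
variable [DistribMulAction G V]

/-- The defining relations of `H_{λ,κ}`. The first two say that the generators from `FG` multiply
as in the group algebra, so that they present the free product of `T(V)` and `FG`; the other two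
are `h v = (h • v) h + λ(h, v)` and `v w - w v = κ(v, w)`. -/
inductive Rel (P : Params F G V) : Free F G V → Free F G V → Prop
  | group_one : Rel P (freeG F G V 1) 1
  | group_mul (a b : MonoidAlgebra F G) :
      Rel P (freeG F G V (a * b)) (freeG F G V a * freeG F G V b)
  | group_vec (h : G) (v : V) :
      Rel P (freeG F G V (.single h 1) * freeV F G V v)
        (freeV F G V (h • v) * freeG F G V (.single h 1) + freeG F G V (P.lam (.single h 1) v))
  | vec_vec (v w : V) :
      Rel P (freeV F G V v * freeV F G V w - freeV F G V w * freeV F G V v)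
        (freeG F G V (P.kap v w).1 + freeVG F G V (P.kap v w).2)

/-- The algebra `H_{λ,κ}`. -/
def H (P : Params F G V) : Type _ := RingQuot (Rel P)

instance (P : Params F G V) : Ring (H P) := inferInstanceAs (Ring (RingQuot (Rel P)))

instance (P : Params F G V) : Algebra F (H P) := inferInstanceAs (Algebra F (RingQuot (Rel P)))

/-- The quotient map onto `H_{λ,κ}`. -/
def H.mk (P : Params F G V) : Free F G V →ₐ[F] H P := RingQuot.mkAlgHom F (Rel P)

theorem H.mk_rel (P : Params F G V) {x y : Free F G V} (h : Rel P x y) : H.mk P x = H.mk P y :=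
  RingQuot.mkAlgHom_rel F h

/-- The image of `FG` in `H_{λ,κ}`. -/
def HG (P : Params F G V) : Submodule F (H P) :=
  LinearMap.range ((H.mk P).toLinearMap ∘ₗ freeG F G V)

/-- The image of `V` in `H_{λ,κ}`. -/
def HV (P : Params F G V) : Submodule F (H P) :=
  LinearMap.range ((H.mk P).toLinearMap ∘ₗ freeV F G V)

/-- The filtration of `H_{λ,κ}` by degree, where vectors have degree `1` and group elements have
degree `0`: the `n`-th piece is the span of all `a₀ w₁ a₁ ⋯ w_m a_m` with `m ≤ n`, `a_i ∈ FG`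
and `w_i ∈ V`. -/
def fil (P : Params F G V) : ℕ → Submodule F (H P)
  | 0 => HG P
  | n + 1 => fil P n ⊔ fil P n * HV P * HG P

theorem one_mem_HG (P : Params F G V) : (1 : H P) ∈ HG P :=
  ⟨1, by simpa using H.mk_rel P (Rel.group_one (P := P))⟩

theorem HG_mul_HG (P : Params F G V) : HG P * HG P ≤ HG P := by
  rw [Submodule.mul_le]
  rintro _ ⟨a, rfl⟩ _ ⟨b, rfl⟩
  exact ⟨a * b, by simpa using H.mk_rel P (Rel.group_mul (P := P) a b)⟩

theorem fil_mul_HG (P : Params F G V) (n : ℕ) : fil P n * HG P ≤ fil P n := by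
  induction n with
  | zero => exact HG_mul_HG P
  | succ n ih =>
    simp only [fil]
    rw [Submodule.sup_mul]
    refine sup_le_sup ih ?_
    rw [mul_assoc]
    exact mul_le_mul' le_rfl (HG_mul_HG P)

theorem fil_mul_fil (P : Params F G V) (m n : ℕ) : fil P m * fil P n ≤ fil P (m + n) := by
  induction n with
  | zero => exact fil_mul_HG P m
  | succ n ih =>
    rw [← add_assoc]
    simp only [fil]
    rw [Submodule.mul_sup, ← mul_assoc, ← mul_assoc]
    exact sup_le_sup ih (mul_le_mul' (mul_le_mul' ih le_rfl) le_rfl)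

instance (P : Params F G V) : SetLike.GradedMonoid (fil P) where
  one_mem := one_mem_HG P
  mul_mem _ _ _ _ hx hy := fil_mul_fil P _ _ (Submodule.mul_mem_mul hx hy)

/-- The associated graded algebra of `H_{λ,κ}`. -/
abbrev grH (P : Params F G V) : Type _ := DirectSum ℕ (Gr (fil P))

/-- `H_{λ,κ}` is a Drinfeld orbifold algebra, i.e. a PBW deformation of `S(V) ⋊ G`: its associated
graded algebra is isomorphic to `S(V) ⋊ G` as a graded `F`-algebra. -/
def IsDrinfeldOrbifold [SMulCommClass G F V] (P : Params F G V) : Prop :=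
  ∃ e : grH P ≃+* SkewGroupAlgebra F G V,
    (∀ (c : F) (x : grH P), e (c • x) = c • e x) ∧
    ∀ n : ℕ, Set.range (fun x : Gr (fil P) n => e (DirectSum.of (Gr (fil P)) n x)) =
      (skewGrade F G V n : Set (SkewGroupAlgebra F G V))

/-! ### Coboundaries -/

/-- The commutator `v a - a v` in `S(V) ⋊ G` of `v ∈ V` and `a ∈ FG`, as an element of
`V ⊗ FG`; for `a = h ∈ G` it is `(v - h • v) h`. -/
def commVG (v : V) (a : MonoidAlgebra F G) : V ⊗[F] MonoidAlgebra F G :=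
  Finsupp.linearCombination F
    (fun h : G => (v - h • v) ⊗ₜ[F] (MonoidAlgebra.single h 1 : MonoidAlgebra F G)) a.coeff

theorem commVG_zero (v : V) : commVG v (0 : MonoidAlgebra F G) = 0 := by simp [commVG]

theorem commVG_neg (v : V) (a : MonoidAlgebra F G) : commVG v (-a) = -commVG v a := by simp [commVG]

theorem commVG_add (v : V) (a b : MonoidAlgebra F G) : commVG v (a + b) = commVG v a + commVG v b := by
  simp [commVG]

/-- The parameters `Q` are obtained from `P` by adding a coboundary `df`, for a linear map
`f : V → FG`. Here `df (h ⊗ v) = h f(v) - f(h • v) h` and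
`df (v ∧ w) = (v f(w) - f(w) v) - (w f(v) - f(v) w)`, in `S(V) ⋊ G`; the constant part of `κ` is
not changed. -/
def DiffByCoboundary (P Q : Params F G V) : Prop :=
  ∃ f : V →ₗ[F] MonoidAlgebra F G,
    (∀ (h : G) (v : V), Q.lam (.single h 1) v =
      P.lam (.single h 1) v + (.single h 1 * f v - f (h • v) * .single h 1)) ∧
    ∀ v w : V, (Q.kap v w).1 = (P.kap v w).1 ∧
      (Q.kap v w).2 = (P.kap v w).2 + (commVG v (f w) - commVG w (f v))

theorem diffByCoboundary_equivalence :
    Equivalence (DiffByCoboundary (F := F) (G := G) (V := V)) where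
  refl P := ⟨0, by simp, by simp [commVG_zero]⟩
  symm := by
    rintro P Q ⟨f, h1, h2⟩
    refine ⟨-f, fun h v => ?_, fun v w => ⟨(h2 v w).1.symm, ?_⟩⟩
    · rw [h1 h v]; simp; abel
    · rw [(h2 v w).2]; simp only [LinearMap.neg_apply, commVG_neg]; abel
  trans := by
    rintro P Q R ⟨f, h1, h2⟩ ⟨f', h1', h2'⟩
    refine ⟨f + f', fun h v => ?_, fun v w => ⟨(h2' v w).1.trans (h2 v w).1, ?_⟩⟩
    · rw [h1' h v, h1 h v]; simp only [LinearMap.add_apply, mul_add, add_mul]; abel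
    · rw [(h2' v w).2, (h2 v w).2]; simp only [LinearMap.add_apply, commVG_add]; abel

variable (F G V) in
/-- Drinfeld orbifold algebras, given by their parameter functions, up to coboundary. -/
def coboundarySetoid [SMulCommClass G F V] :
    Setoid {P : Params F G V // IsDrinfeldOrbifold P} where
  r P Q := DiffByCoboundary P.1 Q.1
  iseqv := ⟨fun P => diffByCoboundary_equivalence.refl P.1,
    fun h => diffByCoboundary_equivalence.symm h,
    fun h h' => diffByCoboundary_equivalence.trans h h'⟩

end Algebras

/-! ### The transvection group -/

section Transvection

variable (p : ℕ)

/-- The space `V = F_p²`. -/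
abbrev V2 : Type := Fin 2 → ZMod p

/-- The basis vector `v₁`. -/
def v1 : V2 p := ![1, 0]

/-- The basis vector `v₂`. -/
def v2 : V2 p := ![0, 1]

/-- The transvection with matrix `[[1, 1], [0, 1]]`, in `GL(V)`. -/
def transvection : LinearMap.GeneralLinearGroup (ZMod p) (V2 p) where
  val := Matrix.toLin' !![1, 1; 0, 1]
  inv := Matrix.toLin' !![1, -1; 0, 1]
  val_inv := by
    rw [Module.End.mul_eq_comp, ← Matrix.toLin'_mul, Module.End.one_eq_id, ← Matrix.toLin'_one]
    congr 1
    ext i j; fin_cases i <;> fin_cases j <;> simp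
  inv_val := by
    rw [Module.End.mul_eq_comp, ← Matrix.toLin'_mul, Module.End.one_eq_id, ← Matrix.toLin'_one]
    congr 1
    ext i j; fin_cases i <;> fin_cases j <;> simp

/-- The cyclic group `G` generated by the transvection, acting on `V`. -/
abbrev TG : Type := Subgroup.zpowers (transvection p)

/-- The generator `g` of `G`. -/
def gen : TG p := ⟨transvection p, Subgroup.mem_zpowers _⟩

/-- The group algebra `F_p G`. -/
abbrev FpG : Type := MonoidAlgebra (ZMod p) (TG p)

variable {p}

/-- The group element `g ^ i`, in the group algebra. -/
def gpow (i : ℕ) : FpG p := MonoidAlgebra.single (gen p ^ i) 1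

/-- The coefficient `b_j` of `b = ∑ b_j g ^ j`. -/
def coef (b : FpG p) (j : ℕ) : ZMod p := b.coeff (gen p ^ j)

variable (p) in
/-- The choices made in the procedure: `b = (g - 1) ^ k * b'` with `0 ≤ k ≤ p` and the sum of the
coefficients of `b'` nonzero, then `d_1, …, d_k`, and `κ^C`. The entry `d m` stands for
`d_{m+1}`. -/
structure Choice where
  k : ℕ
  k_le : k ≤ p
  b : FpG p
  b_eq : ∃ b' : FpG p, ∑ i ∈ Finset.range p, coef b' i ≠ 0 ∧ b = (gpow 1 - 1) ^ k * b'
  d : Fin k → ZMod p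
  kapC : FpG p

/-- `μ(d, j) = (-1)^(p-j) (C(p-1, p-j) d_1 - C(p-2, p-j) d_2 + ⋯ + (-1)^(k+1) C(p-k, p-j) d_k)`. -/
def mu {k : ℕ} (d : Fin k → ZMod p) (j : ℕ) : ZMod p :=
  (-1) ^ (p - j) * ∑ m : Fin k, (-1) ^ (m : ℕ) * ((p - (m + 1)).choose (p - j) : ZMod p) * d m

/-- The bilinear parameter functions `P = (λ, κ)`, with `κ` alternating, are those attached to the
choice `c`. -/
def Choice.Gives (c : Choice p) (P : Params (ZMod p) (TG p) (V2 p)) : Prop :=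
  (∀ i < p, P.lam (gpow i) (v1 p) = (i : ZMod p) • (c.b * gpow i)) ∧
  (∀ i < p, P.lam (gpow i) (v2 p) =
    ∑ j ∈ Finset.range p,
      (((i.choose 2 : ZMod p) + i * (j : ZMod p) ^ (p - 2) * ((j + 1).choose 2 : ZMod p)) *
        coef c.b j) • gpow (i + j) +
    (i : ZMod p) • ∑ j ∈ Finset.range p, ((j : ZMod p) ^ (p - 2) * mu c.d j) • gpow (i + j)) ∧
  P.kap (v1 p) (v2 p) =
    (c.kapC,
      (∑ m : Fin c.k, (-1) ^ (m : ℕ) * c.d m) • (v1 p ⊗ₜ[ZMod p] (1 : FpG p)) +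
      ∑ j ∈ Finset.range p, ((j : ZMod p) * coef c.b j) • (v2 p ⊗ₜ[ZMod p] gpow j)) ∧
  ∀ v : V2 p, P.kap v v = 0

end Transvection

end DrinfeldOrbifold

end

/-!
Write `A` for the group algebra, a commutative ring, `E` for its Euler derivation
`g ^ j ↦ j g ^ j` (`euler`), and `λ(g, v₁) = b g`, `λ(g, v₂) = c g`,
`κ(v₁, v₂) = v₁ x + v₂ y + z` with `b, c, x, y, z ∈ A`. If `H_{λ,κ}` has the size of `S(V) ⋊ G` in
degrees zero and one, then no relation may hold in these degrees. The two ways of evaluating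
`(h h') v` then force `λ` to be the cocycle determined by `b` and `c`, so that in `H_{λ,κ}`

* `a v₁ = v₁ a + b E(a)`,
* `a v₂ = v₂ a + v₁ E(a) + b (E² - E)(a) / 2 + c E(a)`,

and the two ways of evaluating `g v₁ v₂` give `y = E(b)` and `b u = 0` for
`u = x + E(c) - (E² + E)(b) / 2`; this is `IsDrinfeldOrbifold.exists_eq_mkParams`. Conversely, these
two conditions say exactly that the relations define an iterated Ore extension of `A`: first the
differential operator ring `A[v₁; b E]`, then an Ore extension by `v₂`. Rather than the extension
itself, the proof uses its left regular representation on normal forms (`doubleRep`), on which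
`H_{λ,κ}` acts. It shows that the monomials `v₂ ^ j v₁ ^ i h` are linearly independent. They span by
rewriting, and their products agree to leading order with those in `S(V) ⋊ G`, whence
`isDrinfeldOrbifold_mkParams`.

A coboundary `df` subtracts `f(v₁)` from `c` and adds `E(f(v₁))` to `x`, so that the triple
`(b, u, z)` is a complete invariant (`diffByCoboundary_mkParams_iff`). The classification is
therefore about pairs `b u = 0` in `A = F_p[t] / (t ^ p)`, `t = g - 1`. If `b` is `t ^ k` times a
unit, then its annihilator is the ideal of `t ^ (p - k)`, which has the basis
`g ^ m t ^ (p - m)`, `1 ≤ m ≤ k`. The parameters attached to a choice are made such that `u` is the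
combination of this basis with coefficients `± d_m`
(`Choice.slope_add_euler_offset`), so choices correspond bijectively to triples `(b, u, z)`.
The number of pairs is found by summing the sizes of the annihilators (`natCard_mul_eq_zero`).
-/

noncomputable section

namespace DrinfeldOrbifold

/-! ### Representations of Ore extensions -/

section Ore

variable {F R : Type*} [CommRing F] [Ring R] [Algebra F R]

/-- Multiplication by the Ore variable `X` from the left on `⨁ X ^ n R`: the shift
`X ^ n r ↦ X ^ (n + 1) r`. -/
def oreShift (F R : Type*) [CommRing F] [Ring R] [Algebra F R] : Module.End F (ℕ →₀ R) :=
  Finsupp.lmapDomain R F Nat.succ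

@[simp]
theorem oreShift_single (n : ℕ) (r : R) :
    oreShift F R (.single n r) = .single (n + 1) r := by
  simp [oreShift]

theorem oreShift_pow_single (n m : ℕ) (r : R) :
    (oreShift F R ^ n) (.single m r) = .single (m + n) r := by
  induction n with
  | zero => simp
  | succ n ih => rw [pow_succ', Module.End.mul_apply, ih, oreShift_single, add_assoc]

/-- The product `r X ^ n s` expanded in `⨁ X ^ m R`, by recursion on `n`, where
`r X = X σ(r) + δ(r)`. -/
def oreMonomial (σ δ : R →ₗ[F] R) : ℕ → R →ₗ[F] R →ₗ[F] (ℕ →₀ R)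
  | 0 => (LinearMap.mul F R).compr₂ (Finsupp.lsingle 0)
  | n + 1 => (oreMonomial σ δ n ∘ₗ σ).compr₂ (oreShift F R) + oreMonomial σ δ n ∘ₗ δ

/-- The action of `r ∈ R` on `⨁ X ^ n R` by left multiplication in the Ore extension with
`r X = X σ(r) + δ(r)`. -/
def oreAct (σ δ : R →ₗ[F] R) (r : R) : Module.End F (ℕ →₀ R) :=
  Finsupp.lsum F fun n => oreMonomial σ δ n r

theorem oreAct_single_zero (σ δ : R →ₗ[F] R) (r s : R) :
    oreAct σ δ r (.single 0 s) = .single 0 (r * s) := by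
  simp [oreAct, oreMonomial]

theorem oreAct_shift (σ δ : R →ₗ[F] R) (r : R) (m : ℕ →₀ R) :
    oreAct σ δ r (oreShift F R m) =
      oreShift F R (oreAct σ δ (σ r) m) + oreAct σ δ (δ r) m := by
  induction m using Finsupp.induction_linear with
  | zero => simp
  | add m m' h h' => simp only [map_add, h, h']; abel
  | single n s => simp [oreAct, oreMonomial]

theorem oreAct_add (σ δ : R →ₗ[F] R) (r s : R) :
    oreAct σ δ (r + s) = oreAct σ δ r + oreAct σ δ s := by
  ext n : 1; simp [oreAct, LinearMap.ext_iff]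

theorem oreAct_smul (σ δ : R →ₗ[F] R) (c : F) (r : R) :
    oreAct σ δ (c • r) = c • oreAct σ δ r := by
  ext n : 1; simp [oreAct, LinearMap.ext_iff]

/-- Induction on the power of `X` in `⨁ X ^ n R`. -/
theorem ore_induction {motive : (ℕ →₀ R) → Prop} (m : ℕ →₀ R)
    (zero : motive 0) (add : ∀ m m', motive m → motive m' → motive (m + m'))
    (const : ∀ s, motive (.single 0 s)) (shift : ∀ m, motive m → motive (oreShift F R m)) :
    motive m := by
  induction m using Finsupp.induction_linear with
  | zero => exact zero
  | add m m' h h' => exact add m m' h h'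
  | single n s =>
    induction n with
    | zero => exact const s
    | succ n ih => simpa using shift _ ih

/-- If `σ` is an algebra endomorphism and `δ (r s) = δ r * σ s + r * δ s`, then `R` acts on
`⨁ X ^ n R` as on the Ore extension of `R` with `r X = X σ(r) + δ(r)`. -/
def oreRep (σ : R →ₐ[F] R) (δ : R →ₗ[F] R) (hδ : ∀ r s, δ (r * s) = δ r * σ s + r * δ s) :
    R →ₐ[F] Module.End F (ℕ →₀ R) :=
  have mul (m : ℕ →₀ R) : ∀ r s : R, oreAct σ.toLinearMap δ (r * s) m =
      oreAct σ.toLinearMap δ r (oreAct σ.toLinearMap δ s m) := by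
    induction m using ore_induction (F := F) (R := R) with
    | zero => simp
    | add m m' h h' => intro r s; simp only [map_add, h, h']
    | const t =>
      intro r s
      rw [oreAct_single_zero, oreAct_single_zero, oreAct_single_zero, mul_assoc]
    | shift m ih =>
      intro r s
      simp only [oreAct_shift, map_add, AlgHom.toLinearMap_apply, map_mul, hδ, oreAct_add,
        LinearMap.add_apply, ih]
      abel
  have one (m : ℕ →₀ R) : oreAct σ.toLinearMap δ 1 m = m := by
    have h1 : δ 1 = 0 := by simpa using hδ 1 1
    have h0 : oreAct σ.toLinearMap δ 0 = 0 := by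
      simpa using oreAct_smul σ.toLinearMap δ (0 : F) 0
    induction m using ore_induction (F := F) (R := R) with
    | zero => simp
    | add m m' h h' => rw [map_add, h, h']
    | const t => rw [oreAct_single_zero, one_mul]
    | shift m ih =>
      rw [oreAct_shift, AlgHom.toLinearMap_apply, map_one, ih, h1, h0, LinearMap.zero_apply,
        add_zero]
  AlgHom.ofLinearMap ⟨⟨oreAct σ.toLinearMap δ, oreAct_add _ _⟩, oreAct_smul _ _⟩
    (LinearMap.ext one) (fun r s => LinearMap.ext fun m => mul m r s)

theorem oreRep_single_zero (σ : R →ₐ[F] R) (δ : R →ₗ[F] R) (hδ) (r s : R) :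
    oreRep σ δ hδ r (.single 0 s) = .single 0 (r * s) :=
  oreAct_single_zero _ _ r s

theorem oreRep_mul_shift (σ : R →ₐ[F] R) (δ : R →ₗ[F] R) (hδ) (r : R) :
    oreRep σ δ hδ r * oreShift F R =
      oreShift F R * oreRep σ δ hδ (σ r) + oreRep σ δ hδ (δ r) :=
  LinearMap.ext fun m => oreAct_shift _ _ r m

end Ore

/-! ### Differential operator rings -/

section DiffOp

variable {F A : Type*} [CommRing F] [CommRing A] [Algebra F A]

/-- The relations of the differential operator ring `A[w; δ]`. -/
inductive DiffOpRel (δ : Derivation F A A) :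
    TensorAlgebra F (A × F) → TensorAlgebra F (A × F) → Prop
  | one : DiffOpRel δ (TensorAlgebra.ι F (1, 0)) 1
  | mul (a a' : A) : DiffOpRel δ (TensorAlgebra.ι F (a * a', 0))
      (TensorAlgebra.ι F (a, 0) * TensorAlgebra.ι F (a', 0))
  | comm (a : A) : DiffOpRel δ (TensorAlgebra.ι F (a, 0) * TensorAlgebra.ι F (0, 1))
      (TensorAlgebra.ι F (0, 1) * TensorAlgebra.ι F (a, 0) + TensorAlgebra.ι F (δ a, 0))

/-- The differential operator ring `A[w; δ]`, presented as the algebra generated by `A` and `w`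
subject to `a w = w a + δ(a)`. -/
def DiffOp (δ : Derivation F A A) : Type _ := RingQuot (DiffOpRel δ)

namespace DiffOp

variable (δ : Derivation F A A)

instance : Ring (DiffOp δ) := inferInstanceAs (Ring (RingQuot (DiffOpRel δ)))

instance : Algebra F (DiffOp δ) := inferInstanceAs (Algebra F (RingQuot (DiffOpRel δ)))

/-- The quotient map from the free algebra. -/
def mk : TensorAlgebra F (A × F) →ₐ[F] DiffOp δ := RingQuot.mkAlgHom F (DiffOpRel δ)

theorem mk_rel {x y : TensorAlgebra F (A × F)} (h : DiffOpRel δ x y) : mk δ x = mk δ y :=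
  RingQuot.mkAlgHom_rel F h

/-- The inclusion of the coefficients. -/
def of : A →ₐ[F] DiffOp δ :=
  AlgHom.ofLinearMap ((mk δ).toLinearMap ∘ₗ TensorAlgebra.ι F ∘ₗ LinearMap.inl F A F)
    (by simpa using mk_rel δ .one) (fun a a' => by simpa using mk_rel δ (.mul a a'))

/-- The variable. -/
def var : DiffOp δ := mk δ (TensorAlgebra.ι F (0, 1))

theorem of_mul_var (a : A) : of δ a * var δ = var δ * of δ a + of δ (δ a) := by
  have h := mk_rel δ (.comm a)
  rw [map_mul, map_add, map_mul] at h
  exact h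

variable {δ} {R : Type*} [Ring R] [Algebra F R]

/-- The universal property of `A[w; δ]`. -/
def lift (α : A →ₐ[F] R) (r : R) (h : ∀ a, α a * r = r * α a + α (δ a)) : DiffOp δ →ₐ[F] R :=
  RingQuot.liftAlgHom F
    ⟨TensorAlgebra.lift F (α.toLinearMap.coprod (LinearMap.toSpanSingleton F R r)), by
      intro x y hxy
      induction hxy <;> simp [h]⟩

theorem lift_of (α : A →ₐ[F] R) (r : R) (h) (a : A) : lift (δ := δ) α r h (of δ a) = α a := by
  change RingQuot.liftAlgHom F _ (RingQuot.mkAlgHom F _ (TensorAlgebra.ι F (a, 0))) = _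
  rw [RingQuot.liftAlgHom_mkAlgHom_apply]
  simp

theorem lift_var (α : A →ₐ[F] R) (r : R) (h) : lift (δ := δ) α r h (var δ) = r := by
  change RingQuot.liftAlgHom F _ (RingQuot.mkAlgHom F _ (TensorAlgebra.ι F (0, 1))) = _
  rw [RingQuot.liftAlgHom_mkAlgHom_apply]
  simp

/-- The algebra `A[w; δ]` is generated by the coefficients and the variable. -/
theorem induction {motive : DiffOp δ → Prop} (x : DiffOp δ) (of : ∀ a, motive (of δ a))
    (var : motive (var δ)) (add : ∀ x y, motive x → motive y → motive (x + y))
    (mul : ∀ x y, motive x → motive y → motive (x * y)) : motive x := by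
  obtain ⟨t, rfl⟩ := RingQuot.mkAlgHom_surjective F _ x
  change motive (mk δ t)
  have smul (c : F) (x : DiffOp δ) (hx : motive x) : motive (c • x) := by
    rw [Algebra.smul_def, ← (DiffOp.of δ).commutes]
    exact mul _ _ (of _) hx
  induction t using TensorAlgebra.induction with
  | algebraMap c => rw [AlgHom.commutes, ← (DiffOp.of δ).commutes]; exact of _
  | mul x y hx hy => rw [map_mul]; exact mul _ _ hx hy
  | add x y hx hy => rw [map_add]; exact add _ _ hx hy
  | ι m =>
    obtain ⟨a, c⟩ := m
    have : mk δ (TensorAlgebra.ι F (a, c)) = DiffOp.of δ a + c • DiffOp.var δ := by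
      have h : ((a, c) : A × F) = (a, 0) + c • (0, 1) := by simp
      rw [h, map_add, map_add, map_smul, map_smul]
      rfl
    rw [this]
    exact add _ _ (of a) (smul _ _ var)

end DiffOp

end DiffOp

/-! ### The Ore extension of the differential operator ring -/

section Double

variable {F A : Type*} [CommRing F] [CommRing A] [Algebra F A]

/-- The operator `(D ^ 2 - D) / 2`, where `half` is the inverse of `2`; it sends an eigenvector of
`D` with eigenvalue `n` to its multiple by `n (n - 1) / 2`. -/
def binomD (half : F) (D : Derivation F A A) : A →ₗ[F] A :=
  half • (D.toLinearMap ∘ₗ D.toLinearMap - D.toLinearMap)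

theorem binomD_apply (half : F) (D : Derivation F A A) (a : A) :
    binomD half D a = half • (D (D a) - D a) := rfl

theorem binomD_mul {half : F} (hh : half + half = 1) (D : Derivation F A A) (a a' : A) :
    binomD half D (a * a') = binomD half D a * a' + a * binomD half D a' + D a * D a' := by
  have h1 : algebraMap F A half + algebraMap F A half = 1 := by rw [← map_add, hh, map_one]
  simp only [binomD_apply, Derivation.leibniz, map_add, smul_eq_mul, Algebra.smul_def]
  linear_combination (D a * D a') * h1

/-- The commutation relations of `H_{λ,κ}`, for the images in an algebra `R` of the coefficients
`A` under `α` and of the vectors `v₁`, `v₂`. They rewrite any product as a combination of monomials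
`r₂ ^ j r₁ ^ i α(a)`. -/
structure OreRelations {R : Type*} [Ring R] [Algebra F R] (half : F) (D : Derivation F A A)
    (b c x y z : A) (α : A →ₐ[F] R) (r₁ r₂ : R) : Prop where
  coeff_mul_one (a : A) : α a * r₁ = r₁ * α a + α (b * D a)
  coeff_mul_two (a : A) :
    α a * r₂ = r₂ * α a + r₁ * α (D a) + α (b * binomD half D a + c * D a)
  one_mul_two : r₁ * r₂ = r₂ * r₁ + (r₁ * α x + r₂ * α y + α z)

variable (half : F) (D : Derivation F A A) (b c x z : A)

/-- The value on coefficients of the skew derivation defining the second variable. -/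
def skewDerCoeff : A →ₗ[F] DiffOp (b • D) :=
  LinearMap.mulLeft F (DiffOp.var (b • D)) ∘ₗ (DiffOp.of (b • D)).toLinearMap ∘ₗ D.toLinearMap +
    (DiffOp.of (b • D)).toLinearMap ∘ₗ
      (LinearMap.mulLeft F b ∘ₗ binomD half D + LinearMap.mulLeft F c ∘ₗ D.toLinearMap)

theorem skewDerCoeff_apply (a : A) : skewDerCoeff half D b c a =
    DiffOp.var (b • D) * DiffOp.of (b • D) (D a) +
      DiffOp.of (b • D) (b * binomD half D a + c * D a) := rfl

theorem skewDerCoeff_mul (hh : half + half = 1) (a a' : A) : skewDerCoeff half D b c (a * a') =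
    skewDerCoeff half D b c a * DiffOp.of (b • D) a' +
      DiffOp.of (b • D) a * skewDerCoeff half D b c a' := by
  simp only [skewDerCoeff_apply, mul_add, add_mul]
  rw [← mul_assoc (DiffOp.of (b • D) a), DiffOp.of_mul_var, add_mul, mul_assoc, mul_assoc]
  simp only [← map_mul]
  have h1 : D (a * a') = D a * a' + a * D a' := by
    rw [Derivation.leibniz, smul_eq_mul, smul_eq_mul]; ring
  have h2 : b * binomD half D (a * a') + c * D (a * a') =
      (b * binomD half D a + c * D a) * a' + b * D a * D a' +
        a * (b * binomD half D a' + c * D a') := by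
    rw [binomD_mul hh, h1]; ring
  rw [h2, h1]
  simp only [map_add, mul_add, Derivation.smul_apply, smul_eq_mul]
  abel

/-- The homomorphism `β ↦ [[σ(β), 0], [δ(β), β]]` on coefficients, where `σ` is the identity.
Multiplicativity of this matrix says that `σ` is an endomorphism and `δ` a skew derivation, which
allows `δ` to be defined on generators by a universal property. -/
def skewMatCoeff (hh : half + half = 1) : A →ₐ[F] Matrix (Fin 2) (Fin 2) (DiffOp (b • D)) :=
  AlgHom.ofLinearMap
    { toFun a := !![DiffOp.of (b • D) a, 0; skewDerCoeff half D b c a, DiffOp.of (b • D) a]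
      map_add' a a' := by ext i j; fin_cases i <;> fin_cases j <;> simp
      map_smul' s a := by ext i j; fin_cases i <;> fin_cases j <;> simp }
    (by
      have h := skewDerCoeff_mul half D b c hh 1 1
      simp only [map_one, mul_one, one_mul, left_eq_add] at h
      ext i j; fin_cases i <;> fin_cases j <;> simp [h])
    (fun a a' => by
      ext i j
      fin_cases i <;> fin_cases j <;> simp [Matrix.mul_apply, skewDerCoeff_mul half D b c hh])

theorem skewMatCoeff_apply (hh : half + half = 1) (a : A) : skewMatCoeff half D b c hh a =
    !![DiffOp.of (b • D) a, 0; skewDerCoeff half D b c a, DiffOp.of (b • D) a] := rfl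

/-- The matrices attached to the coefficients and to the variable satisfy the relation of
`A[w; b D]`. This is where the condition on `b`, `c` and `x` enters: it resolves the overlap of
the rewriting rules for `a r₁` and `r₁ r₂`. -/
theorem skewDerCoeff_compat (hh : half + half = 1)
    (hb : b * (x + D c - half • (D (D b) + D b)) = 0)
    (a : A) :
    skewDerCoeff half D b c a * (DiffOp.var (b • D) + DiffOp.of (b • D) (D b)) +
        DiffOp.of (b • D) a * (DiffOp.var (b • D) * DiffOp.of (b • D) x + DiffOp.of (b • D) z) =
      (DiffOp.var (b • D) * DiffOp.of (b • D) x + DiffOp.of (b • D) z) * DiffOp.of (b • D) a +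
        DiffOp.var (b • D) * skewDerCoeff half D b c a + skewDerCoeff half D b c (b * D a) := by
  set w := DiffOp.var (b • D)
  set ι := DiffOp.of (b • D)
  have rel (a : A) : ι a * w = w * ι a + ι (b * D a) := DiffOp.of_mul_var _ a
  have h1 : algebraMap F A half + algebraMap F A half = 1 := by rw [← map_add, hh, map_one]
  have hl : skewDerCoeff half D b c a * (w + ι (D b)) + ι a * (w * ι x + ι z) =
      w * (w * ι (D a)) + w * ι (b * D (D a) + (b * binomD half D a + c * D a) + D a * D b + a * x) +
        ι (b * D (b * binomD half D a + c * D a) + (b * binomD half D a + c * D a) * D b +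
          b * D a * x + a * z) := by
    rw [skewDerCoeff_apply]
    have e1 : (w * ι (D a) + ι (b * binomD half D a + c * D a)) * (w + ι (D b)) =
      w * (ι (D a) * w) + ι (b * binomD half D a + c * D a) * w + w * (ι (D a) * ι (D b)) +
        ι (b * binomD half D a + c * D a) * ι (D b) := by noncomm_ring
    have e2 : ι a * (w * ι x + ι z) = (ι a * w) * ι x + ι a * ι z := by noncomm_ring
    rw [e1, e2, rel, rel, rel]
    simp only [map_add, map_mul, mul_add, add_mul, mul_assoc]
    abel
  have hr : (w * ι x + ι z) * ι a + w * skewDerCoeff half D b c a +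
        skewDerCoeff half D b c (b * D a) =
      w * (w * ι (D a)) + w * ι (x * a + (b * binomD half D a + c * D a) + D (b * D a)) +
        ι (z * a + (b * binomD half D (b * D a) + c * D (b * D a))) := by
    rw [skewDerCoeff_apply, skewDerCoeff_apply]
    simp only [map_add, map_mul, mul_add, add_mul, mul_assoc]
    abel
  have e1 : b * D (D a) + (b * binomD half D a + c * D a) + D a * D b + a * x =
      x * a + (b * binomD half D a + c * D a) + D (b * D a) := by
    simp only [Derivation.leibniz, smul_eq_mul]; ring
  have e2 : b * D (b * binomD half D a + c * D a) + (b * binomD half D a + c * D a) * D b +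
      b * D a * x + a * z = z * a + (b * binomD half D (b * D a) + c * D (b * D a)) := by
    rw [binomD_mul hh]
    simp only [Derivation.leibniz, map_add, map_sub, smul_eq_mul, binomD_apply, Algebra.smul_def,
      Derivation.map_algebraMap] at hb ⊢
    linear_combination (D a) * hb + (b * D (D a) * D b) * h1
  rw [hl, hr, e1, e2]

/-- The homomorphism `β ↦ [[σ(β), 0], [δ(β), β]]` on `A[w; b D]`, where `σ` and `δ` govern the
commutation `β r₂ = r₂ σ(β) + δ(β)` with the second variable. -/
def skewMat (hh : half + half = 1)
    (hb : b * (x + D c - half • (D (D b) + D b)) = 0) :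
    DiffOp (b • D) →ₐ[F] Matrix (Fin 2) (Fin 2) (DiffOp (b • D)) :=
  DiffOp.lift (skewMatCoeff half D b c hh)
    !![DiffOp.var (b • D) + DiffOp.of (b • D) (D b), 0;
      DiffOp.var (b • D) * DiffOp.of (b • D) x + DiffOp.of (b • D) z, DiffOp.var (b • D)]
    (fun a => by
      have h := skewDerCoeff_compat half D b c x z hh hb a
      simp only [skewMatCoeff_apply]
      ext i j
      fin_cases i <;> fin_cases j
      · simp only [Matrix.mul_apply, Matrix.add_apply, Fin.sum_univ_two]
        simp [DiffOp.of_mul_var, mul_add, add_mul, ← map_mul, mul_comm]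
        abel
      · simp [Matrix.mul_apply]
      · simpa [Matrix.mul_apply] using h
      · simp [Matrix.mul_apply, DiffOp.of_mul_var])

end Double

/-! ### The representation on normal forms -/

section Faithful

variable {F A : Type*} [CommRing F] [CommRing A] [Algebra F A]

/-- The action of the coefficients of `A[w; δ]` on its normal forms `⨁ w ^ i A`. -/
def DiffOp.repCoeff (δ : Derivation F A A) : A →ₐ[F] Module.End F (ℕ →₀ A) :=
  oreRep (AlgHom.id F A) δ.toLinearMap fun r s => by simp [Derivation.leibniz, mul_comm, add_comm]

/-- The representation of `A[w; δ]` on its normal forms `⨁ w ^ i A`. -/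
def DiffOp.rep (δ : Derivation F A A) : DiffOp δ →ₐ[F] Module.End F (ℕ →₀ A) :=
  DiffOp.lift (DiffOp.repCoeff δ) (oreShift F A) fun a => oreRep_mul_shift _ _ _ a

/-- The coefficients of an element of `A[w; δ]` with respect to the powers of `w`. -/
def DiffOp.normalForm (δ : Derivation F A A) : DiffOp δ →ₗ[F] (ℕ →₀ A) :=
  LinearMap.applyₗ (.single 0 1) ∘ₗ (DiffOp.rep δ).toLinearMap

theorem DiffOp.normalForm_monomial (δ : Derivation F A A) (i : ℕ) (a : A) :
    DiffOp.normalForm δ (DiffOp.var δ ^ i * DiffOp.of δ a) = .single i a := by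
  have h1 : rep δ (var δ) = oreShift F A := lift_var _ _ _
  have h2 : rep δ (of δ a) = repCoeff δ a := lift_of _ _ _ a
  simp only [normalForm, LinearMap.comp_apply, AlgHom.toLinearMap_apply, map_mul, map_pow,
    h1, h2, LinearMap.applyₗ_apply_apply, Module.End.mul_apply]
  rw [repCoeff, oreRep_single_zero, mul_one, oreShift_pow_single, zero_add]

variable (half : F) (D : Derivation F A A) (b c x y z : A) (hh : half + half = 1)
  (hb : b * (x + D c - half • (D (D b) + D b)) = 0)

theorem skewMat_triangular (β : DiffOp (b • D)) :
    skewMat half D b c x z hh hb β 0 1 = 0 ∧ skewMat half D b c x z hh hb β 1 1 = β := by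
  induction β using DiffOp.induction with
  | of a => simp [skewMat, DiffOp.lift_of, skewMatCoeff_apply]
  | var => simp [skewMat, DiffOp.lift_var]
  | add x y hx hy => simp [hx, hy]
  | mul x y hx hy => simp [Matrix.mul_apply, hx, hy]

/-- The endomorphism `σ` in `β r₂ = r₂ σ(β) + δ(β)`. -/
def skewEnd : DiffOp (b • D) →ₐ[F] DiffOp (b • D) :=
  AlgHom.ofLinearMap
    { toFun β := skewMat half D b c x z hh hb β 0 0
      map_add' _ _ := by simp
      map_smul' _ _ := by simp }
    (by simp) (fun β γ => by simp [Matrix.mul_apply, skewMat_triangular])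

/-- The skew derivation `δ` in `β r₂ = r₂ σ(β) + δ(β)`. -/
def skewDer : DiffOp (b • D) →ₗ[F] DiffOp (b • D) where
  toFun β := skewMat half D b c x z hh hb β 1 0
  map_add' _ _ := by simp
  map_smul' _ _ := by simp

theorem skewDer_mul (β γ : DiffOp (b • D)) : skewDer half D b c x z hh hb (β * γ) =
    skewDer half D b c x z hh hb β * skewEnd half D b c x z hh hb γ +
      β * skewDer half D b c x z hh hb γ := by
  simp [skewDer, skewEnd, Matrix.mul_apply, skewMat_triangular]

/-- The action of `A[w; b D]` on the normal forms `⨁ X ^ j A[w; b D]` of the double Ore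
extension. -/
def doubleRep : DiffOp (b • D) →ₐ[F] Module.End F (ℕ →₀ DiffOp (b • D)) :=
  oreRep (skewEnd half D b c x z hh hb) (skewDer half D b c x z hh hb)
    (skewDer_mul half D b c x z hh hb)

theorem doubleRep_relations : OreRelations half D b c x (D b) z
    ((doubleRep half D b c x z hh hb).comp (DiffOp.of (b • D)))
    (doubleRep half D b c x z hh hb (DiffOp.var (b • D))) (oreShift F (DiffOp (b • D))) where
  coeff_mul_one a := by
    simp only [AlgHom.comp_apply, ← map_mul, ← map_add, DiffOp.of_mul_var]
    rfl
  coeff_mul_two a := by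
    have h1 : skewEnd half D b c x z hh hb (DiffOp.of _ a) = DiffOp.of _ a := by
      simp [skewEnd, skewMat, DiffOp.lift_of, skewMatCoeff_apply]
    have h2 : skewDer half D b c x z hh hb (DiffOp.of _ a) = skewDerCoeff half D b c a := by
      simp [skewDer, skewMat, DiffOp.lift_of, skewMatCoeff_apply]
    simp only [AlgHom.comp_apply, add_assoc, ← map_mul, ← map_add]
    rw [doubleRep, oreRep_mul_shift, h1, h2]
    rfl
  one_mul_two := by
    have h1 : skewEnd half D b c x z hh hb (DiffOp.var _) =
        DiffOp.var _ + DiffOp.of _ (D b) := by simp [skewEnd, skewMat, DiffOp.lift_var]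
    have h2 : skewDer half D b c x z hh hb (DiffOp.var _) =
        DiffOp.var _ * DiffOp.of _ x + DiffOp.of _ z := by simp [skewDer, skewMat, DiffOp.lift_var]
    rw [doubleRep, oreRep_mul_shift, h1, h2]
    simp only [AlgHom.comp_apply, map_mul, map_add, mul_add]
    abel

/-- Linear independence of the monomials `r₂ ^ j r₁ ^ i a`: an algebra mapping to the double Ore
extension has a linear map picking out the coefficients of the monomials. -/
theorem exists_normalForm {R : Type*} [Ring R] [Algebra F R] {α : A →ₐ[F] R} {r₁ r₂ : R}
    (φ : R →ₐ[F] Module.End F (ℕ →₀ DiffOp (b • D)))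
    (hα : ∀ a, φ (α a) = doubleRep half D b c x z hh hb (DiffOp.of _ a))
    (h1 : φ r₁ = doubleRep half D b c x z hh hb (DiffOp.var _))
    (h2 : φ r₂ = oreShift F (DiffOp (b • D))) :
    ∃ N : R →ₗ[F] (ℕ →₀ ℕ →₀ A),
      ∀ i j a, N (r₂ ^ j * (r₁ ^ i * α a)) = .single j (.single i a) := by
  refine ⟨Finsupp.mapRange.linearMap (DiffOp.normalForm (b • D)) ∘ₗ
    LinearMap.applyₗ (.single 0 1) ∘ₗ φ.toLinearMap, fun i j a => ?_⟩
  have h : φ (r₂ ^ j * (r₁ ^ i * α a)) = oreShift F (DiffOp (b • D)) ^ j *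
      doubleRep half D b c x z hh hb (DiffOp.var _ ^ i * DiffOp.of _ a) := by
    simp only [map_mul, map_pow, h1, h2, hα]
  simp only [LinearMap.comp_apply, AlgHom.toLinearMap_apply, h, LinearMap.applyₗ_apply_apply,
    Module.End.mul_apply]
  rw [doubleRep, oreRep_single_zero,
    oreShift_pow_single, zero_add, mul_one]
  rw [Finsupp.mapRange.linearMap_apply, Finsupp.mapRange_single, DiffOp.normalForm_monomial]

end Faithful

/-! ### Recognizing the associated graded ring -/

section Recognize

variable {F S R ι : Type*} [CommRing F] [Ring S] [Algebra F S] [Ring R] [Algebra F R]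

theorem mem_filLT {Fil : ℕ → Submodule F R} {m n : ℕ} (h : m < n) {x : R} (hx : x ∈ Fil m) :
    x ∈ filLT Fil n :=
  (le_iSup (fun l : Fin n => Fil l) ⟨m, h⟩) hx

variable (Fil : ℕ → Submodule F R) (e : Module.Basis ι F S) (deg : ι → ℕ) (Λ : S ≃ₗ[F] R)

/-- The symbol of degree `n` of an element of a filtered algebra `R` with a basis `Λ (e i)`: the
component of degree `n`, read in the graded algebra `S` with basis `e`. -/
def symbol (n : ℕ) : R →ₗ[F] S :=
  e.constr F (fun i => if deg i = n then e i else 0) ∘ₗ Λ.symm.toLinearMap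

theorem symbol_basis (n : ℕ) (i : ι) :
    symbol e deg Λ n (Λ (e i)) = if deg i = n then e i else 0 := by
  simp [symbol]

theorem symbol_of_homogeneous {n : ℕ} {s : S}
    (hs : s ∈ Submodule.span F (e '' {i | deg i = n})) : symbol e deg Λ n (Λ s) = s := by
  induction hs using Submodule.span_induction with
  | mem x hx => obtain ⟨i, hi, rfl⟩ := hx; exact (symbol_basis e deg Λ n i).trans (if_pos hi)
  | zero => simp
  | add x y _ _ hx hy => rw [map_add, map_add, hx, hy]
  | smul c x _ hx => rw [map_smul, map_smul, hx]

variable (hFil : ∀ n, Fil n = Submodule.span F ((fun i => Λ (e i)) '' {i | deg i ≤ n}))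
include hFil

theorem symbol_eq_zero {n : ℕ} {x : R} (hx : x ∈ filLT Fil n) : symbol e deg Λ n x = 0 := by
  suffices filLT Fil n ≤ LinearMap.ker (symbol e deg Λ n) from this hx
  refine iSup_le fun m => ?_
  rw [hFil, Submodule.span_le]
  rintro _ ⟨i, hi, rfl⟩
  have : deg i ≠ n := by have := m.2; simp at hi; omega
  simp [symbol_basis, this]

/-- The injection of `Fil n / Fil (n - 1)` into `S` given by the symbol. -/
def grSymbol (n : ℕ) : Gr Fil n →ₗ[F] S :=
  Submodule.liftQ _ (symbol e deg Λ n ∘ₗ (Fil n).subtype) fun _ hx =>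
    symbol_eq_zero Fil e deg Λ hFil hx

theorem basis_mem_fil (i : ι) : Λ (e i) ∈ Fil (deg i) := by
  rw [hFil]; exact Submodule.subset_span ⟨i, le_refl (deg i), rfl⟩

/-- The inverse of the symbol map on all degrees. -/
def grOfBasis : S →ₗ[F] DirectSum ℕ (Gr Fil) :=
  e.constr F fun i => DirectSum.of (Gr Fil) (deg i)
    (Gr.mk Fil (deg i) ⟨Λ (e i), basis_mem_fil Fil e deg Λ hFil i⟩)

theorem grOfBasis_symbol (n : ℕ) (x : R) (hx : x ∈ Fil n) :
    grOfBasis Fil e deg Λ hFil (symbol e deg Λ n x) =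
      DirectSum.of (Gr Fil) n (Gr.mk Fil n ⟨x, hx⟩) := by
  have hx' := hx
  rw [hFil] at hx'
  induction hx' using Submodule.span_induction with
  | mem x hx' =>
    obtain ⟨i, hi, rfl⟩ := hx'
    rw [symbol_basis]
    rcases (show deg i ≤ n from hi).eq_or_lt with rfl | h
    · simp [grOfBasis]
    · rw [if_neg h.ne, map_zero, Gr.mk_eq_zero, map_zero]
      exact mem_filLT h (basis_mem_fil Fil e deg Λ hFil i)
  | zero =>
    have : (⟨0, hx⟩ : Fil n) = 0 := rfl
    rw [this]; simp
  | add x y hx1 hy1 h1 h2 =>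
    rw [← hFil] at hx1 hy1
    rw [map_add, map_add, h1 hx1, h2 hy1, ← map_add, ← map_add]
    rfl
  | smul c x hx1 h1 =>
    rw [← hFil] at hx1
    rw [map_smul, map_smul, h1 hx1]
    have : (⟨c • x, hx⟩ : Fil n) = c • ⟨x, hx1⟩ := rfl
    rw [this, map_smul]
    exact (map_smul (DirectSum.lof F ℕ (Gr Fil) n) c _).symm

theorem symbol_mul [SetLike.GradedMonoid Fil]
    (hmul : ∀ i j, e i * e j ∈ Submodule.span F (e '' {l | deg l = deg i + deg j}) ∧
      Λ (e i * e j) - Λ (e i) * Λ (e j) ∈ filLT Fil (deg i + deg j))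
    {m n : ℕ} {x y : R} (hx : x ∈ Fil m) (hy : y ∈ Fil n) :
    symbol e deg Λ (m + n) (x * y) = symbol e deg Λ m x * symbol e deg Λ n y := by
  rw [hFil] at hx hy
  induction hx using Submodule.span_induction with
  | zero => simp
  | add x y _ _ hx hy => rw [add_mul, map_add, map_add, add_mul, hx, hy]
  | smul c x _ hx => rw [smul_mul_assoc, map_smul, map_smul, smul_mul_assoc, hx]
  | mem x hx =>
    obtain ⟨i, hi, rfl⟩ := hx
    induction hy using Submodule.span_induction with
    | zero => simp
    | add x y _ _ hx hy => rw [mul_add, map_add, map_add, mul_add, hx, hy]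
    | smul c x _ hx => rw [mul_smul_comm, map_smul, map_smul, mul_smul_comm, hx]
    | mem y hy =>
      obtain ⟨j, hj, rfl⟩ := hy
      replace hi : deg i ≤ m := hi
      replace hj : deg j ≤ n := hj
      rw [symbol_basis, symbol_basis]
      by_cases h : deg i = m ∧ deg j = n
      · obtain ⟨rfl, rfl⟩ := h
        rw [if_pos rfl, if_pos rfl, ← symbol_of_homogeneous e deg Λ (hmul i j).1,
          ← sub_eq_zero, ← map_sub, ← neg_sub, map_neg,
          symbol_eq_zero Fil e deg Λ hFil (hmul i j).2, neg_zero]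
      · rw [symbol_eq_zero Fil e deg Λ hFil]
        · rcases not_and_or.1 h with h | h <;> simp [h]
        · exact mem_filLT (m := deg i + deg j) (by omega)
            (SetLike.mul_mem_graded (basis_mem_fil Fil e deg Λ hFil i)
              (basis_mem_fil Fil e deg Λ hFil j))

/-- A filtered algebra with a basis `Λ (e i)`, adapted to the filtration, whose products agree up
to lower terms with those of a graded algebra `S` with homogeneous basis `e i`, has associated
graded algebra `S`. -/
theorem exists_gr_equiv [SetLike.GradedMonoid Fil]
    (hmul : ∀ i j, e i * e j ∈ Submodule.span F (e '' {l | deg l = deg i + deg j}) ∧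
      Λ (e i * e j) - Λ (e i) * Λ (e j) ∈ filLT Fil (deg i + deg j))
    (hone : ∃ i, e i = 1 ∧ deg i = 0 ∧ Λ (e i) = 1) :
    ∃ E : DirectSum ℕ (Gr Fil) ≃+* S,
      (∀ (c : F) (x : DirectSum ℕ (Gr Fil)), E (c • x) = c • E x) ∧
      ∀ n : ℕ, Set.range (fun x : Gr Fil n => E (DirectSum.of (Gr Fil) n x)) =
        (Submodule.span F (e '' {i | deg i = n}) : Set S) := by
  let φ : DirectSum ℕ (Gr Fil) →+* S :=
    DirectSum.toSemiring (fun n => (grSymbol Fil e deg Λ hFil n).toAddMonoidHom)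
      (by
        obtain ⟨i, h1, h2, h3⟩ := hone
        have h := symbol_basis e deg Λ 0 i
        rw [if_pos h2, h3, h1] at h
        exact h)
      (by
        intro m n x y
        obtain ⟨x, rfl⟩ := Gr.mk_surjective Fil m x
        obtain ⟨y, rfl⟩ := Gr.mk_surjective Fil n y
        exact symbol_mul Fil e deg Λ hFil hmul x.2 y.2)
  have hφ (n : ℕ) (x : Fil n) :
      φ (DirectSum.of (Gr Fil) n (Gr.mk Fil n x)) = symbol e deg Λ n x := by
    simp only [φ, DirectSum.toSemiring_of]
    rfl
  have hsmul (c : F) (x : DirectSum ℕ (Gr Fil)) : φ (c • x) = c • φ x := by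
    induction x using DirectSum.induction_on with
    | zero => exact (congrArg φ (smul_zero c)).trans (by simp)
    | of n x =>
      have : c • DirectSum.of (Gr Fil) n x = DirectSum.of (Gr Fil) n (c • x) :=
        (map_smul (DirectSum.lof F ℕ (Gr Fil) n) c x).symm
      rw [this]
      simp only [φ, DirectSum.toSemiring_of]
      exact map_smul (grSymbol Fil e deg Λ hFil n) c x
    | add x y hx hy =>
      exact (congrArg φ (smul_add c x y)).trans (by rw [map_add, map_add, smul_add, hx, hy])
  have hl (x : DirectSum ℕ (Gr Fil)) : grOfBasis Fil e deg Λ hFil (φ x) = x := by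
    induction x using DirectSum.induction_on with
    | zero => simp
    | of n x =>
      obtain ⟨x, rfl⟩ := Gr.mk_surjective Fil n x
      rw [hφ, grOfBasis_symbol]
    | add x y hx hy => rw [map_add, map_add, hx, hy]
  have hr (s : S) : φ (grOfBasis Fil e deg Λ hFil s) = s := by
    have hs := e.mem_span s
    induction hs using Submodule.span_induction with
    | zero => simp
    | mem x hx =>
      obtain ⟨i, rfl⟩ := hx
      simp only [grOfBasis, Module.Basis.constr_basis]
      rw [hφ, symbol_basis, if_pos rfl]
    | add x y _ _ hx hy => rw [map_add, map_add, hx, hy]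
    | smul c x _ hx => rw [map_smul, hsmul, hx]
  refine ⟨RingEquiv.ofBijective φ
    (Function.bijective_iff_has_inverse.2 ⟨_, hl, hr⟩), hsmul, fun n => ?_⟩
  ext s
  constructor
  · rintro ⟨x, rfl⟩
    obtain ⟨⟨x, hx⟩, rfl⟩ := Gr.mk_surjective Fil n x
    have h := hφ n ⟨x, hx⟩
    change φ (DirectSum.of (Gr Fil) n (Gr.mk Fil n ⟨x, hx⟩)) ∈
      Submodule.span F (e '' {i | deg i = n})
    rw [h]
    change symbol e deg Λ n x ∈ Submodule.span F (e '' {i | deg i = n})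
    rw [hFil] at hx
    suffices Submodule.span F ((fun i => Λ (e i)) '' {i | deg i ≤ n}) ≤
      (Submodule.span F (e '' {i | deg i = n})).comap (symbol e deg Λ n) from this hx
    rw [Submodule.span_le]
    rintro _ ⟨i, hi, rfl⟩
    simp only [Submodule.comap_coe, Set.mem_preimage, symbol_basis]
    split_ifs with h
    · exact Submodule.subset_span ⟨i, h, rfl⟩
    · exact zero_mem _
  · intro hs
    have h : Λ s ∈ Fil n := by
      rw [hFil]
      suffices Submodule.span F (e '' {i | deg i = n}) ≤
        (Submodule.span F ((fun i => Λ (e i)) '' {i | deg i ≤ n})).comap Λ.toLinearMap from this hs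
      rw [Submodule.span_le]
      rintro _ ⟨i, hi, rfl⟩
      exact Submodule.subset_span ⟨i, le_of_eq hi, rfl⟩
    exact ⟨Gr.mk Fil n ⟨Λ s, h⟩, (hφ n ⟨Λ s, h⟩).trans (symbol_of_homogeneous e deg Λ hs)⟩

end Recognize

/-! ### Rewriting monomials -/

section Rewriting

variable {F A R S : Type*} [CommRing F] [CommRing A] [Algebra F A] [Ring R] [Algebra F R]
  [Ring S] [Algebra F S]

/-- The span of the monomials `r₂ ^ j r₁ ^ i a` of degree `i + j < n`. -/
def lowerSpan (α : A →ₐ[F] R) (r₁ r₂ : R) (n : ℕ) : Submodule F R :=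
  Submodule.span F {x | ∃ i j a, i + j < n ∧ x = r₂ ^ j * (r₁ ^ i * α a)}

/-- The span of the monomials `r₂ ^ j r₁ ^ i a` of degree `i + j = n`. -/
def homogeneousSpan (α : A →ₐ[F] R) (r₁ r₂ : R) (n : ℕ) : Submodule F R :=
  Submodule.span F {x | ∃ i j a, i + j = n ∧ x = r₂ ^ j * (r₁ ^ i * α a)}

section

variable {α : A →ₐ[F] R} {r₁ r₂ : R}

theorem monomial_mem_lowerSpan {i j n : ℕ} (h : i + j < n) (a : A) :
    r₂ ^ j * (r₁ ^ i * α a) ∈ lowerSpan α r₁ r₂ n :=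
  Submodule.subset_span ⟨i, j, a, h, rfl⟩

theorem monomial_mem_homogeneousSpan {i j n : ℕ} (h : i + j = n) (a : A) :
    r₂ ^ j * (r₁ ^ i * α a) ∈ homogeneousSpan α r₁ r₂ n :=
  Submodule.subset_span ⟨i, j, a, h, rfl⟩

theorem lowerSpan_mono {m n : ℕ} (h : m ≤ n) : lowerSpan α r₁ r₂ m ≤ lowerSpan α r₁ r₂ n := by
  refine Submodule.span_mono ?_
  rintro _ ⟨i, j, a, hij, rfl⟩
  exact ⟨i, j, a, by omega, rfl⟩

theorem lowerSpan_zero : lowerSpan α r₁ r₂ 0 = ⊥ := by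
  simp [lowerSpan]

theorem lowerSpan_le {n : ℕ} {W : Submodule F R}
    (h : ∀ i j a, i + j < n → r₂ ^ j * (r₁ ^ i * α a) ∈ W) : lowerSpan α r₁ r₂ n ≤ W := by
  refine Submodule.span_le.2 ?_
  rintro _ ⟨i, j, a, hij, rfl⟩
  exact h i j a hij

theorem homogeneousSpan_le {n : ℕ} {W : Submodule F R}
    (h : ∀ i j a, i + j = n → r₂ ^ j * (r₁ ^ i * α a) ∈ W) : homogeneousSpan α r₁ r₂ n ≤ W := by
  refine Submodule.span_le.2 ?_
  rintro _ ⟨i, j, a, hij, rfl⟩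
  exact h i j a hij

theorem two_mul_mem_lowerSpan {n : ℕ} {s : R} (hs : s ∈ lowerSpan α r₁ r₂ n) :
    r₂ * s ∈ lowerSpan α r₁ r₂ (n + 1) := by
  have : lowerSpan α r₁ r₂ n ≤ (lowerSpan α r₁ r₂ (n + 1)).comap (LinearMap.mulLeft F r₂) := by
    refine lowerSpan_le fun i j a h => ?_
    rw [Submodule.mem_comap, LinearMap.mulLeft_apply, ← mul_assoc, ← pow_succ']
    exact monomial_mem_lowerSpan (by omega) a
  exact this hs

theorem two_mul_mem_homogeneousSpan {n : ℕ} {s : R} (hs : s ∈ homogeneousSpan α r₁ r₂ n) :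
    r₂ * s ∈ homogeneousSpan α r₁ r₂ (n + 1) := by
  have : homogeneousSpan α r₁ r₂ n ≤
      (homogeneousSpan α r₁ r₂ (n + 1)).comap (LinearMap.mulLeft F r₂) := by
    refine homogeneousSpan_le fun i j a h => ?_
    rw [Submodule.mem_comap, LinearMap.mulLeft_apply, ← mul_assoc, ← pow_succ']
    exact monomial_mem_homogeneousSpan (by omega) a
  exact this hs

end

variable {half : F} {D : Derivation F A A} {b c x y z : A}
  {α : A →ₐ[F] R} {r₁ r₂ : R} {β : A →ₐ[F] S} {s₁ s₂ : S}

namespace OreRelations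

/-- Both closure properties are proved together by induction on the degree, because moving a
coefficient past `r₂` creates an `r₁`, and moving `r₁` past `r₂` creates coefficients. -/
theorem coeff_mul_mem_and_one_mul_mem (h : OreRelations half D b c x y z α r₁ r₂) (n : ℕ) :
    ∀ s ∈ lowerSpan α r₁ r₂ n, (∀ a, α a * s ∈ lowerSpan α r₁ r₂ n) ∧
      r₁ * s ∈ lowerSpan α r₁ r₂ (n + 1) := by
  induction n with
  | zero => simp [lowerSpan_zero]
  | succ n ih =>
    suffices ∀ i j a', i + j < n + 1 → (∀ a, α a * (r₂ ^ j * (r₁ ^ i * α a')) ∈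
        lowerSpan α r₁ r₂ (n + 1)) ∧
        r₁ * (r₂ ^ j * (r₁ ^ i * α a')) ∈ lowerSpan α r₁ r₂ (n + 1 + 1) by
      intro s hs
      constructor
      · intro a
        exact (lowerSpan_le (W := (lowerSpan α r₁ r₂ (n + 1)).comap (LinearMap.mulLeft F (α a)))
          fun i j a' hij => (this i j a' hij).1 a) hs
      · exact (lowerSpan_le (W := (lowerSpan α r₁ r₂ (n + 1 + 1)).comap (LinearMap.mulLeft F r₁))
          fun i j a' hij => (this i j a' hij).2) hs
    intro i j a' hij
    rcases j with _ | j
    · rw [pow_zero, one_mul]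
      constructor
      · intro a
        rcases i with _ | i
        · rw [pow_zero, one_mul, ← map_mul]
          simpa using monomial_mem_lowerSpan (α := α) (r₁ := r₁) (r₂ := r₂) hij (a * a')
        · have hm : r₁ ^ i * α a' ∈ lowerSpan α r₁ r₂ n := by
            simpa using monomial_mem_lowerSpan (α := α) (r₁ := r₁) (r₂ := r₂)
              (show i + 0 < n by omega) a'
          rw [pow_succ', mul_assoc, ← mul_assoc, h.coeff_mul_one, add_mul, mul_assoc]
          exact add_mem (ih _ ((ih _ hm).1 a)).2 (lowerSpan_mono (by omega) ((ih _ hm).1 _))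
      · rw [← mul_assoc, ← pow_succ']
        simpa using monomial_mem_lowerSpan (α := α) (r₁ := r₁) (r₂ := r₂)
          (show (i + 1) + 0 < n + 1 + 1 by omega) a'
    · have hm : r₂ ^ j * (r₁ ^ i * α a') ∈ lowerSpan α r₁ r₂ n :=
        monomial_mem_lowerSpan (by omega) a'
      rw [pow_succ', mul_assoc]
      generalize r₂ ^ j * (r₁ ^ i * α a') = m at hm
      constructor
      · intro a
        rw [← mul_assoc, h.coeff_mul_two, add_mul, add_mul, mul_assoc, mul_assoc]
        exact add_mem (add_mem (two_mul_mem_lowerSpan ((ih _ hm).1 a))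
          (ih _ ((ih _ hm).1 _)).2) (lowerSpan_mono (by omega) ((ih _ hm).1 _))
      · rw [← mul_assoc, h.one_mul_two]
        simp only [add_mul, mul_assoc]
        refine add_mem (two_mul_mem_lowerSpan (ih _ hm).2) (add_mem (add_mem ?_ ?_) ?_)
        · exact lowerSpan_mono (by omega) (ih _ ((ih _ hm).1 _)).2
        · exact lowerSpan_mono (by omega) (two_mul_mem_lowerSpan ((ih _ hm).1 _))
        · exact lowerSpan_mono (by omega) ((ih _ hm).1 _)

theorem coeff_mul_mem (h : OreRelations half D b c x y z α r₁ r₂) {n : ℕ} {s : R}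
    (hs : s ∈ lowerSpan α r₁ r₂ n) (a : A) : α a * s ∈ lowerSpan α r₁ r₂ n :=
  (h.coeff_mul_mem_and_one_mul_mem n s hs).1 a

theorem one_mul_mem (h : OreRelations half D b c x y z α r₁ r₂) {n : ℕ} {s : R}
    (hs : s ∈ lowerSpan α r₁ r₂ n) : r₁ * s ∈ lowerSpan α r₁ r₂ (n + 1) :=
  (h.coeff_mul_mem_and_one_mul_mem n s hs).2

/-! Without deformation parameters, the rewriting rules are homogeneous. -/

theorem one_mul_mem_homogeneous (h : OreRelations half D 0 0 0 0 0 β s₁ s₂) {n : ℕ} {s : S}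
    (hs : s ∈ homogeneousSpan β s₁ s₂ n) : s₁ * s ∈ homogeneousSpan β s₁ s₂ (n + 1) := by
  have h12 : Commute s₁ s₂ := by simpa [commute_iff_eq] using h.one_mul_two
  refine (homogeneousSpan_le (W := (homogeneousSpan β s₁ s₂ (n + 1)).comap (LinearMap.mulLeft F s₁))
    fun i j a hij => ?_) hs
  rw [Submodule.mem_comap, LinearMap.mulLeft_apply, ← mul_assoc, (h12.pow_right j).eq, mul_assoc,
    ← mul_assoc s₁, ← pow_succ']
  exact monomial_mem_homogeneousSpan (by omega) a

theorem coeff_mul_mem_homogeneous (h : OreRelations half D 0 0 0 0 0 β s₁ s₂) (n : ℕ) :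
    ∀ s ∈ homogeneousSpan β s₁ s₂ n, ∀ a, β a * s ∈ homogeneousSpan β s₁ s₂ n := by
  have h1 (a : A) : β a * s₁ = s₁ * β a := by simpa using h.coeff_mul_one a
  have h2 (a : A) : β a * s₂ = s₂ * β a + s₁ * β (D a) := by simpa using h.coeff_mul_two a
  suffices ∀ i j a' a, i + j = n → β a * (s₂ ^ j * (s₁ ^ i * β a')) ∈
      homogeneousSpan β s₁ s₂ n by
    intro s hs a
    exact (homogeneousSpan_le (W := (homogeneousSpan β s₁ s₂ n).comap (LinearMap.mulLeft F (β a)))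
      fun i j a' hij => this i j a' a hij) hs
  intro i j
  induction j generalizing n with
  | zero =>
    intro a' a hij
    have : Commute (β a) (s₁ ^ i) := Commute.pow_right (h1 a) i
    rw [pow_zero, one_mul, ← mul_assoc, this.eq, mul_assoc, ← map_mul]
    simpa using monomial_mem_homogeneousSpan (α := β) (r₁ := s₁) (r₂ := s₂) hij (a * a')
  | succ j ih =>
    intro a' a hij
    obtain rfl : n = i + j + 1 := by omega
    rw [pow_succ', mul_assoc, ← mul_assoc, h2, add_mul, mul_assoc, mul_assoc]
    exact add_mem (two_mul_mem_homogeneousSpan (ih _ a' a rfl))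
      (h.one_mul_mem_homogeneous (ih _ a' (D a) rfl))

/-- Left multiplication by a monomial preserves homogeneity. -/
theorem monomial_mul_mem_homogeneous (h : OreRelations half D 0 0 0 0 0 β s₁ s₂) (i j : ℕ) (a : A)
    {n : ℕ} {s : S} (hs : s ∈ homogeneousSpan β s₁ s₂ n) :
    s₂ ^ j * (s₁ ^ i * β a) * s ∈ homogeneousSpan β s₁ s₂ (i + j + n) := by
  induction j with
  | zero =>
    rw [pow_zero, one_mul]
    induction i with
    | zero => simpa using h.coeff_mul_mem_homogeneous n s hs a
    | succ i ih =>
      rw [show s₁ ^ (i + 1) * β a * s = s₁ * (s₁ ^ i * β a * s) by simp only [pow_succ', mul_assoc],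
        show i + 1 + 0 + n = i + 0 + n + 1 by omega]
      exact h.one_mul_mem_homogeneous ih
  | succ j ih =>
    rw [pow_succ', mul_assoc s₂, mul_assoc s₂, show i + (j + 1) + n = i + j + n + 1 by omega]
    exact two_mul_mem_homogeneousSpan ih

/-! A linear map that matches the monomials in a deformation with those in the undeformed algebra
is multiplicative up to lower terms. -/

variable (hS : OreRelations half D 0 0 0 0 0 β s₁ s₂) (hR : OreRelations half D b c x y z α r₁ r₂)
  (Λ : S →ₗ[F] R) (hΛ : ∀ i j a, Λ (s₂ ^ j * (s₁ ^ i * β a)) = r₂ ^ j * (r₁ ^ i * α a))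

include hΛ in
theorem map_mem_lowerSpan {n : ℕ} {s : S} (hs : s ∈ homogeneousSpan β s₁ s₂ n) :
    Λ s ∈ lowerSpan α r₁ r₂ (n + 1) := by
  refine (homogeneousSpan_le (W := (lowerSpan α r₁ r₂ (n + 1)).comap Λ)
    fun i j a hij => ?_) hs
  rw [Submodule.mem_comap, hΛ]
  exact monomial_mem_lowerSpan (by omega) a

include hΛ in
theorem map_two_mul {n : ℕ} {s : S} (hs : s ∈ homogeneousSpan β s₁ s₂ n) :
    Λ (s₂ * s) = r₂ * Λ s := by
  refine (homogeneousSpan_le (W := LinearMap.eqLocus (Λ ∘ₗ LinearMap.mulLeft F s₂)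
    (LinearMap.mulLeft F r₂ ∘ₗ Λ)) fun i j a hij => ?_) hs
  have h := hΛ i (j + 1) a
  rw [pow_succ', pow_succ', mul_assoc, mul_assoc] at h
  simp [h, hΛ]

include hS hR hΛ in
theorem map_one_mul_sub_mem (n : ℕ) : ∀ s ∈ homogeneousSpan β s₁ s₂ n,
    Λ (s₁ * s) - r₁ * Λ s ∈ lowerSpan α r₁ r₂ (n + 1) := by
  suffices ∀ i j a, i + j = n → Λ (s₁ * (s₂ ^ j * (s₁ ^ i * β a))) -
      r₁ * Λ (s₂ ^ j * (s₁ ^ i * β a)) ∈ lowerSpan α r₁ r₂ (n + 1) from fun s hs =>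
    (homogeneousSpan_le (W := (lowerSpan α r₁ r₂ (n + 1)).comap
      (Λ ∘ₗ LinearMap.mulLeft F s₁ - LinearMap.mulLeft F r₁ ∘ₗ Λ)) this) hs
  intro i j
  induction j generalizing n with
  | zero =>
    intro a hij
    have h0 := hΛ i 0 a
    have h1 := hΛ (i + 1) 0 a
    simp only [pow_zero, one_mul, pow_succ', mul_assoc] at h0 h1 ⊢
    rw [h0, h1, sub_self]
    exact zero_mem _
  | succ j ih =>
    intro a hij
    obtain rfl : n = i + j + 1 := by omega
    have hm : s₂ ^ j * (s₁ ^ i * β a) ∈ homogeneousSpan β s₁ s₂ (i + j) :=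
      monomial_mem_homogeneousSpan rfl a
    have ih' := ih (i + j) a rfl
    rw [pow_succ', mul_assoc]
    generalize s₂ ^ j * (s₁ ^ i * β a) = m at hm ih'
    have h12 : s₁ * s₂ = s₂ * s₁ := by simpa using hS.one_mul_two
    have hl : Λ m ∈ lowerSpan α r₁ r₂ (i + j + 1) := map_mem_lowerSpan Λ hΛ hm
    rw [← mul_assoc, h12, mul_assoc, map_two_mul Λ hΛ (hS.one_mul_mem_homogeneous hm),
      map_two_mul Λ hΛ hm, ← mul_assoc, hR.one_mul_two]
    have e : r₂ * Λ (s₁ * m) - (r₂ * r₁ + (r₁ * α x + r₂ * α y + α z)) * Λ m =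
        r₂ * (Λ (s₁ * m) - r₁ * Λ m) -
          (r₁ * (α x * Λ m) + r₂ * (α y * Λ m) + α z * Λ m) := by noncomm_ring
    rw [e]
    exact sub_mem (two_mul_mem_lowerSpan ih') (add_mem (add_mem
      (hR.one_mul_mem (hR.coeff_mul_mem hl x)) (two_mul_mem_lowerSpan (hR.coeff_mul_mem hl y)))
      (lowerSpan_mono (by omega) (hR.coeff_mul_mem hl z)))

include hS hR hΛ in
theorem map_coeff_mul_sub_mem (n : ℕ) : ∀ s ∈ homogeneousSpan β s₁ s₂ n, ∀ a,
    Λ (β a * s) - α a * Λ s ∈ lowerSpan α r₁ r₂ n := by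
  suffices ∀ i j a' a, i + j = n → Λ (β a * (s₂ ^ j * (s₁ ^ i * β a'))) -
      α a * Λ (s₂ ^ j * (s₁ ^ i * β a')) ∈ lowerSpan α r₁ r₂ n from fun s hs a =>
    (homogeneousSpan_le (W := (lowerSpan α r₁ r₂ n).comap
      (Λ ∘ₗ LinearMap.mulLeft F (β a) - LinearMap.mulLeft F (α a) ∘ₗ Λ))
      fun i j a' => this i j a' a) hs
  intro i j
  induction j generalizing n with
  | zero =>
    induction i generalizing n with
    | zero =>
      intro a' a hij
      have h0 := hΛ 0 0 a'
      have h1 := hΛ 0 0 (a * a')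
      simp only [pow_zero, one_mul, map_mul] at h0 h1 ⊢
      rw [h0, h1, sub_self]
      exact zero_mem _
    | succ i ih =>
      intro a' a hij
      obtain rfl : n = i + 1 := by omega
      have hm : s₂ ^ 0 * (s₁ ^ i * β a') ∈ homogeneousSpan β s₁ s₂ i :=
        monomial_mem_homogeneousSpan (add_zero i) a'
      have ih' := ih i a' a rfl
      have h1 : Λ (s₁ * (s₂ ^ 0 * (s₁ ^ i * β a'))) = r₁ * Λ (s₂ ^ 0 * (s₁ ^ i * β a')) := by
        have h0 := hΛ i 0 a'
        have h1 := hΛ (i + 1) 0 a'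
        simp only [pow_zero, one_mul, pow_succ', mul_assoc] at h0 h1 ⊢
        rw [h0, h1]
      have h3 : s₂ ^ 0 * (s₁ ^ (i + 1) * β a') = s₁ * (s₂ ^ 0 * (s₁ ^ i * β a')) := by
        simp only [pow_zero, one_mul, pow_succ', mul_assoc]
      rw [h3, h1]
      clear h3 h1 ih
      generalize s₂ ^ 0 * (s₁ ^ i * β a') = m at hm ih' ⊢
      have hl : Λ m ∈ lowerSpan α r₁ r₂ (i + 1) := map_mem_lowerSpan Λ hΛ hm
      have h2 : β a * s₁ = s₁ * β a := by simpa using hS.coeff_mul_one a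
      rw [← mul_assoc, h2, mul_assoc, ← mul_assoc (α a), hR.coeff_mul_one]
      have e : Λ (s₁ * (β a * m)) - (r₁ * α a + α (b * D a)) * Λ m =
          (Λ (s₁ * (β a * m)) - r₁ * Λ (β a * m)) + r₁ * (Λ (β a * m) - α a * Λ m) -
            α (b * D a) * Λ m := by noncomm_ring
      rw [e]
      exact sub_mem (add_mem (map_one_mul_sub_mem hS hR Λ hΛ _ _
        (hS.coeff_mul_mem_homogeneous _ _ hm a)) (hR.one_mul_mem ih')) (hR.coeff_mul_mem hl _)
  | succ j ih =>
    intro a' a hij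
    obtain rfl : n = i + j + 1 := by omega
    have hm : s₂ ^ j * (s₁ ^ i * β a') ∈ homogeneousSpan β s₁ s₂ (i + j) :=
      monomial_mem_homogeneousSpan rfl a'
    have ih' := fun a => ih (i + j) a' a rfl
    rw [pow_succ', mul_assoc]
    generalize s₂ ^ j * (s₁ ^ i * β a') = m at hm ih'
    have hl : Λ m ∈ lowerSpan α r₁ r₂ (i + j + 1) := map_mem_lowerSpan Λ hΛ hm
    have h2 : β a * s₂ = s₂ * β a + s₁ * β (D a) := by simpa using hS.coeff_mul_two a
    rw [← mul_assoc, h2, add_mul, mul_assoc, mul_assoc, map_add,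
      map_two_mul Λ hΛ (hS.coeff_mul_mem_homogeneous _ _ hm a), map_two_mul Λ hΛ hm,
      ← mul_assoc (α a), hR.coeff_mul_two]
    have e : r₂ * Λ (β a * m) + Λ (s₁ * (β (D a) * m)) -
        (r₂ * α a + r₁ * α (D a) + α (b * binomD half D a + c * D a)) * Λ m =
        r₂ * (Λ (β a * m) - α a * Λ m) + (Λ (s₁ * (β (D a) * m)) - r₁ * Λ (β (D a) * m)) +
          r₁ * (Λ (β (D a) * m) - α (D a) * Λ m) -
            α (b * binomD half D a + c * D a) * Λ m := by noncomm_ring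
    rw [e]
    exact sub_mem (add_mem (add_mem (two_mul_mem_lowerSpan (ih' a))
      (map_one_mul_sub_mem hS hR Λ hΛ _ _ (hS.coeff_mul_mem_homogeneous _ _ hm _)))
      (hR.one_mul_mem (ih' _))) (hR.coeff_mul_mem hl _)

include hS hR hΛ in
theorem map_monomial_mul_sub_mem (i j : ℕ) (a : A) {n : ℕ} {s : S}
    (hs : s ∈ homogeneousSpan β s₁ s₂ n) :
    Λ (s₂ ^ j * (s₁ ^ i * β a) * s) - Λ (s₂ ^ j * (s₁ ^ i * β a)) * Λ s ∈
      lowerSpan α r₁ r₂ (i + j + n) := by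
  rw [hΛ]
  induction j with
  | zero =>
    induction i with
    | zero => simpa using map_coeff_mul_sub_mem hS hR Λ hΛ n s hs a
    | succ i ih =>
      have hm := hS.monomial_mul_mem_homogeneous i 0 a hs
      simp only [pow_zero, one_mul] at hm ih ⊢
      have e : Λ (s₁ ^ (i + 1) * β a * s) - r₁ ^ (i + 1) * α a * Λ s =
          (Λ (s₁ * (s₁ ^ i * β a * s)) - r₁ * Λ (s₁ ^ i * β a * s)) +
            r₁ * (Λ (s₁ ^ i * β a * s) - r₁ ^ i * α a * Λ s) := by
        simp only [pow_succ', mul_assoc, mul_sub]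
        abel
      rw [e, show i + 1 + 0 + n = i + 0 + n + 1 by omega]
      exact add_mem (map_one_mul_sub_mem hS hR Λ hΛ _ _ hm) (hR.one_mul_mem ih)
  | succ j ih =>
    have hm := hS.monomial_mul_mem_homogeneous i j a hs
    rw [pow_succ', pow_succ', mul_assoc s₂, mul_assoc s₂, mul_assoc r₂, mul_assoc r₂,
      map_two_mul Λ hΛ hm, ← mul_sub, show i + (j + 1) + n = i + j + n + 1 by omega]
    exact two_mul_mem_lowerSpan ih

end OreRelations

end Rewriting

/-! ### The transvection group and its group algebra -/

section Group

variable {p : ℕ}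

theorem gen_smul_v1 : gen p • v1 p = v1 p := by
  change Matrix.toLin' !![1, 1; 0, 1] (v1 p) = v1 p
  ext i; fin_cases i <;> simp [v1, Matrix.toLin'_apply]

theorem gen_smul_v2 : gen p • v2 p = v1 p + v2 p := by
  change Matrix.toLin' !![1, 1; 0, 1] (v2 p) = v1 p + v2 p
  ext i; fin_cases i <;> simp [v1, v2, Matrix.toLin'_apply]

theorem gen_pow_smul_v1 (n : ℕ) : gen p ^ n • v1 p = v1 p := by
  induction n with
  | zero => simp
  | succ n ih => rw [pow_succ, mul_smul, gen_smul_v1, ih]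

theorem gen_pow_smul_v2 (n : ℕ) : gen p ^ n • v2 p = (n : ZMod p) • v1 p + v2 p := by
  induction n with
  | zero => simp
  | succ n ih =>
    rw [pow_succ, mul_smul, gen_smul_v2, smul_add, gen_pow_smul_v1, ih]
    push_cast
    module

theorem vec_eq (v : V2 p) : v = v 0 • v1 p + v 1 • v2 p := by
  ext i; fin_cases i <;> simp [v1, v2]

theorem gen_pow_p : gen p ^ p = 1 := by
  have h (v : V2 p) : gen p ^ p • v = v := by
    rw [vec_eq v, smul_add, smul_comm (gen p ^ p), smul_comm (gen p ^ p), gen_pow_smul_v1,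
      gen_pow_smul_v2]
    simp
  refine Subtype.ext (Units.ext (LinearMap.ext fun v => ?_))
  exact h v

theorem gpow_zero_eq_one : (gpow 0 : FpG p) = 1 := by simp [gpow, MonoidAlgebra.one_def]

theorem gpow_add (i j : ℕ) : (gpow (i + j) : FpG p) = gpow i * gpow j := by
  simp [gpow, pow_add, MonoidAlgebra.single_mul_single]

theorem gpow_pow (i : ℕ) : (gpow i : FpG p) = gpow 1 ^ i := by
  simp [gpow, MonoidAlgebra.single_pow]

theorem gpow_p : (gpow p : FpG p) = 1 := by simp [gpow, gen_pow_p, MonoidAlgebra.one_def]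

variable [Fact p.Prime]

theorem exists_gen_pow (h : TG p) : ∃ i < p, h = gen p ^ i := by
  obtain ⟨h, n, rfl⟩ := h
  have hp : (p : ℤ) ≠ 0 := by exact_mod_cast (Fact.out : p.Prime).ne_zero
  have h1 : (0 : ℤ) ≤ n % p := Int.emod_nonneg n hp
  have h2 : n % p < p := Int.emod_lt_of_pos n (by have := (Fact.out : p.Prime).pos; omega)
  refine ⟨(n % p).toNat, by omega, ?_⟩
  have h3 : gen p ^ n = gen p ^ (n % p).toNat := by
    rw [← zpow_natCast, Int.toNat_of_nonneg h1]
    conv_lhs => rw [← Int.emod_add_mul_ediv n p, zpow_add, zpow_mul, zpow_natCast, gen_pow_p,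
      one_zpow, mul_one]
  rw [← h3]
  rfl

theorem TG_mul_comm (a b : TG p) : a * b = b * a := by
  obtain ⟨i, -, rfl⟩ := exists_gen_pow a
  obtain ⟨j, -, rfl⟩ := exists_gen_pow b
  rw [← pow_add, ← pow_add, add_comm]

instance : CommRing (FpG p) where
  __ := (inferInstance : Ring (FpG p))
  mul_comm a b := by
    induction a using MonoidAlgebra.induction_linear with
    | zero => rw [zero_mul, mul_zero]
    | add x y hx hy => rw [add_mul, mul_add, hx, hy]
    | single m r =>
      induction b using MonoidAlgebra.induction_linear with
      | zero => rw [zero_mul, mul_zero]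
      | add x y hx hy => rw [add_mul, mul_add, hx, hy]
      | single n s =>
        rw [MonoidAlgebra.single_mul_single, MonoidAlgebra.single_mul_single, TG_mul_comm, mul_comm]

/-- The exponent `i` of `h = g ^ i`, read off as the matrix entry in `h v₂ = i v₁ + v₂`. -/
def expo (h : TG p) : ZMod p := (h • v2 p) 0

@[simp]
theorem expo_gen_pow (i : ℕ) : expo (gen p ^ i) = i := by
  rw [expo, gen_pow_smul_v2]; simp [v1, v2]

theorem smul_v1 (h : TG p) : h • v1 p = v1 p := by
  obtain ⟨i, -, rfl⟩ := exists_gen_pow h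
  exact gen_pow_smul_v1 i

theorem smul_v2 (h : TG p) : h • v2 p = expo h • v1 p + v2 p := by
  obtain ⟨i, -, rfl⟩ := exists_gen_pow h
  rw [gen_pow_smul_v2, expo_gen_pow]

theorem expo_mul (h h' : TG p) : expo (h * h') = expo h + expo h' := by
  obtain ⟨i, -, rfl⟩ := exists_gen_pow h
  obtain ⟨j, -, rfl⟩ := exists_gen_pow h'
  rw [← pow_add]; simp

theorem gen_pow_injOn {i j : ℕ} (hi : i < p) (hj : j < p) (h : gen p ^ i = gen p ^ j) : i = j := by
  have := congrArg expo h
  rw [expo_gen_pow, expo_gen_pow, ZMod.natCast_eq_natCast_iff'] at this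
  rwa [Nat.mod_eq_of_lt hi, Nat.mod_eq_of_lt hj] at this

theorem expo_injective : Function.Injective (expo (p := p)) := by
  intro h h' e
  obtain ⟨i, hi, rfl⟩ := exists_gen_pow h
  obtain ⟨j, hj, rfl⟩ := exists_gen_pow h'
  rw [expo_gen_pow, expo_gen_pow, ZMod.natCast_eq_natCast_iff', Nat.mod_eq_of_lt hi,
    Nat.mod_eq_of_lt hj] at e
  rw [e]

instance : Finite (TG p) := Finite.of_injective _ expo_injective

theorem card_TG : Nat.card (TG p) = p := by
  rw [Nat.card_congr (Equiv.ofBijective expo ⟨expo_injective, fun c => ⟨gen p ^ c.val, by simp⟩⟩),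
    Nat.card_zmod]

/-- The Euler derivation `g ^ j ↦ j g ^ j` of the group algebra. -/
def euler : Derivation (ZMod p) (FpG p) (FpG p) :=
  Derivation.mk'
    { toFun a := .ofCoeff (Finsupp.onFinset a.coeff.support (fun h => expo h * a.coeff h)
        fun h hh => by simpa using right_ne_zero_of_mul hh)
      map_add' a a' := by ext h; simp [mul_add]
      map_smul' c a := by ext h; simp [mul_left_comm] }
    (by
      have key (h : TG p) (r : ZMod p) : (MonoidAlgebra.ofCoeff (Finsupp.onFinset
          (MonoidAlgebra.single h r : FpG p).coeff.support
          (fun h' => expo h' * (MonoidAlgebra.single h r : FpG p).coeff h')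
          fun h hh => by simpa using right_ne_zero_of_mul hh) : FpG p) =
          MonoidAlgebra.single h (expo h * r) := by
        classical
        ext h'
        by_cases hh : h = h' <;> simp [Finsupp.single_apply, hh]
      intro a b
      induction a using MonoidAlgebra.induction_linear with
      | zero => rw [zero_mul, map_zero, zero_smul, smul_zero, add_zero]
      | add x y hx hy => rw [add_mul, map_add, hx, hy, map_add]; simp only [smul_eq_mul]; ring
      | single h r =>
        induction b using MonoidAlgebra.induction_linear with
        | zero => rw [mul_zero, map_zero, zero_smul, smul_zero, add_zero]
        | add x y hx hy => rw [mul_add, map_add, hx, hy, map_add]; simp only [smul_eq_mul]; ring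
        | single h' s =>
          rw [MonoidAlgebra.single_mul_single]
          simp only [LinearMap.coe_mk, AddHom.coe_mk, key, smul_eq_mul,
            MonoidAlgebra.single_mul_single]
          rw [TG_mul_comm h' h, ← MonoidAlgebra.single_add, expo_mul]
          congr 1
          ring)

theorem coeff_euler (a : FpG p) (h : TG p) : (euler a).coeff h = expo h * a.coeff h := rfl

theorem euler_single (h : TG p) (r : ZMod p) :
    euler (.single h r : FpG p) = expo h • .single h r := by
  classical
  ext h'
  rw [coeff_euler]
  by_cases hh : h = h' <;> simp [hh]

theorem euler_gpow (i : ℕ) : euler (gpow i : FpG p) = (i : ZMod p) • gpow i := by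
  rw [gpow, euler_single, expo_gen_pow]

theorem half_add_half (hp : p ≠ 2) : (2⁻¹ : ZMod p) + 2⁻¹ = 1 := by
  have h2 : (2 : ZMod p) ≠ 0 := by
    intro h
    have : ((2 : ℕ) : ZMod p) = 0 := by exact_mod_cast h
    rw [ZMod.natCast_eq_zero_iff] at this
    exact hp ((Nat.prime_dvd_prime_iff_eq Fact.out Nat.prime_two).1 this)
  rw [← two_mul, mul_inv_cancel₀ h2]

theorem choose_two_cast (hp : p ≠ 2) (i : ℕ) :
    ((i.choose 2 : ℕ) : ZMod p) = 2⁻¹ * ((i : ZMod p) * i - i) := by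
  have h := half_add_half hp
  induction i with
  | zero => simp
  | succ i ih =>
    rw [Nat.choose_succ_succ' i 1, Nat.choose_one_right]
    push_cast
    rw [ih]
    linear_combination (-(i : ZMod p)) * h

theorem binomD_gpow (hp : p ≠ 2) (i : ℕ) :
    binomD 2⁻¹ euler (gpow i : FpG p) = (i.choose 2 : ZMod p) • gpow i := by
  rw [binomD_apply, euler_gpow, Derivation.map_smul, euler_gpow, choose_two_cast hp,
    smul_smul, ← sub_smul, smul_smul]

end Group

/-! ### The universal property of `H_{λ,κ}` -/

section Universal

variable {F G V : Type*} [CommRing F] [Group G] [AddCommGroup V] [Module F V]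
variable {R : Type*} [Ring R] [Algebra F R]

/-- The multiplication map `v ⊗ a ↦ v a` for images of `V` and `FG` in an algebra. -/
def tensorMul (ν : V →ₗ[F] R) (α : MonoidAlgebra F G →ₐ[F] R) : V ⊗[F] MonoidAlgebra F G →ₗ[F] R :=
  TensorProduct.lift ((LinearMap.mul F R).compl₁₂ ν α.toLinearMap)

@[simp]
theorem tensorMul_tmul (ν : V →ₗ[F] R) (α : MonoidAlgebra F G →ₐ[F] R) (v : V)
    (a : MonoidAlgebra F G) : tensorMul ν α (v ⊗ₜ a) = ν v * α a := by
  simp [tensorMul]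

variable [DistribMulAction G V] (P : Params F G V)

/-- The canonical homomorphism `FG → H_{λ,κ}`. -/
def H.of : MonoidAlgebra F G →ₐ[F] H P :=
  AlgHom.ofLinearMap ((H.mk P).toLinearMap ∘ₗ freeG F G V)
    (by simpa using H.mk_rel P (Rel.group_one (P := P)))
    (fun a b => by simpa using H.mk_rel P (Rel.group_mul (P := P) a b))

/-- The canonical map `V → H_{λ,κ}`. -/
def H.vec : V →ₗ[F] H P := (H.mk P).toLinearMap ∘ₗ freeV F G V

theorem H.single_mul_vec (h : G) (v : V) :
    H.of P (.single h 1) * H.vec P v =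
      H.vec P (h • v) * H.of P (.single h 1) + H.of P (P.lam (.single h 1) v) := by
  have := H.mk_rel P (Rel.group_vec h v)
  rw [map_mul, map_add, map_mul] at this
  exact this

theorem H.mk_freeVG (t : V ⊗[F] MonoidAlgebra F G) :
    H.mk P (freeVG F G V t) = tensorMul (H.vec P) (H.of P) t := by
  induction t with
  | zero => simp
  | add x y hx hy => rw [map_add, map_add, map_add, hx, hy]
  | tmul v a =>
    rw [tensorMul_tmul, freeVG, TensorProduct.lift.tmul]
    exact map_mul (H.mk P) _ _

theorem H.vec_mul_vec_sub (v w : V) :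
    H.vec P v * H.vec P w - H.vec P w * H.vec P v =
      H.of P (P.kap v w).1 + tensorMul (H.vec P) (H.of P) (P.kap v w).2 := by
  have := H.mk_rel P (Rel.vec_vec v w)
  rw [map_sub, map_mul, map_mul, map_add, H.mk_freeVG] at this
  exact this

variable {P}

/-- The universal property of `H_{λ,κ}`. -/
def H.lift (α : MonoidAlgebra F G →ₐ[F] R) (ν : V →ₗ[F] R)
    (h1 : ∀ (h : G) (v : V), α (.single h 1) * ν v =
      ν (h • v) * α (.single h 1) + α (P.lam (.single h 1) v))
    (h2 : ∀ v w : V, ν v * ν w - ν w * ν v = α (P.kap v w).1 + tensorMul ν α (P.kap v w).2) :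
    H P →ₐ[F] R :=
  RingQuot.liftAlgHom F ⟨TensorAlgebra.lift F (α.toLinearMap.coprod ν), by
    have hG (a : MonoidAlgebra F G) :
        TensorAlgebra.lift F (α.toLinearMap.coprod ν) (freeG F G V a) = α a := by simp [freeG]
    have hV (v : V) :
        TensorAlgebra.lift F (α.toLinearMap.coprod ν) (freeV F G V v) = ν v := by simp [freeV]
    have hVG (t : V ⊗[F] MonoidAlgebra F G) :
        TensorAlgebra.lift F (α.toLinearMap.coprod ν) (freeVG F G V t) = tensorMul ν α t := by
      induction t with
      | zero => simp
      | add x y hx hy => rw [map_add, map_add, map_add, hx, hy]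
      | tmul v a =>
        rw [tensorMul_tmul, freeVG, TensorProduct.lift.tmul, ← hG, ← hV]
        exact map_mul _ _ _
    intro x y hxy
    induction hxy with
    | group_one => rw [hG, map_one, map_one]
    | group_mul a b => rw [hG, map_mul α, map_mul, hG, hG]
    | group_vec h v => rw [map_mul, map_add, map_mul, hG, hV, hV, hG, h1]
    | vec_vec v w => rw [map_sub, map_mul, map_mul, map_add, hV, hV, hG, hVG, h2]⟩

theorem H.lift_of (α : MonoidAlgebra F G →ₐ[F] R) (ν : V →ₗ[F] R) (h1 h2)
    (a : MonoidAlgebra F G) : H.lift (P := P) α ν h1 h2 (H.of P a) = α a := by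
  change RingQuot.liftAlgHom F _ (RingQuot.mkAlgHom F _ (freeG F G V a)) = _
  rw [RingQuot.liftAlgHom_mkAlgHom_apply]
  simp [freeG]

theorem H.lift_vec (α : MonoidAlgebra F G →ₐ[F] R) (ν : V →ₗ[F] R) (h1 h2) (v : V) :
    H.lift (P := P) α ν h1 h2 (H.vec P v) = ν v := by
  change RingQuot.liftAlgHom F _ (RingQuot.mkAlgHom F _ (freeV F G V v)) = _
  rw [RingQuot.liftAlgHom_mkAlgHom_apply]
  simp [freeV]

end Universal

/-! ### Parameters in normal form -/

section Parameters

variable {p : ℕ} [Fact p.Prime]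

/-- The parameters with `λ(g, v₁) = b g`, `λ(g, v₂) = c g`, extended to a cocycle, and `κ`
alternating with `κ(v₁, v₂) = K`. -/
def mkParams (b c : FpG p) (K : FpG p × (V2 p ⊗[ZMod p] FpG p)) :
    Params (ZMod p) (TG p) (V2 p) where
  lam := LinearMap.mk₂ (ZMod p)
    (fun a v => v 0 • (b * euler a) + v 1 • (b * binomD 2⁻¹ euler a + c * euler a))
    (fun a a' v => by simp only [map_add, mul_add, smul_add]; abel)
    (fun s a v => by
      simp only [map_smul, Derivation.map_smul, mul_smul_comm, smul_add, smul_comm s])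
    (fun a v w => by simp only [Pi.add_apply, add_smul]; abel)
    (fun s a v => by simp only [Pi.smul_apply, smul_assoc, smul_add])
  kap := LinearMap.mk₂ (ZMod p) (fun v w => (v 0 * w 1 - v 1 * w 0) • K)
    (fun v v' w => by rw [← add_smul]; congr 1; simp only [Pi.add_apply]; ring)
    (fun s v w => by rw [smul_smul]; congr 1; simp only [Pi.smul_apply, smul_eq_mul]; ring)
    (fun v w w' => by rw [← add_smul]; congr 1; simp only [Pi.add_apply]; ring)
    (fun s v w => by rw [smul_smul]; congr 1; simp only [Pi.smul_apply, smul_eq_mul]; ring)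

variable (b c : FpG p) (K : FpG p × (V2 p ⊗[ZMod p] FpG p))

theorem mkParams_lam_apply (a : FpG p) (v : V2 p) : (mkParams b c K).lam a v =
    v 0 • (b * euler a) + v 1 • (b * binomD 2⁻¹ euler a + c * euler a) := rfl

theorem mkParams_kap_apply (v w : V2 p) :
    (mkParams b c K).kap v w = (v 0 * w 1 - v 1 * w 0) • K := rfl

theorem mkParams_lam_v1 (a : FpG p) : (mkParams b c K).lam a (v1 p) = b * euler a := by
  simp [mkParams_lam_apply, v1]

theorem mkParams_lam_v2 (a : FpG p) :
    (mkParams b c K).lam a (v2 p) = b * binomD 2⁻¹ euler a + c * euler a := by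
  simp [mkParams_lam_apply, v2]

theorem mkParams_kap_v1_v2 : (mkParams b c K).kap (v1 p) (v2 p) = K := by
  simp [mkParams_kap_apply, v1, v2]

variable {K} {R : Type*} [Ring R] [Algebra (ZMod p) R]

theorem coeff_mul_extend {α : FpG p →ₐ[ZMod p] R} {r : R} {φ : FpG p →ₗ[ZMod p] R}
    (h : ∀ g : TG p, α (.single g 1) * r = φ (.single g 1)) (a : FpG p) : α a * r = φ a := by
  induction a using MonoidAlgebra.induction_linear with
  | zero => simp
  | add x y hx hy => rw [map_add, add_mul, hx, hy, map_add]
  | single g s =>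
    have : (MonoidAlgebra.single g s : FpG p) = s • .single g 1 := by simp
    rw [this, map_smul, smul_mul_assoc, h, map_smul]

theorem H.relations (x y z : FpG p) (P : Params (ZMod p) (TG p) (V2 p))
    (hP : P = mkParams b c (z, v1 p ⊗ₜ x + v2 p ⊗ₜ y)) :
    OreRelations 2⁻¹ euler b c x y z (H.of P) (H.vec P (v1 p)) (H.vec P (v2 p)) where
  coeff_mul_one a := by
    refine coeff_mul_extend (φ := LinearMap.mulLeft _ (H.vec P (v1 p)) ∘ₗ (H.of P).toLinearMap +
      (H.of P).toLinearMap ∘ₗ LinearMap.mulLeft _ b ∘ₗ euler.toLinearMap) (fun g => ?_) a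
    rw [H.single_mul_vec, smul_v1, hP, mkParams_lam_v1]
    rfl
  coeff_mul_two a := by
    refine coeff_mul_extend (φ := LinearMap.mulLeft _ (H.vec P (v2 p)) ∘ₗ (H.of P).toLinearMap +
      LinearMap.mulLeft _ (H.vec P (v1 p)) ∘ₗ (H.of P).toLinearMap ∘ₗ euler.toLinearMap +
      (H.of P).toLinearMap ∘ₗ (LinearMap.mulLeft _ b ∘ₗ binomD 2⁻¹ euler +
        LinearMap.mulLeft _ c ∘ₗ euler.toLinearMap)) (fun g => ?_) a
    rw [H.single_mul_vec, smul_v2, hP, mkParams_lam_v2, map_add, map_smul, add_mul,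
      smul_mul_assoc, ← mul_smul_comm, ← map_smul, ← euler_single, add_comm (_ * _) (_ * _)]
    rfl
  one_mul_two := by
    rw [← sub_eq_iff_eq_add', H.vec_mul_vec_sub, hP, mkParams_kap_v1_v2]
    simp only [map_add, tensorMul_tmul]
    abel

/-- An algebra with elements satisfying the commutation relations receives a homomorphism from
`H_{λ,κ}`. -/
theorem H.exists_lift {x y z : FpG p} {α : FpG p →ₐ[ZMod p] R} {r₁ r₂ : R}
    (h : OreRelations 2⁻¹ euler b c x y z α r₁ r₂) (P : Params (ZMod p) (TG p) (V2 p))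
    (hP : P = mkParams b c (z, v1 p ⊗ₜ x + v2 p ⊗ₜ y)) :
    ∃ φ : H P →ₐ[ZMod p] R, (∀ a, φ (H.of P a) = α a) ∧ φ (H.vec P (v1 p)) = r₁ ∧
      φ (H.vec P (v2 p)) = r₂ := by
  let ν : V2 p →ₗ[ZMod p] R :=
    (LinearMap.proj 0).smulRight r₁ + (LinearMap.proj 1).smulRight r₂
  have hν (v : V2 p) : ν v = v 0 • r₁ + v 1 • r₂ := rfl
  have hν1 : ν (v1 p) = r₁ := by simp [hν, v1]
  have hν2 : ν (v2 p) = r₂ := by simp [hν, v2]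
  refine ⟨H.lift α ν (fun g v => ?_) (fun v w => ?_), H.lift_of _ _ _ _, ?_, ?_⟩
  · conv_lhs => rw [vec_eq v]
    conv_rhs => rw [vec_eq v]
    simp only [smul_add, smul_comm g, smul_v1, smul_v2, map_add, map_smul, hν1, hν2, mul_add,
      add_mul, mul_smul_comm, smul_mul_assoc, h.coeff_mul_one, h.coeff_mul_two, euler_single, hP,
      mkParams_lam_v1, mkParams_lam_v2]
    abel
  · have h12 := h.one_mul_two
    rw [hν, hν, hP, mkParams_kap_apply]
    simp only [Prod.smul_fst, Prod.smul_snd, map_smul, map_add, tensorMul_tmul, hν1, hν2]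
    rw [← smul_add, ← add_assoc, show α z + r₁ * α x + r₂ * α y = r₁ * r₂ - r₂ * r₁ by
      rw [h12]; abel]
    simp only [mul_add, add_mul, mul_smul_comm, smul_mul_assoc]
    module
  · rw [H.lift_vec, hν1]
  · rw [H.lift_vec, hν2]

end Parameters

/-! ### The skew group algebra -/

section SkewSide

instance {F G V : Type*} [CommRing F] [Group G] [AddCommGroup V] [Module F V]
    [DistribMulAction G V] [SMulCommClass G F V] : SMulCommClass G F (SymmetricAlgebra F V) where
  smul_comm h c s := map_smul (symAct F G V h) c s

variable {p : ℕ} [Fact p.Prime]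

/-- The inclusion of the group algebra into `S(V) ⋊ G`. -/
def skewOf : FpG p →ₐ[ZMod p] SkewGroupAlgebra (ZMod p) (TG p) (V2 p) :=
  MonoidAlgebra.lift (ZMod p) _ (TG p)
    { toFun h := SkewMonoidAlgebra.single h 1
      map_one' := rfl
      map_mul' h h' := by rw [SkewMonoidAlgebra.single_mul_single]; simp }

theorem skewOf_single (h : TG p) : skewOf (.single h 1 : FpG p) = SkewMonoidAlgebra.single h 1 := by
  simp [skewOf]

/-- The inclusion of `V` into `S(V) ⋊ G`. -/
def skewVec (v : V2 p) : SkewGroupAlgebra (ZMod p) (TG p) (V2 p) :=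
  SkewMonoidAlgebra.single 1 (SymmetricAlgebra.ι (ZMod p) (V2 p) v)

theorem smul_ι (h : TG p) (v : V2 p) : h • SymmetricAlgebra.ι (ZMod p) (V2 p) v =
    SymmetricAlgebra.ι (ZMod p) (V2 p) (h • v) := symAct_ι _ _ _ h v

theorem skewVec_mul_single (v : V2 p) (h : TG p) (s : SymmetricAlgebra (ZMod p) (V2 p)) :
    skewVec v * SkewMonoidAlgebra.single h s =
      SkewMonoidAlgebra.single h (SymmetricAlgebra.ι (ZMod p) (V2 p) v * s) := by
  rw [skewVec, SkewMonoidAlgebra.single_mul_single, one_mul, one_smul]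

theorem skewVec_add (v w : V2 p) : skewVec (v + w) = skewVec v + skewVec w := by
  rw [skewVec, map_add, SkewMonoidAlgebra.single_add]; rfl

theorem skewVec_smul (r : ZMod p) (v : V2 p) : skewVec (r • v) = r • skewVec v := by
  rw [skewVec, map_smul, skewVec, SkewMonoidAlgebra.smul_single]

theorem skewOf_single_mul_skewVec (h : TG p) (v : V2 p) :
    skewOf (.single h 1) * skewVec v = skewVec (h • v) * skewOf (.single h 1) := by
  rw [skewOf_single, skewVec_mul_single, skewVec, SkewMonoidAlgebra.single_mul_single, smul_ι,
    one_mul, mul_one, mul_one]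

theorem skewOf_mul_v1 (a : FpG p) : skewOf a * skewVec (v1 p) = skewVec (v1 p) * skewOf a := by
  induction a using MonoidAlgebra.induction_linear with
  | zero => rw [map_zero, zero_mul, mul_zero]
  | add x y hx hy => rw [map_add, add_mul, mul_add, hx, hy]
  | single h r =>
    have e : (MonoidAlgebra.single h r : FpG p) = r • .single h 1 := by simp
    rw [e, map_smul, smul_mul_assoc, mul_smul_comm, skewOf_single_mul_skewVec, smul_v1]

theorem skewOf_mul_v2 (a : FpG p) : skewOf a * skewVec (v2 p) =
    skewVec (v2 p) * skewOf a + skewVec (v1 p) * skewOf (euler a) := by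
  induction a using MonoidAlgebra.induction_linear with
  | zero => simp only [map_zero, zero_mul, mul_zero, add_zero]
  | add x y hx hy => rw [map_add, add_mul, mul_add, hx, hy, map_add, map_add, mul_add]; abel
  | single h r =>
    have e : (MonoidAlgebra.single h r : FpG p) = r • .single h 1 := by simp
    rw [e, Derivation.map_smul, euler_single, map_smul, map_smul, map_smul, smul_mul_assoc,
      mul_smul_comm, mul_smul_comm, mul_smul_comm, skewOf_single_mul_skewVec, smul_v2,
      skewVec_add, skewVec_smul, add_mul, smul_mul_assoc, smul_add, add_comm]

theorem skew_relations : OreRelations (2⁻¹ : ZMod p) (euler (p := p)) 0 0 0 0 0 skewOf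
    (skewVec (v1 p)) (skewVec (v2 p)) where
  coeff_mul_one a := by rw [skewOf_mul_v1, zero_mul, map_zero, add_zero]
  coeff_mul_two a := by rw [skewOf_mul_v2, zero_mul, zero_mul, add_zero, map_zero, add_zero]
  one_mul_two := by
    rw [map_zero, mul_zero, mul_zero, add_zero, add_zero, add_zero]
    nth_rewrite 2 [skewVec]
    nth_rewrite 3 [skewVec]
    rw [skewVec_mul_single, skewVec_mul_single, mul_comm]

theorem skew_monomial (i j : ℕ) (h : TG p) :
    skewVec (v2 p) ^ j * (skewVec (v1 p) ^ i * skewOf (.single h 1)) =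
      SkewMonoidAlgebra.single h (SymmetricAlgebra.ι (ZMod p) (V2 p) (v2 p) ^ j *
        SymmetricAlgebra.ι (ZMod p) (V2 p) (v1 p) ^ i) := by
  have key (v : V2 p) (n : ℕ) (s : SymmetricAlgebra (ZMod p) (V2 p)) :
      skewVec v ^ n * SkewMonoidAlgebra.single h s =
        SkewMonoidAlgebra.single h (SymmetricAlgebra.ι (ZMod p) (V2 p) v ^ n * s) := by
    induction n with
    | zero => simp
    | succ n ih => rw [pow_succ', mul_assoc, ih, skewVec_mul_single, pow_succ', mul_assoc]
  rw [skewOf_single, key, key, mul_one]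

/-- The exponents of a monomial and a group element, as a triple `(j, i, h)`. -/
def monomialIndex : (Σ _ : TG p, Fin 2 →₀ ℕ) ≃ ℕ × ℕ × TG p where
  toFun s := (s.2 1, s.2 0, s.1)
  invFun t := ⟨t.2.2, Finsupp.equivFunOnFinite.symm ![t.2.1, t.1]⟩
  left_inv s := by
    refine Sigma.ext rfl (heq_of_eq ?_)
    ext i; fin_cases i <;> rfl
  right_inv t := rfl

/-- The monomials `v₂ ^ j v₁ ^ i h` as a basis of `S(V) ⋊ G`, indexed by `(j, i, h)`. -/
def skewBasis : Module.Basis (ℕ × ℕ × TG p) (ZMod p) (SkewGroupAlgebra (ZMod p) (TG p) (V2 p)) :=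
  ((Finsupp.basis fun _ : TG p => (Pi.basisFun (ZMod p) (Fin 2)).symmetricAlgebra).map
    (SkewMonoidAlgebra.coeffLinearEquiv (S := ZMod p)).symm).reindex monomialIndex

theorem skewBasis_apply (j i : ℕ) (h : TG p) : skewBasis (j, i, h) =
    skewVec (v2 p) ^ j * (skewVec (v1 p) ^ i * skewOf (.single h 1)) := by
  have e1 : v1 p = Pi.basisFun (ZMod p) (Fin 2) 0 := by
    ext i; fin_cases i <;> simp [v1]
  have e2 : v2 p = Pi.basisFun (ZMod p) (Fin 2) 1 := by
    ext i; fin_cases i <;> simp [v2]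
  have e3 : (Pi.basisFun (ZMod p) (Fin 2)).symmetricAlgebra
      (Finsupp.equivFunOnFinite.symm ![i, j]) =
      SymmetricAlgebra.ι (ZMod p) (V2 p) (v2 p) ^ j *
        SymmetricAlgebra.ι (ZMod p) (V2 p) (v1 p) ^ i := by
    change (SymmetricAlgebra.equivMvPolynomial (Pi.basisFun (ZMod p) (Fin 2))).symm
      (MvPolynomial.basisMonomials (Fin 2) (ZMod p) (Finsupp.equivFunOnFinite.symm ![i, j])) = _
    have e4 : MvPolynomial.basisMonomials (Fin 2) (ZMod p) (Finsupp.equivFunOnFinite.symm ![i, j]) =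
        MvPolynomial.X 0 ^ i * MvPolynomial.X 1 ^ j := by
      rw [MvPolynomial.coe_basisMonomials]
      change MvPolynomial.monomial _ 1 = _
      rw [MvPolynomial.monomial_eq, Finsupp.prod_fintype _ _ (by simp)]
      simp
    rw [e4, map_mul, map_pow, map_pow, SymmetricAlgebra.equivMvPolynomial_symm_X,
      SymmetricAlgebra.equivMvPolynomial_symm_X, e1, e2, mul_comm]
  rw [skew_monomial, ← e3, skewBasis, Module.Basis.reindex_apply, Module.Basis.map_apply,
    Finsupp.coe_basis]
  rfl

/-- The total degree of the monomial with index `(j, i, h)`. -/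
def monomialDeg (t : ℕ × ℕ × TG p) : ℕ := t.2.1 + t.1

end SkewSide

/-- Monomials `r₂ ^ j r₁ ^ i a` with `a` in the group algebra are spanned by those with `a` in the
group. -/
theorem span_monomials {p : ℕ} {R : Type*} [Ring R] [Algebra (ZMod p) R]
    (α : FpG p →ₐ[ZMod p] R) (r₁ r₂ : R) (T : ℕ → Prop) :
    Submodule.span (ZMod p) {x | ∃ i j a, T (i + j) ∧ x = r₂ ^ j * (r₁ ^ i * α a)} =
      Submodule.span (ZMod p) ((fun t : ℕ × ℕ × TG p =>
        r₂ ^ t.1 * (r₁ ^ t.2.1 * α (.single t.2.2 1))) '' {t | T (monomialDeg t)}) := by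
  refine le_antisymm (Submodule.span_le.2 ?_) (Submodule.span_mono ?_)
  · rintro _ ⟨i, j, a, hT, rfl⟩
    induction a using MonoidAlgebra.induction_linear with
    | zero => simp
    | add x y hx hy => rw [map_add, mul_add, mul_add]; exact Submodule.add_mem _ hx hy
    | single h r =>
      have : (MonoidAlgebra.single h r : FpG p) = r • .single h 1 := by simp
      rw [this, map_smul, mul_smul_comm, mul_smul_comm]
      exact Submodule.smul_mem _ _ (Submodule.subset_span ⟨(j, i, h), hT, rfl⟩)
  · rintro _ ⟨⟨j, i, h⟩, hT, rfl⟩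
    exact ⟨i, j, _, hT, rfl⟩

section SkewSide

variable {p : ℕ} [Fact p.Prime]

theorem span_skewBasis (n : ℕ) : Submodule.span (ZMod p) (skewBasis '' {t | monomialDeg t = n}) =
    homogeneousSpan (skewOf (p := p)) (skewVec (v1 p)) (skewVec (v2 p)) n := by
  rw [homogeneousSpan, span_monomials _ _ _ (· = n)]
  congr! 3 with t
  exact skewBasis_apply _ _ _

theorem skewGrade_eq (n : ℕ) : skewGrade (ZMod p) (TG p) (V2 p) n =
    homogeneousSpan (skewOf (p := p)) (skewVec (v1 p)) (skewVec (v2 p)) n := by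
  refine le_antisymm (Submodule.span_le.2 ?_) ?_
  · rintro _ ⟨h, s, hs, rfl⟩
    induction n generalizing s with
    | zero =>
      rw [pow_zero, Submodule.mem_one] at hs
      obtain ⟨r, rfl⟩ := hs
      have := monomial_mem_homogeneousSpan (α := skewOf (p := p)) (r₁ := skewVec (v1 p))
        (r₂ := skewVec (v2 p)) (add_zero 0) (.single h r)
      have e : (MonoidAlgebra.single h r : FpG p) = r • .single h 1 := by simp
      rw [e, map_smul, skewOf_single, SkewMonoidAlgebra.smul_single] at this
      simpa [Algebra.algebraMap_eq_smul_one] using this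
    | succ n ih =>
      rw [pow_succ'] at hs
      induction hs using Submodule.mul_induction_on' with
      | add x _ y _ hx hy => rw [SkewMonoidAlgebra.single_add]; exact add_mem hx hy
      | mem_mul_mem u hu t ht =>
        obtain ⟨v, rfl⟩ := hu
        rw [← skewVec_mul_single]
        have e : skewVec v = v 0 • skewVec (v1 p) + v 1 • skewVec (v2 p) := by
          conv_lhs => rw [vec_eq v]
          rw [skewVec_add, skewVec_smul, skewVec_smul]
        rw [e, add_mul, smul_mul_assoc, smul_mul_assoc]
        exact add_mem (Submodule.smul_mem _ _ (skew_relations.one_mul_mem_homogeneous (ih t ht)))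
          (Submodule.smul_mem _ _ (two_mul_mem_homogeneousSpan (ih t ht)))
  · rw [homogeneousSpan, span_monomials _ _ _ (· = n)]
    refine Submodule.span_mono ?_
    rintro _ ⟨⟨j, i, h⟩, hn, rfl⟩
    have hn : i + j = n := hn
    refine ⟨h, _, ?_, skew_monomial _ _ _⟩
    rw [← hn, add_comm i j, pow_add]
    exact Submodule.mul_mem_mul (Submodule.pow_mem_pow _ (LinearMap.mem_range_self _ _) j)
      (Submodule.pow_mem_pow _ (LinearMap.mem_range_self _ _) i)

end SkewSide

/-! ### The Poincaré–Birkhoff–Witt property -/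

section PBW

variable {p : ℕ} [Fact p.Prime] {b c x y z : FpG p} (P : Params (ZMod p) (TG p) (V2 p))

theorem fil_mono {m n : ℕ} (h : m ≤ n) : fil P m ≤ fil P n := by
  induction n, h using Nat.le_induction with
  | base => exact le_rfl
  | succ n _ ih => exact ih.trans le_sup_left

theorem of_mem_fil (a : FpG p) : H.of P a ∈ fil P 0 := ⟨a, rfl⟩

theorem vec_mem_fil (v : V2 p) : H.vec P v ∈ fil P 1 := by
  refine (le_sup_right : _ ≤ fil P 1) ?_
  have := Submodule.mul_mem_mul (Submodule.mul_mem_mul (one_mem_HG P)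
    (show H.vec P v ∈ HV P from ⟨v, rfl⟩)) (one_mem_HG P)
  rwa [one_mul, mul_one] at this

theorem pow_mem_fil {r : H P} (h : r ∈ fil P 1) (n : ℕ) : r ^ n ∈ fil P n := by
  induction n with
  | zero => rw [pow_zero]; exact one_mem_HG P
  | succ n ih => rw [pow_succ]; exact fil_mul_fil P n 1 (Submodule.mul_mem_mul ih h)

theorem H.vec_eq (v : V2 p) : H.vec P v = v 0 • H.vec P (v1 p) + v 1 • H.vec P (v2 p) := by
  conv_lhs => rw [DrinfeldOrbifold.vec_eq v, map_add, map_smul, map_smul]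

variable {P}

/-- The monomials `v₂ ^ j v₁ ^ i a` of degree at most `n` span the `n`-th piece of the filtration. -/
theorem fil_eq_lowerSpan (h : OreRelations 2⁻¹ euler b c x y z (H.of P) (H.vec P (v1 p))
    (H.vec P (v2 p))) (n : ℕ) :
    fil P n = lowerSpan (H.of P) (H.vec P (v1 p)) (H.vec P (v2 p)) (n + 1) := by
  apply le_antisymm
  · have key (n : ℕ) : ∀ m, fil P n * lowerSpan (H.of P) (H.vec P (v1 p)) (H.vec P (v2 p)) m ≤
        lowerSpan (H.of P) (H.vec P (v1 p)) (H.vec P (v2 p)) (n + m) := by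
      induction n with
      | zero =>
        intro m
        rw [Submodule.mul_le]
        rintro _ ⟨a, rfl⟩ s hs
        rw [zero_add]
        exact h.coeff_mul_mem hs a
      | succ n ih =>
        intro m
        simp only [fil]
        rw [Submodule.sup_mul, mul_assoc, mul_assoc]
        refine sup_le ((ih m).trans (lowerSpan_mono (by omega))) ?_
        rw [show n + 1 + m = n + (m + 1) by omega]
        refine le_trans (mul_le_mul' le_rfl ?_) (ih (m + 1))
        rw [Submodule.mul_le]
        rintro _ ⟨v, rfl⟩ s hs
        have hs' : s ∈ lowerSpan (H.of P) (H.vec P (v1 p)) (H.vec P (v2 p)) m := by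
          refine (Submodule.mul_le.2 ?_ : HG P * _ ≤ _) hs
          rintro _ ⟨a, rfl⟩ s hs
          exact h.coeff_mul_mem hs a
        change H.vec P v * s ∈ _
        rw [H.vec_eq P v, add_mul, smul_mul_assoc, smul_mul_assoc]
        exact add_mem (Submodule.smul_mem _ _ (h.one_mul_mem hs'))
          (Submodule.smul_mem _ _ (two_mul_mem_lowerSpan hs'))
    intro s hs
    have h1 : (1 : H P) ∈ lowerSpan (H.of P) (H.vec P (v1 p)) (H.vec P (v2 p)) 1 := by
      simpa using monomial_mem_lowerSpan (α := H.of P) (r₁ := H.vec P (v1 p))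
        (r₂ := H.vec P (v2 p)) (show 0 + 0 < 1 by omega) 1
    simpa using key n 1 (Submodule.mul_mem_mul hs h1)
  · refine lowerSpan_le fun i j a hij => fil_mono P (show i + j ≤ n by omega) ?_
    have h1 := fil_mul_fil P i 0 (Submodule.mul_mem_mul
      (pow_mem_fil P (vec_mem_fil P (v1 p)) i) (of_mem_fil P a))
    have h2 := fil_mul_fil P j (i + 0) (Submodule.mul_mem_mul
      (pow_mem_fil P (vec_mem_fil P (v2 p)) j) h1)
    rwa [add_zero, add_comm] at h2

theorem exists_mem_fil (P : Params (ZMod p) (TG p) (V2 p)) (s : H P) : ∃ n, s ∈ fil P n := by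
  obtain ⟨t, rfl⟩ := RingQuot.mkAlgHom_surjective (ZMod p) _ s
  change ∃ n, H.mk P t ∈ fil P n
  induction t using TensorAlgebra.induction with
  | algebraMap r =>
    refine ⟨0, ?_⟩
    rw [AlgHom.commutes, ← (H.of P).commutes]
    exact of_mem_fil P _
  | ι m =>
    have h : H.mk P (TensorAlgebra.ι (ZMod p) m) = H.of P m.1 + H.vec P m.2 := by
      have : m = (m.1, 0) + (0, m.2) := by simp
      conv_lhs => rw [this, map_add, map_add]
      rfl
    rw [h]
    exact ⟨1, add_mem (fil_mono P zero_le_one (of_mem_fil P _)) (vec_mem_fil P _)⟩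
  | mul s t hs ht =>
    obtain ⟨m, hm⟩ := hs
    obtain ⟨n, hn⟩ := ht
    exact ⟨m + n, by rw [map_mul]; exact fil_mul_fil P m n (Submodule.mul_mem_mul hm hn)⟩
  | add s t hs ht =>
    obtain ⟨m, hm⟩ := hs
    obtain ⟨n, hn⟩ := ht
    exact ⟨m + n, by
      rw [map_add]
      exact add_mem (fil_mono P (by omega) hm) (fil_mono P (by omega) hn)⟩

/-- Coordinates in which the monomials of the double Ore extension are linearly independent. -/
theorem linearIndependent_single : LinearIndependent (ZMod p) (fun t : ℕ × ℕ × TG p =>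
    (Finsupp.single t.1 (Finsupp.single t.2.1 (.single t.2.2 1)) : ℕ →₀ ℕ →₀ FpG p)) := by
  let B : Module.Basis (Σ _ : ℕ, Σ _ : ℕ, TG p) (ZMod p) (ℕ →₀ ℕ →₀ FpG p) :=
    Finsupp.basis fun _ => Finsupp.basis fun _ => MonoidAlgebra.basis (TG p) (ZMod p)
  have := B.linearIndependent.comp (fun t : ℕ × ℕ × TG p => ⟨t.1, t.2.1, t.2.2⟩) (by
    rintro ⟨j, i, h⟩ ⟨j', i', h'⟩ e
    simp only [Sigma.mk.injEq, heq_eq_eq] at e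
    simp [e])
  convert this using 2 with t
  simp only [B, Function.comp_apply, Finsupp.coe_basis]
  rfl

/-- The sufficient condition: the monomials are linearly independent, because `H` acts on the
double Ore extension, so the associated graded algebra is `S(V) ⋊ G`. -/
theorem isDrinfeldOrbifold_mkParams (hp : p ≠ 2)
    (hb : b * (x + euler c - (2⁻¹ : ZMod p) • (euler (euler b) + euler b)) = 0) :
    IsDrinfeldOrbifold (mkParams b c (z, v1 p ⊗ₜ x + v2 p ⊗ₜ euler b)) := by
  obtain ⟨P, hP⟩ : ∃ P, P = mkParams b c (z, v1 p ⊗ₜ x + v2 p ⊗ₜ euler b) := ⟨_, rfl⟩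
  rw [← hP]
  have hH := H.relations b c x (euler b) z P hP
  have hh := half_add_half hp
  obtain ⟨φ, hφ, hφ1, hφ2⟩ := H.exists_lift b c
    (doubleRep_relations (2⁻¹ : ZMod p) euler b c x z hh hb) P hP
  obtain ⟨N, hN⟩ := exists_normalForm (2⁻¹ : ZMod p) euler b c x z hh hb φ hφ hφ1 hφ2
  let mono : ℕ × ℕ × TG p → H P := fun t =>
    H.vec P (v2 p) ^ t.1 * (H.vec P (v1 p) ^ t.2.1 * H.of P (.single t.2.2 1))
  have hli : LinearIndependent (ZMod p) mono := by
    refine LinearIndependent.of_comp N ?_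
    convert linearIndependent_single (p := p) using 2 with t
    exact hN _ _ _
  have hspan (n : ℕ) : fil P n = Submodule.span (ZMod p) (mono '' {t | monomialDeg t ≤ n}) := by
    rw [fil_eq_lowerSpan hH, lowerSpan, span_monomials _ _ _ (· < n + 1)]
    simp only [Nat.lt_succ_iff]
    rfl
  have htop : ⊤ ≤ Submodule.span (ZMod p) (Set.range mono) := by
    intro s _
    obtain ⟨n, hn⟩ := exists_mem_fil P s
    rw [hspan] at hn
    exact Submodule.span_mono (Set.image_subset_range _ _) hn
  let Λ : SkewGroupAlgebra (ZMod p) (TG p) (V2 p) ≃ₗ[ZMod p] H P :=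
    skewBasis.equiv (Module.Basis.mk hli htop) (Equiv.refl _)
  have hΛ (t : ℕ × ℕ × TG p) : Λ (skewBasis t) = mono t := by
    simp only [Λ, Module.Basis.equiv_apply, Module.Basis.mk_apply, Equiv.refl_apply]
  have hΛ' (i j : ℕ) (a : FpG p) :
      Λ (skewVec (v2 p) ^ j * (skewVec (v1 p) ^ i * skewOf a)) =
        H.vec P (v2 p) ^ j * (H.vec P (v1 p) ^ i * H.of P a) := by
    induction a using MonoidAlgebra.induction_linear with
    | zero => simp only [map_zero, mul_zero]
    | add x y hx hy => simp only [map_add, mul_add, hx, hy]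
    | single h r =>
      have e : (MonoidAlgebra.single h r : FpG p) = r • .single h 1 := by simp
      rw [e, map_smul, map_smul, mul_smul_comm, mul_smul_comm, mul_smul_comm, mul_smul_comm,
        map_smul, ← skewBasis_apply, hΛ]
  have hfil (n : ℕ) : fil P n =
      Submodule.span (ZMod p) ((fun t => Λ (skewBasis t)) '' {t | monomialDeg t ≤ n}) := by
    simp only [hΛ]; exact hspan n
  have hlt (n : ℕ) : lowerSpan (H.of P) (H.vec P (v1 p)) (H.vec P (v2 p)) n ≤ filLT (fil P) n := by
    refine lowerSpan_le fun i j a hij => mem_filLT hij ?_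
    rw [fil_eq_lowerSpan hH]
    exact monomial_mem_lowerSpan (by omega) a
  obtain ⟨E, h1, h2⟩ := exists_gr_equiv (fil P) skewBasis monomialDeg Λ hfil
    (by
      rintro ⟨j, i, h⟩ ⟨j', i', h'⟩
      have hs : skewBasis (j', i', h') ∈ homogeneousSpan (skewOf (p := p)) (skewVec (v1 p))
          (skewVec (v2 p)) (i' + j') := by
        rw [skewBasis_apply]; exact monomial_mem_homogeneousSpan rfl _
      rw [span_skewBasis, skewBasis_apply j i h]
      exact ⟨skew_relations.monomial_mul_mem_homogeneous i j _ hs,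
        hlt _ (OreRelations.map_monomial_mul_sub_mem skew_relations hH Λ.toLinearMap hΛ' i j _ hs)⟩)
    ⟨(0, 0, 1), by rw [skewBasis_apply, pow_zero, pow_zero, one_mul, one_mul, skewOf_single]; rfl,
      rfl, by rw [hΛ]; simp [mono, ← MonoidAlgebra.one_def]⟩
  refine ⟨E, h1, fun n => ?_⟩
  rw [skewGrade_eq, ← span_skewBasis]
  exact h2 n

end PBW

/-! ### Necessity of the conditions -/

section Necessity

variable {p : ℕ} [Fact p.Prime]

/-- The coefficient of `v_{i+1}` of an element of `V ⊗ FG`. -/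
def tensorCoord (i : Fin 2) : V2 p ⊗[ZMod p] FpG p →ₗ[ZMod p] FpG p :=
  TensorProduct.lift (LinearMap.lsmul (ZMod p) (FpG p) ∘ₗ LinearMap.proj i)

@[simp]
theorem tensorCoord_tmul (i : Fin 2) (v : V2 p) (a : FpG p) :
    tensorCoord i (v ⊗ₜ a) = v i • a := by simp [tensorCoord]

theorem tensor_eq (t : V2 p ⊗[ZMod p] FpG p) :
    t = v1 p ⊗ₜ tensorCoord 0 t + v2 p ⊗ₜ tensorCoord 1 t := by
  induction t with
  | zero => simp
  | add s t hs ht =>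
    conv_lhs => rw [hs, ht]
    simp only [map_add, tmul_add]
    abel
  | tmul v a =>
    conv_lhs => rw [vec_eq v]
    simp only [add_tmul, tensorCoord_tmul, tmul_smul, smul_tmul']

theorem tensorCoord_zero_basis (x y : FpG p) :
    tensorCoord 0 (v1 p ⊗ₜ[ZMod p] x + v2 p ⊗ₜ y) = x := by simp [v1, v2]

theorem tensorCoord_one_basis (x y : FpG p) :
    tensorCoord 1 (v1 p ⊗ₜ[ZMod p] x + v2 p ⊗ₜ y) = y := by simp [v1, v2]

/-- The map `FG ⊕ (V ⊗ FG) → H` onto the elements of degree at most one. -/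
def degreeOneMap (P : Params (ZMod p) (TG p) (V2 p)) :
    (FpG p × (V2 p ⊗[ZMod p] FpG p)) →ₗ[ZMod p] H P :=
  (H.of P).toLinearMap.coprod (tensorMul (H.vec P) (H.of P))

theorem fil_one_le_range (P : Params (ZMod p) (TG p) (V2 p)) :
    fil P 1 ≤ LinearMap.range (degreeOneMap P) := by
  have h0 (a : FpG p) : H.of P a ∈ LinearMap.range (degreeOneMap P) :=
    ⟨(a, 0), by simp [degreeOneMap]⟩
  have hv (v : V2 p) (a : FpG p) : H.vec P v * H.of P a ∈ LinearMap.range (degreeOneMap P) :=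
    ⟨(0, v ⊗ₜ a), by simp [degreeOneMap]⟩
  have key (a : FpG p) (v : V2 p) (a' : FpG p) :
      H.of P a * H.vec P v * H.of P a' ∈ LinearMap.range (degreeOneMap P) := by
    induction a using MonoidAlgebra.induction_linear with
    | zero => simp
    | add x y hx hy => simpa only [map_add, add_mul] using add_mem hx hy
    | single g r =>
      have e : (MonoidAlgebra.single g r : FpG p) = r • .single g 1 := by simp
      rw [e, map_smul, smul_mul_assoc, smul_mul_assoc, H.single_mul_vec, add_mul, mul_assoc,
        ← map_mul, ← map_mul]
      exact Submodule.smul_mem _ _ (add_mem (hv _ _) (h0 _))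
  refine sup_le ?_ ?_
  · rintro _ ⟨a, rfl⟩
    exact h0 a
  · change HG P * HV P * HG P ≤ _
    rw [mul_assoc, Submodule.mul_le]
    rintro _ ⟨a, rfl⟩ s hs
    induction hs using Submodule.mul_induction_on' with
    | mem_mul_mem u hu w hw =>
      obtain ⟨v, rfl⟩ := hu
      obtain ⟨a', rfl⟩ := hw
      rw [← mul_assoc]
      exact key a v a'
    | add s _ t _ hs ht => rw [mul_add]; exact add_mem hs ht

theorem finrank_FpG : Module.finrank (ZMod p) (FpG p) = p := by
  have := Fintype.ofFinite (TG p)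
  rw [Module.finrank_eq_card_basis (MonoidAlgebra.basis (TG p) (ZMod p)),
    ← Nat.card_eq_fintype_card, card_TG]

instance : Module.Finite (ZMod p) (FpG p) := by
  have := Fintype.ofFinite (TG p)
  exact Module.Finite.of_basis (MonoidAlgebra.basis (TG p) (ZMod p))

theorem finrank_skewGrade (n : ℕ) :
    Module.finrank (ZMod p) (skewGrade (ZMod p) (TG p) (V2 p) n) = (n + 1) * p := by
  have := Fintype.ofFinite (TG p)
  let f : Fin (n + 1) × TG p → ℕ × ℕ × TG p := fun t => (t.1, n - t.1, t.2)
  have hf : Function.Injective f := by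
    rintro ⟨j, h⟩ ⟨j', h'⟩ e
    simp only [f, Prod.mk.injEq] at e
    exact Prod.ext (Fin.ext e.1) e.2.2
  have hr : skewBasis '' {t | monomialDeg t = n} = Set.range (skewBasis (p := p) ∘ f) := by
    rw [Set.range_comp]
    congr 1
    ext ⟨j, i, h⟩
    simp only [monomialDeg, Set.mem_ofPred_eq, Set.mem_range, f, Prod.mk.injEq, Prod.exists]
    constructor
    · intro e
      exact ⟨⟨j, by omega⟩, h, rfl, by dsimp only; omega, rfl⟩
    · rintro ⟨j', h', rfl, rfl, rfl⟩
      omega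
  rw [skewGrade_eq, ← span_skewBasis, hr,
    finrank_span_eq_card (skewBasis.linearIndependent.comp f hf)]
  rw [Fintype.card_prod, Fintype.card_fin, ← Nat.card_eq_fintype_card, card_TG]

theorem finrank_Gr {P : Params (ZMod p) (TG p) (V2 p)} (hP : IsDrinfeldOrbifold P) (n : ℕ) :
    Module.finrank (ZMod p) (Gr (fil P) n) = (n + 1) * p := by
  obtain ⟨e, h1, h2⟩ := hP
  have hadd (x y : grH P) : e (x + y) = e x + e y := e.map_add' x y
  have hinj : Function.Injective e := e.toEquiv.injective
  generalize hE : (e : grH P → SkewGroupAlgebra (ZMod p) (TG p) (V2 p)) = E at hadd hinj h1 h2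
  clear hE e
  let f : Gr (fil P) n →ₗ[ZMod p] SkewGroupAlgebra (ZMod p) (TG p) (V2 p) :=
    { toFun x := E (DirectSum.of (Gr (fil P)) n x)
      map_add' x y := (congrArg E (map_add (DirectSum.of (Gr (fil P)) n) x y)).trans (hadd _ _)
      map_smul' c x :=
        (congrArg E (map_smul (DirectSum.lof (ZMod p) ℕ (Gr (fil P)) n) c x)).trans (h1 c _) }
  have hf : Function.Injective f := hinj.comp (DirectSum.of_injective n)
  have hr : LinearMap.range f = skewGrade (ZMod p) (TG p) (V2 p) n := SetLike.coe_injective (h2 n)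
  rw [← LinearMap.finrank_range_of_inj hf, hr, finrank_skewGrade]

/-- For a Drinfeld orbifold algebra, `FG ⊕ (V ⊗ FG)` embeds into `H`, by counting dimensions in
degrees zero and one. -/
theorem degreeOneMap_injective {P : Params (ZMod p) (TG p) (V2 p)} (hP : IsDrinfeldOrbifold P) :
    Function.Injective (degreeOneMap P) := by
  have h0 := finrank_Gr hP 0
  have h1 := finrank_Gr hP 1
  have hfin : Module.Finite (ZMod p) (fil P 1) :=
    Module.Finite.of_injective (Submodule.inclusion (fil_one_le_range P))
      (Submodule.inclusion_injective _)
  have hle : fil P 0 ≤ fil P 1 := fil_mono P zero_le_one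
  have hfin0 : Module.Finite (ZMod p) (fil P 0) :=
    Module.Finite.of_injective (Submodule.inclusion hle) (Submodule.inclusion_injective _)
  have e1 : filLT (fil P) 1 = fil P 0 := by
    refine le_antisymm (iSup_le fun m => ?_) fun x hx => mem_filLT zero_lt_one hx
    obtain ⟨m, hm⟩ := m
    obtain rfl : m = 0 := by omega
    exact le_rfl
  have e2 := Submodule.finrank_quotient_add_finrank ((filLT (fil P) 1).submoduleOf (fil P 1))
  have e3 : Module.finrank (ZMod p) ((filLT (fil P) 1).submoduleOf (fil P 1)) =
      Module.finrank (ZMod p) (fil P 0) := by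
    rw [e1]; exact (Submodule.submoduleOfEquivOfLe hle).finrank_eq
  have e4 : Module.finrank (ZMod p) (Gr (fil P) 0) ≤ Module.finrank (ZMod p) (fil P 0) :=
    Submodule.finrank_quotient_le _
  have hdom : Module.finrank (ZMod p) (FpG p × (V2 p ⊗[ZMod p] FpG p)) = 3 * p := by
    rw [Module.finrank_prod, Module.finrank_tensorProduct, finrank_FpG, Module.finrank_fin_fun]
    ring
  have hge : 3 * p ≤ Module.finrank (ZMod p) (fil P 1) := by
    rw [← e2, e3]
    have : Module.finrank (ZMod p) (Gr (fil P) 1) + Module.finrank (ZMod p) (Gr (fil P) 0) =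
        3 * p := by
      rw [h0, h1]; ring
    rw [← this]
    exact Nat.add_le_add le_rfl e4
  have hr := Submodule.finrank_mono (fil_one_le_range P)
  have hk := LinearMap.finrank_range_add_finrank_ker (degreeOneMap P)
  rw [← LinearMap.ker_eq_bot, ← Submodule.finrank_eq_zero (R := ZMod p)]
  omega

variable {P : Params (ZMod p) (TG p) (V2 p)} (hP : Function.Injective (degreeOneMap P))
include hP

theorem of_injective : Function.Injective (H.of P) := by
  intro a a' h
  have : degreeOneMap P (a, 0) = degreeOneMap P (a', 0) := by simpa [degreeOneMap] using h
  exact congrArg Prod.fst (hP this)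

theorem eq_zero_of_vec_one_add {u w : FpG p}
    (h : H.vec P (v1 p) * H.of P u + H.of P w = 0) : u = 0 ∧ w = 0 := by
  have h' : degreeOneMap P (w, v1 p ⊗ₜ u + v2 p ⊗ₜ 0) = degreeOneMap P 0 := by
    rw [map_zero, ← h]; simp [degreeOneMap, add_comm]
  have h'' := hP h'
  have e := congrArg (fun t => tensorCoord 0 t.2) h''
  rw [tensorCoord_zero_basis] at e
  exact ⟨by simpa using e, congrArg Prod.fst h''⟩

theorem kap_self (v : V2 p) : P.kap v v = 0 := by
  refine hP ?_
  rw [map_zero, ← sub_self (H.vec P v * H.vec P v), H.vec_mul_vec_sub]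
  rfl

/-- The cocycle condition on `λ`, by comparing `(h h') v` with `h (h' v)`. -/
theorem lam_mul (h h' : TG p) (v : V2 p) : P.lam (.single (h * h') 1) v =
    P.lam (.single h 1) (h' • v) * .single h' 1 + .single h 1 * P.lam (.single h' 1) v := by
  refine of_injective hP ?_
  have h1 := H.single_mul_vec P (h * h') v
  have e : (MonoidAlgebra.single (h * h') 1 : FpG p) = .single h 1 * .single h' 1 := by
    rw [MonoidAlgebra.single_mul_single, mul_one]
  rw [← sub_eq_iff_eq_add'] at h1
  rw [← h1]
  conv_lhs => rw [e, map_mul, mul_assoc, H.single_mul_vec, mul_add, ← mul_assoc,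
    H.single_mul_vec, mul_smul]
  rw [map_add, map_mul, map_mul]
  noncomm_ring

theorem lam_gpow (b c : FpG p) (hb : P.lam (gpow 1) (v1 p) = b * gpow 1)
    (hc : P.lam (gpow 1) (v2 p) = c * gpow 1) (i : ℕ) :
    P.lam (gpow i) (v1 p) = (i : ZMod p) • (b * gpow i) ∧
    P.lam (gpow i) (v2 p) = ((i.choose 2 : ZMod p) • b + (i : ZMod p) • c) * gpow i := by
  induction i with
  | zero =>
    have h (v : V2 p) : P.lam (gpow 0) v = 0 := by
      have := lam_mul hP 1 1 v
      rw [one_smul, mul_one, ← MonoidAlgebra.one_def, mul_one, one_mul, left_eq_add] at this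
      rw [gpow_zero_eq_one, this]
    simp [h]
  | succ i ih =>
    have key (v : V2 p) : P.lam (gpow (i + 1)) v =
        P.lam (gpow i) (gen p • v) * gpow 1 + gpow i * P.lam (gpow 1) v := by
      have := lam_mul hP (gen p ^ i) (gen p) v
      rw [← pow_succ] at this
      rw [gpow, this, gpow, gpow, pow_one]
    rw [key, key, gen_smul_v1, gen_smul_v2, map_add, ih.1, ih.2, hb, hc, gpow_add,
      Nat.choose_succ_succ' i 1, Nat.choose_one_right]
    push_cast
    simp only [Algebra.smul_def, map_add, map_one]
    constructor <;> ring

/-- The values at `g` determine `λ`, and `κ` is alternating. -/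
theorem exists_eq_mkParams (hp : p ≠ 2) : ∃ b c x y z : FpG p,
    P = mkParams b c (z, v1 p ⊗ₜ x + v2 p ⊗ₜ y) := by
  have hinv : (gpow 1 : FpG p) * gpow (p - 1) = 1 := by
    rw [← gpow_add, Nat.add_sub_cancel' (Fact.out : p.Prime).one_le, gpow_p]
  set b := P.lam (gpow 1) (v1 p) * gpow (p - 1)
  set c := P.lam (gpow 1) (v2 p) * gpow (p - 1)
  have hlam := lam_gpow hP b c (by rw [mul_assoc, mul_comm (gpow _), hinv, mul_one])
    (by rw [mul_assoc, mul_comm (gpow _), hinv, mul_one])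
  obtain ⟨K, hK⟩ : ∃ K, K = P.kap (v1 p) (v2 p) := ⟨_, rfl⟩
  have hanti (v w : V2 p) : P.kap v w = - P.kap w v := by
    have h := kap_self hP (v + w)
    simp only [map_add, LinearMap.add_apply, kap_self hP, zero_add, add_zero] at h
    exact eq_neg_of_add_eq_zero_right h
  refine ⟨b, c, tensorCoord 0 K.2, tensorCoord 1 K.2, K.1, ?_⟩
  rw [← tensor_eq]
  refine Params.ext ?_ ?_
  · refine LinearMap.ext fun a => LinearMap.ext fun v => ?_
    induction a using MonoidAlgebra.induction_linear with
    | zero => simp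
    | add x y hx hy => rw [map_add, map_add, LinearMap.add_apply, LinearMap.add_apply, hx, hy]
    | single h r =>
      have e : (MonoidAlgebra.single h r : FpG p) = r • .single h 1 := by simp
      obtain ⟨i, -, rfl⟩ := exists_gen_pow h
      rw [e, map_smul, map_smul, LinearMap.smul_apply, LinearMap.smul_apply, vec_eq v]
      change r • P.lam (gpow i) _ = r • (mkParams b c _).lam (gpow i) _
      rw [map_add, map_add, map_smul, map_smul, map_smul, map_smul, mkParams_lam_v1,
        mkParams_lam_v2, (hlam i).1, (hlam i).2, euler_gpow, binomD_gpow hp]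
      simp only [Algebra.smul_def]
      ring
  · refine LinearMap.ext fun v => LinearMap.ext fun w => ?_
    rw [mkParams_kap_apply, show ((K.1, K.2) : FpG p × _) = K from rfl]
    conv_lhs => rw [vec_eq v, vec_eq w]
    simp only [map_add, map_smul, LinearMap.add_apply, LinearMap.smul_apply, kap_self hP,
      hanti (v2 p) (v1 p), ← hK]
    module

/-- The two ways of evaluating `g v₁ v₂` yield the conditions on the parameters. -/
theorem conditions_of_injective {b c x y z : FpG p}
    (h : OreRelations 2⁻¹ euler b c x y z (H.of P) (H.vec P (v1 p)) (H.vec P (v2 p)))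
    (hp : p ≠ 2) :
    y = euler b ∧ b * (x + euler c - (2⁻¹ : ZMod p) • (euler (euler b) + euler b)) = 0 := by
  set r₁ := H.vec P (v1 p)
  set r₂ := H.vec P (v2 p)
  set α := H.of P
  set γ : FpG p := gpow 1
  have hγ : euler γ = γ := by rw [euler_gpow, Nat.cast_one, one_smul]
  have hγ2 : binomD (2⁻¹ : ZMod p) euler γ = 0 := by simp [binomD_apply, hγ]
  have g1 : α γ * r₁ = (r₁ + α b) * α γ := by
    rw [h.coeff_mul_one, hγ, map_mul, add_mul]
  have g2 : α γ * r₂ = (r₂ + r₁ + α c) * α γ := by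
    rw [h.coeff_mul_two, hγ, hγ2, mul_zero, zero_add, map_mul, add_mul, add_mul]
  have comm (a a' : FpG p) : α a * α a' = α a' * α a := by rw [← map_mul, mul_comm, map_mul]
  -- the commutator `r₁ r₂ - r₂ r₁` conjugated by `g`, computed in two ways
  have l : α γ * (r₁ * r₂ - r₂ * r₁) =
      ((r₁ + α b) * α x + (r₂ + r₁ + α c) * α y + α z) * α γ := by
    have : r₁ * r₂ - r₂ * r₁ = r₁ * α x + r₂ * α y + α z := by rw [h.one_mul_two]; abel
    rw [this, mul_add, mul_add, ← mul_assoc, ← mul_assoc, g1, g2, mul_assoc, mul_assoc, comm γ,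
      comm γ, comm γ]
    noncomm_ring
  have r : α γ * (r₁ * r₂ - r₂ * r₁) =
      ((r₁ + α b) * (r₂ + r₁ + α c) - (r₂ + r₁ + α c) * (r₁ + α b)) * α γ := by
    rw [mul_sub, ← mul_assoc, ← mul_assoc, g1, g2, mul_assoc, mul_assoc, g1, g2]
    noncomm_ring
  have hc1 := h.coeff_mul_one c
  have hb1 := h.coeff_mul_one b
  have hb2 := h.coeff_mul_two b
  have hcancel : (r₁ + α b) * α x + (r₂ + r₁ + α c) * α y + α z =
      (r₁ + α b) * (r₂ + r₁ + α c) - (r₂ + r₁ + α c) * (r₁ + α b) := by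
    have e := l.symm.trans r
    have hinv : α γ * α (gpow (p - 1)) = 1 := by
      rw [← map_mul, ← gpow_add, Nat.add_sub_cancel' (Fact.out : p.Prime).one_le, gpow_p, map_one]
    have e' := congrArg (· * α (gpow (p - 1))) e
    simpa only [mul_assoc, hinv, mul_one] using e'
  have hexp : (r₁ + α b) * (r₂ + r₁ + α c) - (r₂ + r₁ + α c) * (r₁ + α b) =
      r₁ * α x + r₂ * α y + α z - α (b * euler c) + r₁ * α (euler b) +
        α (b * binomD 2⁻¹ euler b + c * euler b) + α (b * euler b) := by
    have e : (r₁ + α b) * (r₂ + r₁ + α c) - (r₂ + r₁ + α c) * (r₁ + α b) =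
        r₁ * r₂ - r₂ * r₁ + (r₁ * α c - α c * r₁) + (α b * r₂ - r₂ * α b) +
          (α b * r₁ - r₁ * α b) + (α b * α c - α c * α b) := by noncomm_ring
    rw [e, hc1, hb1, hb2, h.one_mul_two, comm b c]
    abel
  rw [hexp] at hcancel
  obtain ⟨e1, e2⟩ := eq_zero_of_vec_one_add hP (u := y - euler b)
    (w := b * x + c * y + b * euler c - (b * binomD 2⁻¹ euler b + c * euler b) - b * euler b) (by
      rw [← sub_eq_zero] at hcancel
      rw [← hcancel]
      simp only [map_add, map_sub, map_mul]
      noncomm_ring)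
  have hy : y = euler b := sub_eq_zero.1 e1
  refine ⟨hy, ?_⟩
  have h2 : algebraMap (ZMod p) (FpG p) 2⁻¹ + algebraMap (ZMod p) (FpG p) 2⁻¹ = 1 := by
    rw [← map_add, half_add_half hp, map_one]
  rw [hy, binomD_apply] at e2
  simp only [Algebra.smul_def] at e2 ⊢
  linear_combination e2 + (- b * euler b) * h2

omit hP

/-- Drinfeld orbifold algebras are given by parameters in normal form. -/
theorem IsDrinfeldOrbifold.exists_eq_mkParams (hp : p ≠ 2) (h : IsDrinfeldOrbifold P) :
    ∃ b c x z : FpG p,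
      b * (x + euler c - (2⁻¹ : ZMod p) • (euler (euler b) + euler b)) = 0 ∧
      P = mkParams b c (z, v1 p ⊗ₜ x + v2 p ⊗ₜ euler b) := by
  have hi := degreeOneMap_injective h
  obtain ⟨b, c, x, y, z, hP⟩ := DrinfeldOrbifold.exists_eq_mkParams hi hp
  obtain ⟨rfl, hb⟩ := conditions_of_injective hi (H.relations b c x y z P hP) hp
  exact ⟨b, c, x, z, hb, hP⟩

end Necessity

/-! ### The ideals of the group algebra -/

section GroupAlgebra

variable {p : ℕ} [Fact p.Prime]

theorem sum_coef (a : FpG p) : ∑ j ∈ Finset.range p, coef a j • gpow j = a := by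
  classical
  ext h
  obtain ⟨i, hi, rfl⟩ := exists_gen_pow h
  rw [MonoidAlgebra.coeff_sum, Finsupp.finsetSum_apply, Finset.sum_eq_single_of_mem i (by simpa)]
  · simp [gpow, coef]
  · intro j hj hji
    have : gen p ^ j ≠ gen p ^ i := fun e => hji (gen_pow_injOn (by simpa using hj) hi e)
    simp [gpow, this]

theorem coef_sum (r : ℕ → ZMod p) {i : ℕ} (hi : i < p) :
    coef (∑ j ∈ Finset.range p, r j • gpow j) i = r i := by
  classical
  rw [coef, MonoidAlgebra.coeff_sum, Finsupp.finsetSum_apply,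
    Finset.sum_eq_single_of_mem i (by simpa)]
  · simp [gpow]
  · intro j hj hji
    have : gen p ^ j ≠ gen p ^ i := fun e => hji (gen_pow_injOn (by simpa using hj) hi e)
    simp [gpow, this]

/-- The augmentation of the group algebra, the sum of the coefficients. -/
def augment : FpG p →ₐ[ZMod p] ZMod p := MonoidAlgebra.lift (ZMod p) (ZMod p) (TG p) 1

theorem augment_gpow (i : ℕ) : augment (gpow i : FpG p) = 1 := by simp [augment, gpow]

theorem augment_eq_sum (a : FpG p) : augment a = ∑ i ∈ Finset.range p, coef a i := by
  conv_lhs => rw [← sum_coef a]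
  simp [augment_gpow]

local notation "τ" => (gpow 1 - 1 : FpG _)

theorem tau_pow_p : (τ : FpG p) ^ p = 0 := by
  have : CharP (FpG p) p := (Algebra.charP_iff (ZMod p) (FpG p) p).1 inferInstance
  rw [sub_pow_char, ← gpow_pow, gpow_p, one_pow, sub_self]

theorem tau_pow_eq_sum (n : ℕ) : (τ : FpG p) ^ n =
    ∑ i ∈ Finset.range (n + 1), ((-1) ^ i * (n.choose i : ZMod p)) • gpow (n - i) := by
  rw [sub_eq_neg_add, add_pow]
  refine Finset.sum_congr rfl fun i _ => ?_
  rw [gpow_pow (n - i), Algebra.smul_def]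
  simp only [map_mul, map_pow, map_neg, map_one, map_natCast]
  ring

/-- The coefficient of `g ^ (p - 1)` in `(g - 1) ^ (p - 1)` is one. -/
theorem tau_pow_ne_zero {n : ℕ} (hn : n < p) : (τ : FpG p) ^ n ≠ 0 := by
  have key : (τ : FpG p) ^ (p - 1) ≠ 0 := by
    intro h
    rw [tau_pow_eq_sum, Nat.sub_add_cancel (Fact.out : p.Prime).one_le,
      ← Finset.sum_range_reflect] at h
    have e := coef_sum (p := p)
      (fun j => (-1) ^ (p - 1 - j) * ((p - 1).choose (p - 1 - j) : ZMod p)) (i := p - 1)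
      (Nat.sub_lt (Fact.out : p.Prime).pos one_pos)
    rw [Finset.sum_congr rfl (g := fun j =>
      ((-1) ^ (p - 1 - j) * ((p - 1).choose (p - 1 - j) : ZMod p)) • gpow (p - 1 - (p - 1 - j)))
      (fun j hj => by rw [Nat.sub_sub_self (by have := Finset.mem_range.1 hj; omega)]), h] at e
    simp [coef] at e
  intro h
  exact key (pow_eq_zero_of_le (by omega) h)

theorem tau_dvd_sub_augment (a : FpG p) : τ ∣ a - augment a • 1 := by
  conv_rhs => rw [augment_eq_sum, Finset.sum_smul, ← sum_coef a, ← Finset.sum_sub_distrib]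
  refine Finset.dvd_sum fun j _ => ?_
  rw [sum_coef, ← smul_sub, gpow_pow j]
  refine dvd_smul_of_dvd _ ?_
  simpa using sub_dvd_pow_sub_pow (gpow 1 : FpG p) 1 j

theorem tau_dvd {a : FpG p} (ha : augment a = 0) : τ ∣ a := by
  simpa [ha] using tau_dvd_sub_augment a

theorem isUnit_of_augment_ne_zero {a : FpG p} (ha : augment a ≠ 0) : IsUnit a := by
  obtain ⟨a', h⟩ := tau_dvd_sub_augment a
  have hn : IsNilpotent (τ * a') := ⟨p, by rw [mul_pow, tau_pow_p, zero_mul]⟩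
  have hu : IsUnit (augment a • (1 : FpG p)) := by
    rw [← Algebra.algebraMap_eq_smul_one]
    exact (isUnit_iff_ne_zero.2 ha).map _
  rw [sub_eq_iff_eq_add] at h
  rw [h]
  exact hn.isUnit_add_right_of_commute hu (Commute.all _ _)

/-- The group algebra is a local principal ideal ring, whose ideals are generated by the powers
of `g - 1`. -/
theorem exists_eq_tau_pow_mul (a : FpG p) :
    ∃ k ≤ p, ∃ a', augment a' ≠ 0 ∧ a = τ ^ k * a' := by
  have key (n : ℕ) (hn : n ≤ p) : (∃ k ≤ p, ∃ a', augment a' ≠ 0 ∧ a = τ ^ k * a') ∨ τ ^ n ∣ a := by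
    induction n with
    | zero => exact Or.inr (by simp)
    | succ n ih =>
      obtain h | ⟨a', h⟩ := ih (by omega)
      · exact Or.inl h
      by_cases ha : augment a' = 0
      · obtain ⟨a'', rfl⟩ := tau_dvd ha
        exact Or.inr ⟨a'', by rw [h, pow_succ, mul_assoc]⟩
      · exact Or.inl ⟨n, by omega, a', ha, h⟩
  obtain h | ⟨a', h⟩ := key p le_rfl
  · exact h
  -- the remaining case is `a = 0 = τ ^ p`
  · exact ⟨p, le_rfl, 1, by simp, by rw [h, tau_pow_p, zero_mul, zero_mul]⟩

theorem le_of_tau_pow_dvd {k n : ℕ} {a : FpG p} (hk : k < p) (ha : augment a ≠ 0)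
    (h : τ ^ n ∣ τ ^ k * a) : n ≤ k := by
  by_contra! hn
  rw [(isUnit_of_augment_ne_zero ha).dvd_mul_right] at h
  refine tau_pow_ne_zero (p := p) (n := p - 1) (by omega) ?_
  have h' := mul_dvd_mul_right h (τ ^ (p - 1 - k))
  rw [← pow_add, ← pow_add, pow_eq_zero_of_le (by omega) tau_pow_p, zero_dvd_iff] at h'
  rwa [show k + (p - 1 - k) = p - 1 by omega] at h'

theorem tau_pow_mul_unique {k k' : ℕ} {a a' : FpG p} (hk : k ≤ p) (hk' : k' ≤ p)
    (ha : augment a ≠ 0) (ha' : augment a' ≠ 0) (h : τ ^ k * a = τ ^ k' * a') : k = k' := by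
  wlog hle : k ≤ k' generalizing k k' a a'
  · exact (this hk' hk ha' ha h.symm (by omega)).symm
  obtain hlt | rfl := hk.lt_or_eq
  · exact le_antisymm hle (le_of_tau_pow_dvd hlt ha (Dvd.intro _ h.symm))
  · omega

theorem mul_eq_zero_iff_tau_pow_dvd {k : ℕ} {a w : FpG p} (hk : k ≤ p) (ha : augment a ≠ 0) :
    τ ^ k * a * w = 0 ↔ τ ^ (p - k) ∣ w := by
  constructor
  · intro h
    rw [mul_right_comm, (isUnit_of_augment_ne_zero ha).mul_left_eq_zero] at h
    obtain ⟨m, hm, w', hw', rfl⟩ := exists_eq_tau_pow_mul w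
    rw [← mul_assoc, ← pow_add] at h
    refine Dvd.dvd.mul_right (pow_dvd_pow _ ?_) _
    by_contra! hlt
    exact tau_pow_ne_zero (p := p) (n := k + m) (by omega)
      ((isUnit_of_augment_ne_zero hw').mul_left_eq_zero.1 h)
  · rintro ⟨w', rfl⟩
    rw [mul_mul_mul_comm, ← pow_add, Nat.add_sub_cancel' hk, tau_pow_p, zero_mul]

/-- The combination `∑ (-1)^m d_m g^(m+1) (g - 1)^(p-(m+1))`. The parameters `d` enter `λ` and `κ`
as the coefficients of this element. -/
def annElement {k : ℕ} (d : Fin k → ZMod p) : FpG p :=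
  ∑ m : Fin k, ((-1) ^ (m : ℕ) * d m) • (gpow (m + 1) * τ ^ (p - (m + 1)))

theorem annElement_snoc {k : ℕ} (d : Fin k → ZMod p) (s : ZMod p) :
    annElement (Fin.snoc d s : Fin (k + 1) → ZMod p) =
      annElement d + τ ^ (p - (k + 1)) * (((-1) ^ k * s) • gpow (k + 1)) := by
  rw [annElement, Fin.sum_univ_castSucc, annElement]
  simp only [Fin.snoc_castSucc, Fin.snoc_last, Fin.val_castSucc, Fin.val_last]
  rw [mul_smul_comm, mul_comm (gpow (k + 1))]

/-- The elements `g^(m+1) (g - 1)^(p-(m+1))` for `m < k` are a basis of the ideal generated by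
`(g - 1)^(p-k)`, which is the annihilator of `(g - 1)^k`: they are triangular with respect to
the powers of `g - 1`. -/
theorem existsUnique_annElement {k : ℕ} (hk : k ≤ p) {w : FpG p} (hw : τ ^ (p - k) ∣ w) :
    ∃! d : Fin k → ZMod p, annElement d = w := by
  induction k generalizing w with
  | zero =>
    have : w = 0 := by rw [Nat.sub_zero, tau_pow_p] at hw; exact zero_dvd_iff.1 hw
    exact ⟨Fin.elim0, by simp [annElement, this], fun d _ => Subsingleton.elim _ _⟩
  | succ k ih =>
    have hpk : p - k = p - (k + 1) + 1 := by omega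
    have hsq : ((-1) ^ k * (-1) ^ k : ZMod p) = 1 := by rw [← mul_pow]; simp
    obtain ⟨w', rfl⟩ := hw
    have hdvd : τ ^ (p - k) ∣
        τ ^ (p - (k + 1)) * w' - τ ^ (p - (k + 1)) * (augment w' • gpow (k + 1)) := by
      rw [← mul_sub, hpk, pow_succ]
      exact mul_dvd_mul_left _ (tau_dvd (by simp [augment_gpow]))
    obtain ⟨d, hd, hd'⟩ := ih (by omega) hdvd
    refine ⟨Fin.snoc d ((-1) ^ k * augment w'), ?_, fun e he => ?_⟩
    · change annElement _ = _
      rw [annElement_snoc, hd, ← mul_assoc, hsq, one_mul, sub_add_cancel]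
    · obtain ⟨e', s, rfl⟩ : ∃ (e' : Fin k → ZMod p) (s : ZMod p), e = Fin.snoc e' s :=
        ⟨Fin.init e, e (Fin.last k), (Fin.snoc_init_self e).symm⟩
      rw [annElement_snoc] at he
      have hmem : τ ^ (p - k) ∣ annElement e' := by
        refine Finset.dvd_sum fun m _ => ?_
        exact dvd_smul_of_dvd _ (Dvd.dvd.mul_left (pow_dvd_pow _ (by omega)) _)
      have hs : s = (-1) ^ k * augment w' := by
        have h1 : τ ^ (p - k) ∣ τ ^ (p - (k + 1)) * (w' - ((-1) ^ k * s) • gpow (k + 1)) := by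
          rw [mul_sub, ← he, add_sub_cancel_right]
          exact hmem
        by_contra hne
        have h2 := le_of_tau_pow_dvd (by omega) (fun h => hne ?_) h1
        · omega
        · rw [map_sub, map_smul, augment_gpow, smul_eq_mul, mul_one, sub_eq_zero] at h
          rw [h, ← mul_assoc, hsq, one_mul]
      subst hs
      rw [← mul_assoc, hsq, one_mul] at he
      rw [hd' e' (eq_sub_of_add_eq he)]

theorem tau_pow_dvd_annElement {k : ℕ} (d : Fin k → ZMod p) : τ ^ (p - k) ∣ annElement d :=
  Finset.dvd_sum fun m _ =>
    dvd_smul_of_dvd _ (Dvd.dvd.mul_left (pow_dvd_pow _ (by omega)) _)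

theorem annElement_injective {k : ℕ} (hk : k ≤ p) :
    Function.Injective (annElement (p := p) (k := k)) := fun d _ h =>
  (existsUnique_annElement hk (tau_pow_dvd_annElement d)).unique rfl h.symm

/-- The expansion of the annihilator basis. The leading term `g ^ p = 1` is split off, as it
contributes to the coefficient of `v₁` in `κ`, and the others contribute to `λ`. -/
theorem gpow_mul_tau_pow {m : ℕ} (hm : m < p) :
    (gpow (m + 1) * τ ^ (p - (m + 1)) : FpG p) =
      1 + ∑ j ∈ Finset.range p,
        ((-1) ^ (p - j) * ((p - (m + 1)).choose (p - j) : ZMod p)) • gpow j := by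
  have hsub : Finset.range (p - (m + 1) + 1) ⊆ Finset.range (p + 1) := by
    intro i; simp only [Finset.mem_range]; omega
  have e : (gpow (m + 1) * τ ^ (p - (m + 1)) : FpG p) = ∑ i ∈ Finset.range (p + 1),
      ((-1) ^ i * ((p - (m + 1)).choose i : ZMod p)) • gpow (p - i) := by
    rw [tau_pow_eq_sum, Finset.mul_sum, ← Finset.sum_subset hsub]
    · refine Finset.sum_congr rfl fun i hi => ?_
      rw [mul_smul_comm, ← gpow_add]
      congr 2
      have := Finset.mem_range.1 hi
      omega
    · intro i _ hi
      rw [Nat.choose_eq_zero_of_lt (by simpa [Nat.lt_succ_iff] using hi)]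
      simp
  rw [e, ← Finset.sum_range_reflect, Finset.sum_range_succ, add_comm]
  congr 1
  · simp [gpow_p]
  · refine Finset.sum_congr rfl fun j hj => ?_
    have := Finset.mem_range.1 hj
    rw [show p + 1 - 1 - j = p - j by omega, Nat.sub_sub_self this.le]

theorem annElement_eq {k : ℕ} (hk : k ≤ p) (d : Fin k → ZMod p) : annElement d =
    (∑ m : Fin k, (-1) ^ (m : ℕ) * d m) • 1 + ∑ j ∈ Finset.range p, mu d j • gpow j := by
  simp only [mu, Finset.mul_sum, Finset.sum_smul]
  rw [Finset.sum_comm, ← Finset.sum_add_distrib]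
  refine Finset.sum_congr rfl fun m _ => ?_
  rw [gpow_mul_tau_pow (by omega), smul_add, Finset.smul_sum]
  congr 1
  refine Finset.sum_congr rfl fun j _ => ?_
  rw [smul_smul]
  congr 1
  ring

end GroupAlgebra

/-! ### Coboundaries of parameters in normal form -/

section Coboundaries

variable {p : ℕ} [Fact p.Prime]

theorem commVG_single (v : V2 p) (h : TG p) (r : ZMod p) :
    commVG v (.single h r : FpG p) = r • ((v - h • v) ⊗ₜ .single h 1) := by
  simp [commVG]

theorem commVG_v1 (a : FpG p) : commVG (v1 p) a = 0 := by
  induction a using MonoidAlgebra.induction_linear with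
  | zero => exact commVG_zero _
  | add a a' h h' => rw [commVG_add, h, h', add_zero]
  | single h r => rw [commVG_single, smul_v1, sub_self, zero_tmul, smul_zero]

theorem commVG_v2 (a : FpG p) : commVG (v2 p) a = -(v1 p ⊗ₜ euler a) := by
  induction a using MonoidAlgebra.induction_linear with
  | zero => rw [commVG_zero, map_zero, tmul_zero, neg_zero]
  | add a a' h h' => rw [commVG_add, h, h', map_add, tmul_add, neg_add]
  | single h r =>
    rw [commVG_single, smul_v2, sub_add_cancel_right, neg_tmul, smul_neg, euler_single,
      ← smul_tmul', tmul_smul, show (MonoidAlgebra.single h r : FpG p) = r • .single h 1 by simp,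
      tmul_smul, smul_comm]

theorem commVG_smul_add (s s' : ZMod p) (a : FpG p) :
    commVG (s • v1 p + s' • v2 p) a = -(v1 p ⊗ₜ (s' • euler a)) := by
  have hlin (v w : V2 p) : commVG (s • v + s' • w) a = s • commVG v a + s' • commVG w a := by
    induction a using MonoidAlgebra.induction_linear with
    | zero => simp only [commVG_zero, smul_zero, add_zero]
    | add a a' h h' => rw [commVG_add, h, h', commVG_add, commVG_add]; module
    | single h r =>
      simp only [commVG_single]
      rw [smul_add, smul_comm h, smul_comm h, add_sub_add_comm, ← smul_sub, ← smul_sub, add_tmul,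
        ← smul_tmul', ← smul_tmul']
      module
  rw [hlin, commVG_v1, commVG_v2, smul_zero, zero_add, tmul_smul, smul_neg]

theorem isUnit_gpow (i : ℕ) : IsUnit (gpow i : FpG p) :=
  isUnit_of_augment_ne_zero (by rw [augment_gpow]; exact one_ne_zero)

/-- Adding a coboundary of `f` only matters through `f v₁`: it subtracts `f v₁` from `c` and adds
its Euler derivative to `x`, so that `x + euler c` is a complete invariant. -/
theorem diffByCoboundary_mkParams_iff {b c x y z b' c' x' y' z' : FpG p} :
    DiffByCoboundary (mkParams b c (z, v1 p ⊗ₜ x + v2 p ⊗ₜ y))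
      (mkParams b' c' (z', v1 p ⊗ₜ x' + v2 p ⊗ₜ y')) ↔
    b = b' ∧ z = z' ∧ y = y' ∧ x + euler c = x' + euler c' := by
  have hγ : euler (gpow 1 : FpG p) = gpow 1 := by rw [euler_gpow, Nat.cast_one, one_smul]
  have hγ2 : binomD 2⁻¹ euler (gpow 1 : FpG p) = 0 := by simp [binomD_apply, hγ]
  have hγ1 : (gpow 1 : FpG p) = .single (gen p) 1 := by rw [gpow, pow_one]
  constructor
  · rintro ⟨f, hl, hk⟩
    have e1 := hl (gen p) (v1 p)
    have e2 := hl (gen p) (v2 p)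
    rw [← hγ1, mkParams_lam_v1, mkParams_lam_v1, hγ, gen_smul_v1, mul_comm _ (f _), sub_self,
      add_zero] at e1
    rw [← hγ1, mkParams_lam_v2, mkParams_lam_v2, hγ, hγ2, gen_smul_v2, map_add, mul_zero, zero_add,
      mul_zero, zero_add, mul_comm _ (f _), ← sub_mul, ← add_mul] at e2
    have e1' := (isUnit_gpow 1).mul_right_cancel e1
    have e2' := (isUnit_gpow 1).mul_right_cancel e2
    obtain ⟨e3, e4⟩ := hk (v1 p) (v2 p)
    rw [mkParams_kap_v1_v2, mkParams_kap_v1_v2] at e3 e4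
    dsimp only at e3 e4
    rw [commVG_v1, commVG_v2, zero_sub, neg_neg, add_right_comm, ← tmul_add] at e4
    have e5 := congrArg (tensorCoord 0) e4
    have e6 := congrArg (tensorCoord 1) e4
    rw [tensorCoord_zero_basis, tensorCoord_zero_basis] at e5
    rw [tensorCoord_one_basis, tensorCoord_one_basis] at e6
    refine ⟨e1'.symm, e3.symm, e6.symm, ?_⟩
    rw [e5, e2', map_add, map_sub, map_add]
    abel
  · rintro ⟨rfl, rfl, rfl, hx⟩
    have hx' : x' = x + euler (c - c') := by rw [map_sub, ← add_sub_assoc, hx, add_sub_cancel_right]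
    refine ⟨(LinearMap.proj 0).smulRight (c - c'), fun h v => ?_, fun v w => ⟨rfl, ?_⟩⟩
    · rw [mkParams_lam_apply, mkParams_lam_apply]
      conv_rhs => rw [vec_eq v]
      rw [smul_add h, smul_comm h, smul_comm h, smul_v1, smul_v2, euler_single]
      simp only [v1, v2, LinearMap.smulRight_apply, LinearMap.proj_apply, Pi.add_apply,
        Pi.smul_apply, Matrix.cons_val_zero, Matrix.cons_val_one, smul_eq_mul]
      simp only [Algebra.smul_def, map_add, map_mul, map_one, map_zero]
      ring
    · rw [mkParams_kap_apply, mkParams_kap_apply, vec_eq v, vec_eq w, commVG_smul_add,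
        commVG_smul_add]
      simp only [v1, v2, LinearMap.smulRight_apply, LinearMap.proj_apply, Pi.add_apply,
        Pi.smul_apply, Matrix.cons_val_zero, Matrix.cons_val_one, smul_eq_mul, Prod.smul_snd,
        Derivation.map_smul, hx', tmul_add, tmul_smul]
      module

end Coboundaries

/-! ### The parameters attached to a choice -/

section Choices

variable {p : ℕ} [Fact p.Prime]

/-- The element `λ(g, v₂) g⁻¹` of the parameters attached to a choice. -/
def Choice.offset (c : Choice p) : FpG p :=
  ∑ j ∈ Finset.range p,
    ((j : ZMod p) ^ (p - 2) * (((j + 1).choose 2 : ZMod p) * coef c.b j + mu c.d j)) • gpow j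

/-- The coefficient of `v₁` in `κ(v₁, v₂)`, for the parameters attached to a choice. -/
def Choice.slope (c : Choice p) : FpG p := (∑ m : Fin c.k, (-1) ^ (m : ℕ) * c.d m) • 1

/-- The parameters attached to a choice, in normal form. -/
def Choice.params (c : Choice p) : Params (ZMod p) (TG p) (V2 p) :=
  mkParams c.b c.offset (c.kapC, v1 p ⊗ₜ c.slope + v2 p ⊗ₜ euler c.b)

theorem Choice.gives_params (hp : p ≠ 2) (c : Choice p) : c.Gives c.params := by
  refine ⟨fun i _ => ?_, fun i _ => ?_, ?_, fun v => ?_⟩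
  · rw [params, mkParams_lam_v1, euler_gpow, mul_smul_comm]
  · have hb : c.b * gpow i = ∑ j ∈ Finset.range p, coef c.b j • gpow (i + j) := by
      conv_lhs => rw [← sum_coef c.b, Finset.sum_mul]
      exact Finset.sum_congr rfl fun j _ => by rw [smul_mul_assoc, ← gpow_add, add_comm j i]
    have hc : c.offset * gpow i = ∑ j ∈ Finset.range p, ((j : ZMod p) ^ (p - 2) *
        (((j + 1).choose 2 : ZMod p) * coef c.b j + mu c.d j)) • gpow (i + j) := by
      rw [offset, Finset.sum_mul]
      exact Finset.sum_congr rfl fun j _ => by rw [smul_mul_assoc, ← gpow_add, add_comm j i]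
    rw [params, mkParams_lam_v2, euler_gpow, binomD_gpow hp, mul_smul_comm, mul_smul_comm, hb, hc,
      Finset.smul_sum, Finset.smul_sum, Finset.smul_sum, ← Finset.sum_add_distrib,
      ← Finset.sum_add_distrib]
    refine Finset.sum_congr rfl fun j _ => ?_
    module
  · rw [params, mkParams_kap_v1_v2, slope, tmul_smul]
    conv_lhs => rw [← sum_coef c.b]
    simp only [map_sum, Derivation.map_smul, euler_gpow, smul_smul, tmul_sum, tmul_smul,
      mul_comm (coef c.b _)]
  · rw [params, mkParams_kap_apply, mul_comm, sub_self, zero_smul]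

theorem Choice.Gives.unique {c : Choice p} {P Q : Params (ZMod p) (TG p) (V2 p)} (hP : c.Gives P)
    (hQ : c.Gives Q) : P = Q := by
  obtain ⟨h1, h2, h3, h4⟩ := hP
  obtain ⟨h1', h2', h3', h4'⟩ := hQ
  refine Params.ext (LinearMap.ext fun a => LinearMap.ext fun v => ?_)
    (LinearMap.ext fun v => LinearMap.ext fun w => ?_)
  · induction a using MonoidAlgebra.induction_linear with
    | zero => simp
    | add x y hx hy => rw [map_add, map_add, LinearMap.add_apply, LinearMap.add_apply, hx, hy]
    | single h r =>
      have e : (MonoidAlgebra.single h r : FpG p) = r • .single h 1 := by simp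
      obtain ⟨i, hi, rfl⟩ := exists_gen_pow h
      rw [e, map_smul, map_smul, LinearMap.smul_apply, LinearMap.smul_apply, vec_eq v]
      change r • P.lam (gpow i) _ = r • Q.lam (gpow i) _
      simp only [map_add, map_smul, h1 i hi, h2 i hi, h1' i hi, h2' i hi]
  · have hanti {P : Params (ZMod p) (TG p) (V2 p)} (h : ∀ v, P.kap v v = 0) (v w : V2 p) :
        P.kap v w = - P.kap w v := by
      have h' := h (v + w)
      simp only [map_add, LinearMap.add_apply, h, zero_add, add_zero] at h'
      exact eq_neg_of_add_eq_zero_right h'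
    rw [vec_eq v, vec_eq w]
    simp only [map_add, map_smul, LinearMap.add_apply, LinearMap.smul_apply, h4, h4',
      hanti h4 (v2 p) (v1 p), hanti h4' (v2 p) (v1 p), h3, h3']

theorem Choice.gives_iff (hp : p ≠ 2) {c : Choice p} {P : Params (ZMod p) (TG p) (V2 p)} :
    c.Gives P ↔ P = c.params :=
  ⟨fun h => h.unique (c.gives_params hp), fun h => h ▸ c.gives_params hp⟩

theorem mu_zero {k : ℕ} (d : Fin k → ZMod p) : mu d 0 = 0 := by
  rw [mu, Finset.sum_eq_zero, mul_zero]
  intro m _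
  rw [Nat.choose_eq_zero_of_lt (by have := (Fact.out : p.Prime).pos; omega), Nat.cast_zero,
    mul_zero, zero_mul]

/-- The factors `j^(p-2) = j⁻¹` undo the Euler derivation. -/
theorem Choice.slope_add_euler_offset (hp : p ≠ 2) (c : Choice p) :
    c.slope + euler c.offset - (2⁻¹ : ZMod p) • (euler (euler c.b) + euler c.b) =
      annElement c.d := by
  rw [annElement_eq c.k_le, slope, add_sub_assoc]
  congr 1
  conv_lhs => rw [← sum_coef c.b, offset]
  simp only [map_sum, Derivation.map_smul, euler_gpow, Finset.smul_sum,
    ← Finset.sum_add_distrib, ← Finset.sum_sub_distrib]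
  refine Finset.sum_congr rfl fun j hj => ?_
  rw [choose_two_cast hp, Nat.cast_add, Nat.cast_one]
  obtain rfl | hj0 := eq_or_ne j 0
  -- no division by `j = 0` is needed, as all terms vanish
  · simp [mu_zero]
  · have hj' : (j : ZMod p) ≠ 0 := by
      rw [Ne, ZMod.natCast_eq_zero_iff]
      exact fun h => hj0 (Nat.eq_zero_of_dvd_of_lt h (Finset.mem_range.1 hj))
    have hinv : (j : ZMod p) * (j : ZMod p) ^ (p - 2) = 1 := by
      rw [← pow_succ', show p - 2 + 1 = p - 1 by have := (Fact.out : p.Prime).two_le; omega,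
        ZMod.pow_card_sub_one_eq_one hj']
    simp only [smul_smul, ← add_smul, ← sub_smul]
    congr 1
    linear_combination (2⁻¹ * ((j + 1 : ZMod p) * (j + 1) - (j + 1)) * coef c.b j + mu c.d j) * hinv

theorem Choice.mul_annElement (c : Choice p) : c.b * annElement c.d = 0 := by
  obtain ⟨b', h, hb⟩ := c.b_eq
  rw [hb]
  exact (mul_eq_zero_iff_tau_pow_dvd c.k_le (by rwa [augment_eq_sum])).2
    (tau_pow_dvd_annElement _)

theorem Choice.isDrinfeldOrbifold (hp : p ≠ 2) (c : Choice p) : IsDrinfeldOrbifold c.params :=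
  isDrinfeldOrbifold_mkParams hp (by rw [c.slope_add_euler_offset hp, c.mul_annElement])

/-- A choice is determined by `b`, the corresponding annihilator element of `b`, and `κ^C`. -/
theorem Choice.ext_annElement {c c' : Choice p} (hb : c.b = c'.b)
    (hd : annElement c.d = annElement c'.d) (hk : c.kapC = c'.kapC) : c = c' := by
  obtain ⟨k, hkp, b, hb1, d, z⟩ := c
  obtain ⟨k', hkp', b', hb1', d', z'⟩ := c'
  obtain ⟨e, he, he'⟩ := hb1
  obtain ⟨f, hf, hf'⟩ := hb1'
  dsimp only at hb hd hk
  rw [← augment_eq_sum] at he hf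
  obtain rfl := tau_pow_mul_unique hkp hkp' he hf (he'.symm.trans (hb.trans hf'))
  obtain rfl := annElement_injective hkp hd
  subst hb hk
  rfl

theorem Choice.exists_of_mul_eq_zero {b w : FpG p} (h : b * w = 0) (z : FpG p) :
    ∃ c : Choice p, c.b = b ∧ annElement c.d = w ∧ c.kapC = z := by
  obtain ⟨k, hk, a, ha, rfl⟩ := exists_eq_tau_pow_mul b
  obtain ⟨d, hd, -⟩ := existsUnique_annElement hk ((mul_eq_zero_iff_tau_pow_dvd hk ha).1 h)
  exact ⟨⟨k, hk, _, ⟨a, by rwa [← augment_eq_sum], rfl⟩, d, z⟩, rfl, hd, rfl⟩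

/-- The parameters attached to a choice in terms of the complete invariant. -/
theorem Choice.diffByCoboundary_iff (hp : p ≠ 2) {c : Choice p} {b e x z : FpG p} :
    DiffByCoboundary c.params (mkParams b e (z, v1 p ⊗ₜ x + v2 p ⊗ₜ euler b)) ↔
      c.b = b ∧ c.kapC = z ∧
        annElement c.d = x + euler e - (2⁻¹ : ZMod p) • (euler (euler b) + euler b) := by
  rw [params, diffByCoboundary_mkParams_iff, ← c.slope_add_euler_offset hp]
  constructor
  · rintro ⟨h1, h2, -, h3⟩
    exact ⟨h1, h2, by rw [h1, h3]⟩
  · rintro ⟨h1, h2, h3⟩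
    rw [h1] at h3
    exact ⟨h1, h2, by rw [h1], sub_left_injective h3⟩

theorem existsUnique_choice (hp : p ≠ 2) {Q : Params (ZMod p) (TG p) (V2 p)}
    (hQ : IsDrinfeldOrbifold Q) : ∃! c : Choice p, DiffByCoboundary c.params Q := by
  obtain ⟨b, e, x, z, h, rfl⟩ := hQ.exists_eq_mkParams hp
  obtain ⟨c, h1, h2, h3⟩ := Choice.exists_of_mul_eq_zero h z
  refine ⟨c, (c.diffByCoboundary_iff hp).2 ⟨h1, h3, h2⟩, fun c' hc' => ?_⟩
  obtain ⟨h1', h3', h2'⟩ := (c'.diffByCoboundary_iff hp).1 hc'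
  exact Choice.ext_annElement (h1'.trans h1.symm) (h2'.trans h2.symm) (h3'.trans h3.symm)

end Choices

/-! ### Counting -/

section Counting

variable {p : ℕ} [Fact p.Prime]

local notation "τ" => (gpow 1 - 1 : FpG _)

theorem natCard_FpG : Nat.card (FpG p) = p ^ p := by
  rw [Module.natCard_eq_pow_finrank (K := ZMod p), finrank_FpG, Nat.card_zmod]

instance : Finite (FpG p) := Module.finite_of_finite (ZMod p)

theorem natCard_tau_pow_dvd {k : ℕ} (hk : k ≤ p) :
    Nat.card {w : FpG p // τ ^ (p - k) ∣ w} = p ^ k := by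
  rw [← Nat.card_congr (Equiv.ofBijective
    (fun d : Fin k → ZMod p => (⟨annElement d, tau_pow_dvd_annElement d⟩ :
      {w : FpG p // τ ^ (p - k) ∣ w})) ⟨fun d d' h => annElement_injective hk (Subtype.ext_iff.1 h),
        fun w => ?_⟩)]
  · simp
  · obtain ⟨d, hd, -⟩ := existsUnique_annElement hk w.2
    exact ⟨d, Subtype.ext hd⟩

/-- The pairs with product zero are counted by summing over `b` the size `p^k` of the annihilator
of `b = (g - 1)^k (unit)`, written as `1 + ∑_{m < k} p^m (p - 1)`; for each `m`, there are
`p^(p-m-1)` elements `b` divisible by `(g - 1)^(m+1)`. -/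
theorem natCard_mul_eq_zero : Nat.card {t : FpG p × FpG p // t.1 * t.2 = 0} = p ^ (p + 1) := by
  classical
  have := Fintype.ofFinite (FpG p)
  have hp1 := (Fact.out : p.Prime).one_le
  have hstep (n : ℕ) : p ^ n + p ^ n * (p - 1) = p ^ (n + 1) := by
    rw [← mul_one_add, Nat.add_sub_cancel' hp1, pow_succ]
  have hgeom (n : ℕ) : 1 + ∑ m ∈ Finset.range n, p ^ m * (p - 1) = p ^ n := by
    induction n with
    | zero => simp
    | succ n ih => rw [Finset.sum_range_succ, ← add_assoc, ih, hstep]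
  have hann (b : FpG p) : Nat.card {w : FpG p // b * w = 0} =
      1 + ∑ m ∈ Finset.range p, if τ ^ (m + 1) ∣ b then p ^ m * (p - 1) else 0 := by
    obtain ⟨k, hk, a, ha, rfl⟩ := exists_eq_tau_pow_mul b
    have h (m : ℕ) (hm : m ∈ Finset.range p) : τ ^ (m + 1) ∣ τ ^ k * a ↔ m < k := by
      refine ⟨fun h => ?_, fun h => Dvd.dvd.mul_right (pow_dvd_pow _ h) _⟩
      obtain hk | rfl := hk.lt_or_eq
      · exact le_of_tau_pow_dvd hk ha h
      -- for `k = p` both sides hold throughout the range of `m`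
      · exact Finset.mem_range.1 hm
    rw [Finset.sum_congr rfl fun m hm => if_congr (h m hm) rfl rfl, ← Finset.sum_filter,
      show (Finset.range p).filter (· < k) = Finset.range k by ext; simp; omega,
      hgeom]
    simp only [mul_eq_zero_iff_tau_pow_dvd hk ha]
    rw [natCard_tau_pow_dvd hk]
  have hlevel (m : ℕ) (hm : m ∈ Finset.range p) :
      (Finset.univ.filter fun b : FpG p => τ ^ (m + 1) ∣ b).card = p ^ (p - (m + 1)) := by
    have hm' := Finset.mem_range.1 hm
    have h := natCard_tau_pow_dvd (p := p) (k := p - (m + 1)) (by omega)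
    rwa [Nat.sub_sub_self hm', Nat.card_eq_fintype_card, Fintype.card_subtype] at h
  rw [Nat.card_congr (Equiv.subtypeProdEquivSigmaSubtype fun b w : FpG p => b * w = 0),
    Nat.card_sigma, Finset.sum_congr rfl fun b _ => hann b, Finset.sum_add_distrib,
    Finset.sum_const, Finset.card_univ, ← Nat.card_eq_fintype_card, natCard_FpG, Finset.sum_comm]
  simp only [← Finset.sum_filter, Finset.sum_const, smul_eq_mul, mul_one]
  rw [Finset.sum_congr rfl (g := fun _ => p ^ (p - 1) * (p - 1)) fun m hm => ?_]
  · rw [Finset.sum_const, Finset.card_range, smul_eq_mul, ← mul_assoc, ← pow_succ',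
      Nat.sub_add_cancel hp1, hstep]
  · rw [hlevel m hm, ← mul_assoc, ← pow_add]
    congr 2
    have := Finset.mem_range.1 hm
    omega

theorem natCard_choice : Nat.card (Choice p) = p ^ (2 * p + 1) := by
  rw [Nat.card_congr (Equiv.ofBijective
    (fun c : Choice p => ((⟨(c.b, annElement c.d), c.mul_annElement⟩, c.kapC) :
      {t : FpG p × FpG p // t.1 * t.2 = 0} × FpG p)) ⟨fun c c' h => ?_, fun t => ?_⟩),
    Nat.card_prod, natCard_mul_eq_zero, natCard_FpG, ← pow_add]
  · congr 1; omega
  · rw [Prod.mk.injEq, Subtype.mk.injEq, Prod.mk.injEq] at h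
    exact Choice.ext_annElement h.1.1 h.1.2 h.2
  · obtain ⟨⟨⟨b, w⟩, h⟩, z⟩ := t
    obtain ⟨c, rfl, rfl, rfl⟩ := Choice.exists_of_mul_eq_zero h z
    exact ⟨c, rfl⟩

theorem natCard_quotient (hp : p ≠ 2) :
    Nat.card (Quotient (coboundarySetoid (ZMod p) (TG p) (V2 p))) = Nat.card (Choice p) := by
  refine (Nat.card_congr (Equiv.ofBijective (fun c : Choice p =>
    (⟦⟨c.params, c.isDrinfeldOrbifold hp⟩⟧ :
      Quotient (coboundarySetoid (ZMod p) (TG p) (V2 p)))) ⟨fun c c' h => ?_, fun q => ?_⟩)).symm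
  · have h' : DiffByCoboundary c.params c'.params := Quotient.exact h
    exact (existsUnique_choice hp (c'.isDrinfeldOrbifold hp)).unique h'
      (diffByCoboundary_equivalence.refl _)
  · obtain ⟨Q, rfl⟩ := Quotient.exists_rep q
    obtain ⟨c, hc, -⟩ := existsUnique_choice hp Q.2
    exact ⟨c, Quotient.sound hc⟩

end Counting

end DrinfeldOrbifold

end

open DrinfeldOrbifold in
theorem theorem7 (p : ℕ) [Fact p.Prime] (hp : p ≠ 2) :
    (∀ c : Choice p, ∃! P : Params (ZMod p) (TG p) (V2 p), c.Gives P) ∧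
    (∀ (c : Choice p) (P : Params (ZMod p) (TG p) (V2 p)), c.Gives P → IsDrinfeldOrbifold P) ∧
    (∀ Q : Params (ZMod p) (TG p) (V2 p), IsDrinfeldOrbifold Q →
      ∃! c : Choice p, ∃ P : Params (ZMod p) (TG p) (V2 p), c.Gives P ∧ DiffByCoboundary P Q) ∧
    Nat.card (Quotient (coboundarySetoid (ZMod p) (TG p) (V2 p))) = p ^ (2 * p + 1) := by
  simp only [Choice.gives_iff hp, existsUnique_eq, exists_eq_left, implies_true, forall_eq,
    true_and]
  exact ⟨fun c => c.isDrinfeldOrbifold hp, fun Q hQ => existsUnique_choice hp hQ,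
    (natCard_quotient hp).trans natCard_choice⟩
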